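/- Let $n\ge 4$ and $s\ge 1$. Use the alphabet $1<\dots<n-1<{n\atop \bar n}<\overline{n-1}<\dots<\bar 1$ ($n,\bar n$ incomparable, $\bar{\bar a}=a$), and write $(a,b)$ for a column with $a$ on top of $b$. Let $\mathcal T(s)$ be the set of $2\times s$ tableaux $T$ with weakly increasing rows, with $b\not\le a$ for every column $(a,b)$, and in which no column $(n-1,n)$ stands to the left of a column $(n,\overline{n-1})$ and no column $(n-1,\bar n)$ to the left of a column $(\bar n,\overline{n-1})$. The type $D_n$ crystal $B(k\varpi_2)$ is the set of those $T\in\mathcal T(k)$ without a column $(1,\bar 1)$ and in which no column $(a,\bar a)$ has a left neighbour with top entry $a$ or a right neighbour with bottom entry $\bar a$. For $1\le i\le n$ the operators $\tilde e_i,\tilde f_i$ act on it through the column word $b_1a_1b_2a_2\cdots$, viewed in a tensor power of the vector crystal $B(\varpi_1)$. On tensor products $$\tilde f_i(b_2\otimes b_1)=\begin{cases}\tilde f_i b_2\otimes b_1&\varepsilon_i(b_2)\ge\varphi_i(b_1)\\ b_2\otimes\tilde f_i b_1&\text{otherwise}\end{cases}\qquad \tilde e_i(b_2\otimes b_1)=\begin{cases}\tilde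 e_i b_2\otimes b_1&\varepsilon_i(b_2)>\varphi_i(b_1)\\ b_2\otimes\tilde e_i b_1&\text{otherwise.}\end{cases}$$ The height-two drop map $D:\mathcal T(s)\to\bigsqcup_{k=0}^sB(k\varpi_2)$ is a bijection. It is the identity on $B(s\varpi_2)$ and sends the tableau with all columns $(1,\bar 1)$ to the empty tableau. In every other tableau there is a unique $a\in\{1,\dots,n,\bar n\}$ with a maximal block of columns $(a,\bar a)$ which either has a left neighbour with top entry $a$ or a right neighbour with bottom entry $\bar a$ (then $D$ deletes the block), or has neither and has at least two columns (then $D$ deletes all but one of them). Transport $\tilde e_i,\tilde f_i$, $1\le i\le n$, to $\mathcal T(s)$ along $D$. The connected components of $\mathcal T(s)$ under the colours $2,\dots,n$ are $D_{n-1}$-crystals. Such a component $v$ inside $B(k\varpi_2)$ has a shape (its $D_{n-1}$-highest weight) and a rank $R(v)=r_k(v)+s-k$, where $r_k(v)$ is the number of $1$-arrows on a path from the highest weight vector of $B(k\varpi_2)$ to $v$. Inside $B(k\varpi_2)$ a component is determined by its shape and rank. Let $\ell$ be the least index such that $B(\ell\varpi_2)$ has a component with the shape and rank of $v$. Let $\check\sigma(v)$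 be the component of the same shape as $v$ and of rank $2s-R(v)$ in $B((s+\ell-k)\varpi_2)$. The involution $\sigma$ of $\mathcal T(s)$ maps each component $v$ to $\check\sigma(v)$ by the isomorphism of $D_{n-1}$-crystals. The affine crystal $\tilde B^{2,s}$ of type $D_n^{(1)}$ is $\mathcal T(s)$ with these $\tilde e_i,\tilde f_i$ for $1\le i\le n$ and $\tilde e_0=\sigma\tilde e_1\sigma$, $\tilde f_0=\sigma\tilde f_1\sigma$. **Lemma.** The crystal $\tilde B^{2,s}\otimes\tilde B^{2,s}$ is connected. Moreover, every element $b\otimes b'$ is sent to $u_0\otimes u_0$ by some finite sequence of operators $\tilde e_i$, $i\in\{0,1,\dots,n\}$, where $u_0$ is the tableau with all columns $(1,\bar 1)$, i.e. the unique element of $B(0)\subset\tilde B^{2,s}$. -/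

import Mathlib

namespace TypeD

/-! ## Abstract Kashiwara operators and tensor products -/

/-- The Kashiwara operators of a crystal with index set `I` on the set `B`;
the value `none` stands for the symbol `∅` (the operator kills the vertex). -/
structure CrystalOps (I B : Type*) where
  e : I → B → Option B
  f : I → B → Option B

/-- `iter g k b` is `g (g (⋯ (g b)))`, with `k` applications of the partial map `g`. -/
def iter {B : Type*} (g : B → Option B) : ℕ → B → Option B
  | 0, b => some b
  | k + 1, b => (g b).bind (iter g k)

/-- `ε_i(b) = max {k ≥ 0 | e_i^k b ≠ ∅}`. -/
noncomputable def CrystalOps.eps {I B : Type*} (C : CrystalOps I B) (i : I) (b : B) : ℕ :=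
  sSup {k | iter (C.e i) k b ≠ none}

/-- `φ_i(b) = max {k ≥ 0 | f_i^k b ≠ ∅}`. -/
noncomputable def CrystalOps.phi {I B : Type*} (C : CrystalOps I B) (i : I) (b : B) : ℕ :=
  sSup {k | iter (C.f i) k b ≠ none}

/-- The tensor product `B₂ ⊗ B₁`, in the convention
`f_i (b₂ ⊗ b₁) = f_i b₂ ⊗ b₁` if `ε_i(b₂) ≥ φ_i(b₁)` and `b₂ ⊗ f_i b₁` otherwise,
`e_i (b₂ ⊗ b₁) = e_i b₂ ⊗ b₁` if `ε_i(b₂) > φ_i(b₁)` and `b₂ ⊗ e_i b₁` otherwise. -/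
noncomputable def CrystalOps.tensor {I B₂ B₁ : Type*} (C₂ : CrystalOps I B₂)
    (C₁ : CrystalOps I B₁) : CrystalOps I (B₂ × B₁) where
  e i b := if C₁.phi i b.2 < C₂.eps i b.1 then (C₂.e i b.1).map (fun x => (x, b.2))
    else (C₁.e i b.2).map (fun y => (b.1, y))
  f i b := if C₁.phi i b.2 ≤ C₂.eps i b.1 then (C₂.f i b.1).map (fun x => (x, b.2))
    else (C₁.f i b.2).map (fun y => (b.1, y))

/-- There is an arrow of the crystal graph from `x` to `y`: `f_i x = y`, or `e_i y = x`,
for some colour `i` (in a crystal the two conditions say the same). -/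
def CrystalOps.Arrow {I B : Type*} (C : CrystalOps I B) (x y : B) : Prop :=
  ∃ i, C.f i x = some y ∨ C.e i y = some x

/-- The crystal graph is connected (as an undirected graph). -/
def CrystalOps.Connected {I B : Type*} (C : CrystalOps I B) : Prop :=
  Nonempty B ∧ ∀ x y : B, Relation.EqvGen C.Arrow x y

/-! ## The alphabet and the crystal `B(ϖ₁)` of type `D_n`

The letter `i` is coded by the integer `i`, the letter `ī` by `-i`, for `1 ≤ i ≤ n`. -/

/-- `x` codes a letter of `1, …, n, n̄, …, 1̄`. -/
def IsLetter (n : ℕ) (x : ℤ) : Prop := x ≠ 0 ∧ |x| ≤ n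

/-- The height of a letter in `1 < 2 < ⋯ < n-1 < n, n̄ < … < 2̄ < 1̄`;
`n` and `n̄` have the same height and are incomparable. -/
def height (n : ℕ) (x : ℤ) : ℤ := if 0 < x then x else 2 * n + x

/-- The strict order of the alphabet. -/
def ltLetter (n : ℕ) (x y : ℤ) : Prop := height n x < height n y

/-- The partial order of the alphabet. -/
def leLetter (n : ℕ) (x y : ℤ) : Prop := x = y ∨ ltLetter n x y

/-- `f_i` on letters, for `1 ≤ i ≤ n`. -/
def letterF (n i : ℕ) (x : ℤ) : Option ℤ :=
  if i < n then
    if x = i then some (i + 1) else if x = -(i + 1) then some (-i) else none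
  else
    if x = n - 1 then some (-n) else if x = n then some (-(n - 1)) else none

/-- `e_i` on letters, for `1 ≤ i ≤ n`. -/
def letterE (n i : ℕ) (x : ℤ) : Option ℤ :=
  if i < n then
    if x = i + 1 then some i else if x = -i then some (-(i + 1)) else none
  else
    if x = -n then some (n - 1) else if x = -(n - 1) then some n else none

/-- `φ_i` of a letter (all `i`-strings of `B(ϖ₁)` have length at most one). -/
def letterPhi (n i : ℕ) (x : ℤ) : ℕ := if (letterF n i x).isSome then 1 else 0

/-- `ε_i` of a letter. -/
def letterEps (n i : ℕ) (x : ℤ) : ℕ := if (letterE n i x).isSome then 1 else 0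

/-- `φ_i` of the word `x₁ x₂ ⋯`, seen as `x₁ ⊗ x₂ ⊗ ⋯` in a tensor power of `B(ϖ₁)`:
`φ_i(b₂ ⊗ b₁) = φ_i(b₂) + max(0, φ_i(b₁) - ε_i(b₂))` (truncated subtraction). -/
def wordPhi (n i : ℕ) : List ℤ → ℕ
  | [] => 0
  | x :: w => letterPhi n i x + (wordPhi n i w - letterEps n i x)

/-- `f_i` on words, by the tensor product rule. -/
def wordF (n i : ℕ) : List ℤ → Option (List ℤ)
  | [] => none
  | x :: w => if wordPhi n i w ≤ letterEps n i x then (letterF n i x).map (fun y => y :: w)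
    else (wordF n i w).map (fun v => x :: v)

/-- `e_i` on words, by the tensor product rule. -/
def wordE (n i : ℕ) : List ℤ → Option (List ℤ)
  | [] => none
  | x :: w => if wordPhi n i w < letterEps n i x then (letterE n i x).map (fun y => y :: w)
    else (wordE n i w).map (fun v => x :: v)

/-! ## Two-row rectangular tableaux

A tableau of shape `(k,k)` is the list of its `k` columns; the column with top entry `a` and
bottom entry `b` is the pair `(a, b)`. -/

/-- The column word `b₁ a₁ b₂ a₂ ⋯`. -/
def colWord : List (ℤ × ℤ) → List ℤ
  | [] => []
  | c :: T => c.2 :: c.1 :: colWord T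

/-- The tableau with a given column word. -/
def ofColWord : List ℤ → List (ℤ × ℤ)
  | b :: a :: w => (a, b) :: ofColWord w
  | _ => []

/-- Entries are letters, both rows are weakly increasing (`a ≤ b` for horizontally adjacent
`a b`), columns satisfy `b ≰ a` for `b` below `a`, and no column `(n-1, n)` occurs to the left
of a column `(n, \overline{n-1})`, nor `(n-1, n̄)` to the left of `(n̄, \overline{n-1})`. -/
structure IsTableau (n : ℕ) (T : List (ℤ × ℤ)) : Prop where
  letters : ∀ c ∈ T, IsLetter n c.1 ∧ IsLetter n c.2
  rows : T.IsChain (fun c d => leLetter n c.1 d.1 ∧ leLetter n c.2 d.2)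
  cols : ∀ c ∈ T, ¬ leLetter n c.2 c.1
  noPair : T.Pairwise (fun c d =>
    ¬ (c = ((n : ℤ) - 1, (n : ℤ)) ∧ d = ((n : ℤ), -((n : ℤ) - 1))) ∧
    ¬ (c = ((n : ℤ) - 1, -(n : ℤ)) ∧ d = (-(n : ℤ), -((n : ℤ) - 1))))

/-- The Kashiwara–Nakashima tableaux: the elements of `B(kϖ₂)`, `k` being the number of columns.
In addition to the above, no column `(a, ā)` has a left neighbour with top entry `a` or a right
neighbour with bottom entry `ā`, and there is no column `(1, 1̄)`. -/
structure IsKN (n : ℕ) (T : List (ℤ × ℤ)) : Prop extends IsTableau n T where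
  noConfig : T.IsChain (fun c d =>
    ¬ (d.2 = -d.1 ∧ c.1 = d.1) ∧ ¬ (c.2 = -c.1 ∧ d.2 = c.2))
  noOne : ((1 : ℤ), (-1 : ℤ)) ∉ T

/-- `f_i` on `B(kϖ₂)`, `1 ≤ i ≤ n`. -/
def knF (n i : ℕ) (t : List (ℤ × ℤ)) : Option (List (ℤ × ℤ)) :=
  (wordF n i (colWord t)).map ofColWord

/-- `e_i` on `B(kϖ₂)`, `1 ≤ i ≤ n`. -/
def knE (n i : ℕ) (t : List (ℤ × ℤ)) : Option (List (ℤ × ℤ)) :=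
  (wordE n i (colWord t)).map ofColWord

/-! ## The set `𝒯(s)`, the drop map and the fill map -/

/-- `𝒯(s)`: the vertices of `B̃^{2,s}`. -/
def Tab (n s : ℕ) : Type := {T : List (ℤ × ℤ) // T.length = s ∧ IsTableau n T}

/-- `T` contains an `a`-configuration whose `m` removable columns `(a, ā)` may be deleted,
leaving `t`. In the three cases: the maximal block of columns `(a, ā)` has a left neighbour with
top entry `a`, and all its columns are deleted; it has a right neighbour with bottom entry `ā`,
and all its columns are deleted; it has neither, and all columns but one are deleted. -/
def ConfigDrop (n : ℕ) (T t : List (ℤ × ℤ)) : Prop :=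
  ∃ (a : ℤ) (m : ℕ) (L R : List (ℤ × ℤ)),
    ((1 ≤ a ∧ a ≤ n) ∨ a = -n) ∧ 1 ≤ m ∧
    ((T = L ++ List.replicate m (a, -a) ++ R ∧ t = L ++ R ∧
        (∃ b, L.getLast? = some (a, b) ∧ b ≠ -a) ∧ R.head? ≠ some (a, -a)) ∨
      (T = L ++ List.replicate m (a, -a) ++ R ∧ t = L ++ R ∧
        (∃ d, R.head? = some (d, -a) ∧ d ≠ a) ∧ L.getLast? ≠ some (a, -a)) ∨
      (T = L ++ List.replicate (m + 1) (a, -a) ++ R ∧ t = L ++ [(a, -a)] ++ R ∧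
        (∀ c, L.getLast? = some c → c.1 ≠ a) ∧ (∀ c, R.head? = some c → c.2 ≠ -a)))

/-- The graph of the height-two drop map `D_{2,s} : 𝒯(s) → ⨁_{k ≤ s} B(kϖ₂)`. -/
def DropsTo (n : ℕ) (T t : List (ℤ × ℤ)) : Prop :=
  (IsKN n T ∧ t = T) ∨
  (¬ IsKN n T ∧ (∀ c ∈ T, c = (1, -1)) ∧ t = []) ∨
  (¬ IsKN n T ∧ (¬ ∀ c ∈ T, c = (1, -1)) ∧ ConfigDrop n T t)

open Classical in
/-- The height-two drop map `D_{2,s}` (the default value is never used). -/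
noncomputable def drop {n s : ℕ} (T : Tab n s) : List (ℤ × ℤ) :=
  if h : ∃ t, DropsTo n T.1 t then h.choose else []

open Classical in
/-- The height-two fill map `F_{2,s}`, the inverse of `D_{2,s}`; it is defined on all of
`⨁_{k ≤ s} B(kϖ₂)`. -/
noncomputable def fill {n s : ℕ} (t : List (ℤ × ℤ)) : Option (Tab n s) :=
  if h : ∃ T : Tab n s, drop T = t then some h.choose else none

/-- `f_i T = F(f_i (D T))` on `𝒯(s)`, for `1 ≤ i ≤ n`. -/
noncomputable def clF {n s : ℕ} (i : ℕ) (T : Tab n s) : Option (Tab n s) :=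
  (knF n i (drop T)).bind fill

/-- `e_i T = F(e_i (D T))` on `𝒯(s)`, for `1 ≤ i ≤ n`. -/
noncomputable def clE {n s : ℕ} (i : ℕ) (T : Tab n s) : Option (Tab n s) :=
  (knE n i (drop T)).bind fill

/-! ## Branching components and the involution `σ`

A connected `U_q(D_{n-1})`-component (colours `2, …, n`), that is, a vertex of the branching
component graph, is represented by its highest weight vector. -/

/-- The `k` such that `T` lies in the classical component `B(kϖ₂)`. -/
noncomputable def comp {n s : ℕ} (T : Tab n s) : ℕ := (drop T).length

/-- The coefficient of `ε_j` in the weight of `T`, for `1 ≤ j ≤ n`: the number of letters `j`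
minus the number of letters `j̄`. -/
def wt {n s : ℕ} (T : Tab n s) (j : ℕ) : ℤ :=
  ((colWord T.1).count (j : ℤ) : ℤ) - ((colWord T.1).count (-(j : ℤ)) : ℤ)

/-- `T` is a `U_q(D_{n-1})`-highest weight vector. -/
def IsBranchHW {n s : ℕ} (T : Tab n s) : Prop := ∀ i, 2 ≤ i → i ≤ n → clE i T = none

/-- The branching components with highest weight vectors `u` and `v` have the same shape `λ`,
that is, the same `U_q(D_{n-1})`-highest weight. -/
def SameShape {n s : ℕ} (u v : Tab n s) : Prop := ∀ j, 2 ≤ j → j ≤ n → wt u j = wt v j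

/-- The rank `R(v) = r_k(v) + s - k` for `v` in the branching component graph of `B(kϖ₂)`.
Here `r_k` is the number of `1`-arrows on a path from the highest weight vector of `B(kϖ₂)`,
i.e. the coefficient of `α₁ = ε₁ - ε₂` in `kϖ₂ - wt`. As `α₁` is the only simple root that
involves `ε₁`, and `ϖ₂ = ε₁ + ε₂`, this is `k - wt₁`. -/
noncomputable def rank {n s : ℕ} (T : Tab n s) : ℤ := ((comp T : ℤ) - wt T 1) + s - comp T

/-- The minimal `ℓ` such that the component of `u` lies in the image of the branching component
graph of `B(ℓϖ₂)`. The inclusions of these graphs preserve shape and rank, and a vertex of each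
of them is determined by its shape and its rank. -/
noncomputable def minComp {n s : ℕ} (u : Tab n s) : ℕ :=
  sInf {l | ∃ w : Tab n s, IsBranchHW w ∧ SameShape w u ∧ rank w = rank u ∧ comp w = l}

/-- The map `σ̌` on branching components (given by highest weight vectors): if `u` lies in
`B(kϖ₂)` and has rank `p`, then `v` has the same shape, has rank `2s - p` and
lies in `B((s + ℓ - k)ϖ₂)`. -/
def CheckSigma {n s : ℕ} (u v : Tab n s) : Prop :=
  IsBranchHW u ∧ IsBranchHW v ∧ SameShape u v ∧ rank v = 2 * s - rank u ∧
    comp v + comp u = s + minComp u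

/-- `path [i₁, …, i_k] u = f_{i₁} ⋯ f_{i_k} u`. -/
noncomputable def path {n s : ℕ} : List ℕ → Tab n s → Option (Tab n s)
  | [], u => some u
  | i :: l, u => (path l u).bind (clF i)

/-- The graph of `σ`: if `b = f_{i₁} ⋯ f_{i_k} u` with all `i_j` in `{2, …, n}` and `u` a highest
weight vector of a branching component, then `σ b = f_{i₁} ⋯ f_{i_k} u†`, where `u†` is the
highest weight vector of the image of that component under `σ̌`. -/
def SigmaRel {n s : ℕ} (b b' : Tab n s) : Prop :=
  ∃ (u u' : Tab n s) (l : List ℕ), (∀ i ∈ l, 2 ≤ i ∧ i ≤ n) ∧ CheckSigma u u' ∧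
    path l u = some b ∧ path l u' = some b'

open Classical in
/-- The involution `σ` of `𝒯(s)` (it is defined everywhere and single-valued). -/
noncomputable def sigma {n s : ℕ} (b : Tab n s) : Option (Tab n s) :=
  if h : ∃ b', SigmaRel b b' then some h.choose else none

/-- The affine crystal `B̃^{2,s}` of type `D_n^{(1)}`, with index set `{0, 1, …, n}`:
`f_0 = σ f_1 σ` and `e_0 = σ e_1 σ`. -/
noncomputable def B2 (n s : ℕ) : CrystalOps (Fin (n + 1)) (Tab n s) where
  e i T := if i = 0 then ((sigma T).bind (clE 1)).bind sigma else clE i T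
  f i T := if i = 0 then ((sigma T).bind (clF 1)).bind sigma else clF i T

/-- `u₀`, the tableau all of whose `s` columns are `(1, 1̄)`: the unique element of
`B(0) ⊂ B̃^{2,s}`. -/
def uZero (n s : ℕ) (hn : 4 ≤ n) : Tab n s :=
  ⟨List.replicate s (1, -1), List.length_replicate, by
    have hn' : (4 : ℤ) ≤ n := by exact_mod_cast hn
    refine ⟨?_, ?_, ?_, ?_⟩
    · intro c hc
      rw [List.eq_of_mem_replicate hc]
      refine ⟨⟨by norm_num, ?_⟩, ⟨by norm_num, ?_⟩⟩ <;> norm_num <;> omega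
    · exact List.isChain_replicate_of_rel _ ⟨Or.inl rfl, Or.inl rfl⟩
    · intro c hc
      rw [List.eq_of_mem_replicate hc]
      simp only [leLetter, ltLetter, height]
      norm_num
      omega
    · refine List.pairwise_replicate.2 (Or.inr ⟨?_, ?_⟩) <;> rintro ⟨h, -⟩ <;>
        rw [Prod.mk.injEq] at h <;> omega⟩

end TypeD

namespace TypeD

/-! ## Letters -/

/-! Write u_k and l_k for the highest and lowest weight vectors of B(kϖ₂): all columns (1,2), resp.
all columns (2̄,1̄). Both u₀ and l₀ are the vertex of B(0). The two tensor factors are driven to u₀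
one after the other, the right one first.

Right factor. If b' is not classically highest, some e_i with i ≠ 0 does not kill b', and it then
acts on b ⊗ b', on one factor or the other. Either way the sum of the letter heights drops, so b'
becomes some u_k (`raises_right_highest`). Now e₀ is applied. While it acts on the left it lowers ε₀
there, so at last it acts on the right, where e₀ u_k = u_{k-1} (`raises_right_step`). Repeating this
turns b' into u₀.

Left factor. Since φ_i(u₀) = 0 for i ≠ 0, the classical e_i now act on the left until it is some u_k
(`raises_left_highest`). For k > 0 one has φ₀(u₀) ≤ s < k + s ≤ ε₀(u_k), so e₀ acts on the left as
well and leads down to u₀ (`raises_left_uZero`).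

The affine input is thus e₀ u_{k+1} = u_k (`e_zero_highest`) and e₀ l_k = l_{k+1} for k < s
(`e_zero_lowest`), which give the string u_k → ⋯ → u₀ = l₀ → ⋯ → l_s, together with an upper bound
for φ₀(u₀). The bound holds because σ negates the coefficient of ε₁, so that f₀ raises it by one,
while it never exceeds s. The involution σ is evaluated only at the vertices met along this string
(`sigma_highest`, `sigma_lowest`). All of them lie in D_{n-1}-components generated by tableaux with
columns (1,2), (1,2̄), (2,2̄), (2,1̄) only.

Underneath lies the classical structure: `drop` is injective and reaches every Kashiwara–Nakashima
tableau with at most s columns (`drop_injective`, `exists_drop_eq`), and these tableaux are stable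
under e_i (`IsKN.knE`). Stability under f_i is not required, because f_i serves only as the reverse
of e_i. -/

theorem letterE_eq_some {n i : ℕ} {x y : ℤ} : letterE n i x = some y ↔
    (i < n ∧ x = i + 1 ∧ y = i) ∨ (i < n ∧ x = -i ∧ x ≠ i + 1 ∧ y = -(i + 1)) ∨
    (n ≤ i ∧ x = -n ∧ y = n - 1) ∨ (n ≤ i ∧ x = -(n - 1) ∧ x ≠ -n ∧ y = n) := by
  unfold letterE
  split_ifs <;> simp <;> omega

theorem letterF_eq_some {n i : ℕ} {x y : ℤ} : letterF n i x = some y ↔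
    (i < n ∧ x = i ∧ y = i + 1) ∨ (i < n ∧ x = -(i + 1) ∧ x ≠ i ∧ y = -i) ∨
    (n ≤ i ∧ x = n - 1 ∧ y = -n) ∨ (n ≤ i ∧ x = n ∧ x ≠ n - 1 ∧ y = -(n - 1)) := by
  unfold letterF
  split_ifs <;> simp <;> omega

theorem letterF_eq_some_iff {n i : ℕ} (hn : 4 ≤ n) (hi : 1 ≤ i) {x y : ℤ} :
    letterF n i x = some y ↔ letterE n i y = some x := by
  rw [letterE_eq_some, letterF_eq_some]
  omega

theorem letterEps_eq_one {n i : ℕ} {x : ℤ} : letterEps n i x = 1 ↔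
    (i < n ∧ (x = i + 1 ∨ x = -i)) ∨ (n ≤ i ∧ (x = -n ∨ x = -(n - 1))) := by
  unfold letterEps letterE
  split_ifs <;> simp_all

theorem letterPhi_eq_one {n i : ℕ} {x : ℤ} : letterPhi n i x = 1 ↔
    (i < n ∧ (x = i ∨ x = -(i + 1))) ∨ (n ≤ i ∧ (x = n - 1 ∨ x = n)) := by
  unfold letterPhi letterF
  split_ifs <;> simp_all

theorem letterEps_le_one (n i : ℕ) (x : ℤ) : letterEps n i x ≤ 1 := by
  unfold letterEps; split_ifs <;> simp

theorem letterPhi_le_one (n i : ℕ) (x : ℤ) : letterPhi n i x ≤ 1 := by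
  unfold letterPhi; split_ifs <;> simp

theorem letterEps_eq_zero {n i : ℕ} {x : ℤ} : letterEps n i x = 0 ↔
    ¬ ((i < n ∧ (x = i + 1 ∨ x = -i)) ∨ (n ≤ i ∧ (x = -n ∨ x = -(n - 1)))) := by
  rw [← letterEps_eq_one]
  have := letterEps_le_one n i x
  omega

theorem letterPhi_eq_zero {n i : ℕ} {x : ℤ} : letterPhi n i x = 0 ↔
    ¬ ((i < n ∧ (x = i ∨ x = -(i + 1))) ∨ (n ≤ i ∧ (x = n - 1 ∨ x = n))) := by
  rw [← letterPhi_eq_one]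
  have := letterPhi_le_one n i x
  omega

theorem letterE_eq_none {n i : ℕ} {x : ℤ} : letterE n i x = none ↔ letterEps n i x = 0 := by
  unfold letterEps
  cases letterE n i x <;> simp

theorem letterF_eq_none {n i : ℕ} {x : ℤ} : letterF n i x = none ↔ letterPhi n i x = 0 := by
  unfold letterPhi
  cases letterF n i x <;> simp

theorem letterEps_of_letterE {n i : ℕ} {x y : ℤ} (h : letterE n i x = some y) :
    letterEps n i x = 1 := by simp [letterEps, h]

theorem letterPhi_of_letterF {n i : ℕ} {x y : ℤ} (h : letterF n i x = some y) :
    letterPhi n i x = 1 := by simp [letterPhi, h]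

theorem letterPhi_eq_zero_of_eps {n i : ℕ} (hn : 4 ≤ n) (hi : 1 ≤ i) {x : ℤ}
    (h : letterEps n i x = 1) : letterPhi n i x = 0 := by
  rw [letterEps_eq_one] at h
  rw [letterPhi_eq_zero]
  omega

theorem letterEps_eq_zero_of_phi {n i : ℕ} (hn : 4 ≤ n) (hi : 1 ≤ i) {x : ℤ}
    (h : letterPhi n i x = 1) : letterEps n i x = 0 := by
  rw [letterPhi_eq_one] at h
  rw [letterEps_eq_zero]
  omega

theorem height_cases (n : ℕ) (x : ℤ) :
    (0 < x ∧ height n x = x) ∨ (x ≤ 0 ∧ height n x = 2 * n + x) := by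
  unfold height; split_ifs <;> omega

theorem IsLetter.bounds {n : ℕ} {x : ℤ} (h : IsLetter n x) : x ≠ 0 ∧ -n ≤ x ∧ x ≤ n :=
  ⟨h.1, abs_le.1 h.2⟩

theorem isLetter_of_bounds {n : ℕ} {x : ℤ} (h : x ≠ 0 ∧ -n ≤ x ∧ x ≤ n) : IsLetter n x :=
  ⟨h.1, abs_le.2 h.2⟩

theorem IsLetter.height_neg {n : ℕ} {x : ℤ} (h : IsLetter n x) :
    height n (-x) = 2 * n - height n x := by
  have := h.bounds
  have h1 := height_cases n x
  have h2 := height_cases n (-x)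
  omega

theorem IsLetter.letterE {n i : ℕ} (hn : 4 ≤ n) (hi : 1 ≤ i) {x y : ℤ} (hx : IsLetter n x)
    (h : letterE n i x = some y) : IsLetter n y := by
  have := hx.bounds
  rw [letterE_eq_some] at h
  exact isLetter_of_bounds (by omega)

theorem height_letterE {n i : ℕ} (hn : 4 ≤ n) (hi : 1 ≤ i) {x y : ℤ}
    (h : letterE n i x = some y) : height n y = height n x - 1 := by
  rw [letterE_eq_some] at h
  have h1 := height_cases n x
  have h2 := height_cases n y
  omega

theorem leLetter.refl (n : ℕ) (x : ℤ) : leLetter n x x := Or.inl rfl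

theorem leLetter.trans {n : ℕ} {x y z : ℤ} (h : leLetter n x y) (h' : leLetter n y z) :
    leLetter n x z := by
  unfold leLetter ltLetter at *
  rcases h with rfl | h
  · exact h'
  · rcases h' with rfl | h'
    · exact Or.inr h
    · exact Or.inr (h.trans h')

theorem leLetter.antisymm {n : ℕ} {x y : ℤ} (h : leLetter n x y) (h' : leLetter n y x) :
    x = y := by
  unfold leLetter ltLetter at *
  rcases h with rfl | h
  · rfl
  · rcases h' with rfl | h'
    · rfl
    · omega

theorem leLetter.neg {n : ℕ} {x y : ℤ} (hx : IsLetter n x) (hy : IsLetter n y)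
    (h : leLetter n x y) : leLetter n (-y) (-x) := by
  unfold leLetter ltLetter at *
  rw [hx.height_neg, hy.height_neg]
  omega

theorem leLetter.height_le {n : ℕ} {x y : ℤ} (h : leLetter n x y) :
    height n x ≤ height n y := by
  unfold leLetter ltLetter at h
  rcases h with rfl | h <;> omega

/-! ## Words -/

theorem wordPhi_cons_of_neutral {n i : ℕ} {x : ℤ} (w : List ℤ) (h : letterPhi n i x = 0)
    (h' : letterEps n i x = 0) : wordPhi n i (x :: w) = wordPhi n i w := by
  simp [wordPhi, h, h']

theorem wordE_cons_of_eps_eq_zero {n i : ℕ} {x : ℤ} (w : List ℤ) (h : letterEps n i x = 0) :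
    wordE n i (x :: w) = (wordE n i w).map (fun v => x :: v) := by
  simp [wordE, h]

theorem wordF_eq_none_of_wordPhi {n i : ℕ} {w : List ℤ} (h : wordPhi n i w = 0) :
    wordF n i w = none := by
  induction w with
  | nil => rfl
  | cons y v ih =>
    simp only [wordPhi] at h
    rw [wordF, if_pos (by omega), letterF_eq_none.2 (by omega)]
    rfl

theorem wordF_cons_of_neutral {n i : ℕ} {x : ℤ} (w : List ℤ) (h : letterPhi n i x = 0)
    (h' : letterEps n i x = 0) : wordF n i (x :: w) = (wordF n i w).map (fun v => x :: v) := by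
  rw [wordF, h']
  split_ifs with h0
  -- At a tie `wordF` selects the neutral head and kills the word; the tail has φ_i = 0, so it is
  -- killed too.
  · rw [letterF_eq_none.2 h, wordF_eq_none_of_wordPhi (by omega)]
    rfl
  · rfl

/-- The change of φ_i carries the induction: it shows that e_i picks in the new word the letter that
f_i changed, although one rule uses a strict and the other a weak inequality. -/
theorem wordE_of_wordF {n i : ℕ} (hn : 4 ≤ n) (hi : 1 ≤ i) {w w' : List ℤ}
    (h : wordF n i w = some w') : wordE n i w' = some w ∧ wordPhi n i w = wordPhi n i w' + 1 := by
  induction w generalizing w' with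
  | nil => simp [wordF] at h
  | cons x v ih =>
    rw [wordF] at h
    split_ifs at h with h0
    · obtain ⟨y, hy, rfl⟩ := Option.map_eq_some_iff.1 h
      have h1 := letterPhi_of_letterF hy
      have h2 := letterEps_eq_zero_of_phi hn hi h1
      have h3 := (letterF_eq_some_iff hn hi).1 hy
      have h4 := letterEps_of_letterE h3
      have h5 := letterPhi_eq_zero_of_eps hn hi h4
      simp only [wordE, wordPhi]
      rw [if_pos (by omega), h3]
      exact ⟨rfl, by omega⟩
    · obtain ⟨v', hv, rfl⟩ := Option.map_eq_some_iff.1 h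
      obtain ⟨h1, h2⟩ := ih hv
      simp only [wordE, wordPhi]
      rw [if_neg (by omega), h1]
      exact ⟨rfl, by omega⟩

theorem wordF_of_wordE {n i : ℕ} (hn : 4 ≤ n) (hi : 1 ≤ i) {w w' : List ℤ}
    (h : wordE n i w = some w') : wordF n i w' = some w ∧ wordPhi n i w' = wordPhi n i w + 1 := by
  induction w generalizing w' with
  | nil => simp [wordE] at h
  | cons x v ih =>
    rw [wordE] at h
    split_ifs at h with h0
    · obtain ⟨y, hy, rfl⟩ := Option.map_eq_some_iff.1 h
      have h3 := (letterF_eq_some_iff hn hi).2 hy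
      have h1 := letterPhi_of_letterF h3
      have h2 := letterEps_eq_zero_of_phi hn hi h1
      have h4 := letterEps_of_letterE hy
      have h5 := letterPhi_eq_zero_of_eps hn hi h4
      simp only [wordF, wordPhi]
      rw [if_pos (by omega), h3]
      exact ⟨rfl, by omega⟩
    · obtain ⟨v', hv, rfl⟩ := Option.map_eq_some_iff.1 h
      obtain ⟨h1, h2⟩ := ih hv
      simp only [wordF, wordPhi]
      rw [if_neg (by omega), h1]
      exact ⟨rfl, by omega⟩

theorem wordE_cons_eq_none {n i : ℕ} {x : ℤ} {w : List ℤ} (h : wordE n i (x :: w) = none) :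
    letterEps n i x ≤ wordPhi n i w ∧ wordE n i w = none := by
  rw [wordE] at h
  split_ifs at h with h0
  · rw [Option.map_eq_none_iff, letterE_eq_none] at h
    omega
  · exact ⟨by omega, Option.map_eq_none_iff.1 h⟩

theorem wordE_eq_none_of_suffix {n i : ℕ} (u : List ℤ) {w : List ℤ}
    (h : wordE n i (u ++ w) = none) : wordE n i w = none := by
  induction u with
  | nil => exact h
  | cons x u ih => exact ih (wordE_cons_eq_none h).2

theorem wordE_eq_none_of_eps {n i : ℕ} {w : List ℤ} (h : ∀ x ∈ w, letterEps n i x = 0) :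
    wordE n i w = none := by
  induction w with
  | nil => rfl
  | cons x v ih =>
    rw [wordE_cons_of_eps_eq_zero _ (h x (by simp)), ih fun y hy => h y (by simp [hy])]
    rfl

theorem wordPhi_eq_zero_of_phi {n i : ℕ} {w : List ℤ} (h : ∀ x ∈ w, letterPhi n i x = 0) :
    wordPhi n i w = 0 := by
  induction w with
  | nil => rfl
  | cons x v ih =>
    rw [wordPhi, h x (by simp), ih fun y hy => h y (by simp [hy])]
    simp

theorem exists_phi_of_wordPhi_append {n i : ℕ} {u v : List ℤ} (hv : wordPhi n i v = 0)
    (h : wordPhi n i (u ++ v) ≠ 0) : ∃ x ∈ u, letterPhi n i x = 1 := by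
  induction u with
  | nil => exact absurd hv h
  | cons x u ih =>
    rw [List.cons_append, wordPhi] at h
    by_cases h1 : letterPhi n i x = 1
    · exact ⟨x, by simp, h1⟩
    · have := letterPhi_le_one n i x
      obtain ⟨y, hy, h2⟩ := ih (by omega)
      exact ⟨y, by simp [hy], h2⟩

/-- The position at which `e_i` acts on a word. -/
theorem exists_split_of_wordE {n i : ℕ} (hn : 4 ≤ n) (hi : 1 ≤ i) {w w' : List ℤ}
    (h : wordE n i w = some w') : ∃ (u v : List ℤ) (x y : ℤ),
      w = u ++ x :: v ∧ w' = u ++ y :: v ∧ letterE n i x = some y ∧ wordPhi n i v = 0 ∧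
      ∀ u₁ z u₂, u = u₁ ++ z :: u₂ → letterEps n i z = 1 → ∃ q ∈ u₂, letterPhi n i q = 1 := by
  induction w generalizing w' with
  | nil => simp [wordE] at h
  | cons x v ih =>
    rw [wordE] at h
    split_ifs at h with h0
    · obtain ⟨y, hy, rfl⟩ := Option.map_eq_some_iff.1 h
      have := letterEps_le_one n i x
      refine ⟨[], v, x, y, rfl, rfl, hy, by omega, ?_⟩
      intro u₁ z u₂ h
      simp at h
    · obtain ⟨v', hv, rfl⟩ := Option.map_eq_some_iff.1 h
      obtain ⟨u, r, a, b, rfl, rfl, hab, hr, hu⟩ := ih hv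
      refine ⟨x :: u, r, a, b, rfl, rfl, hab, hr, ?_⟩
      intro u₁ z u₂ h1 hz
      cases u₁ with
      | nil =>
        simp only [List.nil_append, List.cons.injEq] at h1
        obtain ⟨rfl, rfl⟩ := h1
        -- The head was passed over in spite of ε_i = 1, so φ_i of the rest is positive. The part
        -- from `a` on contributes nothing, as ε_i(a) = 1 forces φ_i(a) = 0.
        refine exists_phi_of_wordPhi_append (v := a :: r) ?_ (by omega)
        have h2 := letterEps_of_letterE hab
        have h3 := letterPhi_eq_zero_of_eps hn hi h2
        simp [wordPhi, h3, hr]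
      | cons t u₁ =>
        simp only [List.cons_append, List.cons.injEq] at h1
        exact hu u₁ z u₂ h1.2 hz

theorem length_wordE {n i : ℕ} {w w' : List ℤ} (h : wordE n i w = some w') :
    w'.length = w.length := by
  induction w generalizing w' with
  | nil => simp [wordE] at h
  | cons x v ih =>
    rw [wordE] at h
    split_ifs at h
    · obtain ⟨y, -, rfl⟩ := Option.map_eq_some_iff.1 h
      simp
    · obtain ⟨y, hy, rfl⟩ := Option.map_eq_some_iff.1 h
      simp [ih hy]

theorem length_wordF {n i : ℕ} {w w' : List ℤ} (h : wordF n i w = some w') :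
    w'.length = w.length := by
  induction w generalizing w' with
  | nil => simp [wordF] at h
  | cons x v ih =>
    rw [wordF] at h
    split_ifs at h
    · obtain ⟨y, -, rfl⟩ := Option.map_eq_some_iff.1 h
      simp
    · obtain ⟨y, hy, rfl⟩ := Option.map_eq_some_iff.1 h
      simp [ih hy]

/-! ## Column words -/

theorem ofColWord_colWord (t : List (ℤ × ℤ)) : ofColWord (colWord t) = t := by
  induction t with
  | nil => rfl
  | cons c t ih => simp [colWord, ofColWord, ih]

theorem colWord_injective : Function.Injective colWord :=
  Function.LeftInverse.injective ofColWord_colWord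

theorem length_colWord (t : List (ℤ × ℤ)) : (colWord t).length = 2 * t.length := by
  induction t with
  | nil => rfl
  | cons c t ih => simp [colWord, ih]; ring

theorem exists_colWord (k : ℕ) (w : List ℤ) (h : w.length = 2 * k) : ∃ t, colWord t = w := by
  induction k generalizing w with
  | zero => exact ⟨[], by simp_all [colWord]⟩
  | succ k ih =>
    match w, h with
    | b :: a :: w, h =>
      obtain ⟨t, rfl⟩ := ih w (by simp at h; omega)
      exact ⟨(a, b) :: t, rfl⟩
    | [_], h => simp at h; omega

theorem colWord_append (t t' : List (ℤ × ℤ)) : colWord (t ++ t') = colWord t ++ colWord t' := by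
  induction t with
  | nil => rfl
  | cons c t ih => simp [colWord, ih]

theorem mem_colWord {x : ℤ} {t : List (ℤ × ℤ)} :
    x ∈ colWord t ↔ ∃ c ∈ t, x = c.1 ∨ x = c.2 := by
  induction t with
  | nil => simp [colWord]
  | cons c t ih => simp only [colWord, List.mem_cons, ih]; aesop

theorem knE_eq_some {n i : ℕ} {t t' : List (ℤ × ℤ)} :
    knE n i t = some t' ↔ wordE n i (colWord t) = some (colWord t') := by
  unfold knE
  constructor
  · intro h
    obtain ⟨w, hw, rfl⟩ := Option.map_eq_some_iff.1 h
    obtain ⟨t', rfl⟩ := exists_colWord t.length w (by rw [length_wordE hw, length_colWord])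
    rw [hw, ofColWord_colWord]
  · intro h
    rw [h, Option.map_some, ofColWord_colWord]

theorem knF_eq_some {n i : ℕ} {t t' : List (ℤ × ℤ)} :
    knF n i t = some t' ↔ wordF n i (colWord t) = some (colWord t') := by
  unfold knF
  constructor
  · intro h
    obtain ⟨w, hw, rfl⟩ := Option.map_eq_some_iff.1 h
    obtain ⟨t', rfl⟩ := exists_colWord t.length w (by rw [length_wordF hw, length_colWord])
    rw [hw, ofColWord_colWord]
  · intro h
    rw [h, Option.map_some, ofColWord_colWord]

theorem knE_eq_none {n i : ℕ} {t : List (ℤ × ℤ)} :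
    knE n i t = none ↔ wordE n i (colWord t) = none := by
  unfold knE; exact Option.map_eq_none_iff

theorem length_knE {n i : ℕ} {t t' : List (ℤ × ℤ)} (h : knE n i t = some t') :
    t'.length = t.length := by
  have := length_wordE (knE_eq_some.1 h)
  rw [length_colWord, length_colWord] at this
  omega

theorem knF_eq_some_iff {n i : ℕ} (hn : 4 ≤ n) (hi : 1 ≤ i) {t t' : List (ℤ × ℤ)} :
    knF n i t = some t' ↔ knE n i t' = some t := by
  rw [knE_eq_some, knF_eq_some]
  exact ⟨fun h => (wordE_of_wordF hn hi h).1, fun h => (wordF_of_wordE hn hi h).1⟩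

/-! ## Columns and tableaux -/

/-- The order on columns that governs horizontally adjacent columns. -/
def leCol (n : ℕ) (c d : ℤ × ℤ) : Prop := leLetter n c.1 d.1 ∧ leLetter n c.2 d.2

theorem leCol.trans {n : ℕ} {c d e : ℤ × ℤ} (h : leCol n c d) (h' : leCol n d e) : leCol n c e :=
  ⟨h.1.trans h'.1, h.2.trans h'.2⟩

theorem leCol.antisymm {n : ℕ} {c d : ℤ × ℤ} (h : leCol n c d) (h' : leCol n d c) : c = d :=
  Prod.ext (h.1.antisymm h'.1) (h.2.antisymm h'.2)

instance (n : ℕ) : IsTrans (ℤ × ℤ) (leCol n) := ⟨fun _ _ _ h h' => h.trans h'⟩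

/-- The pairs of columns `c`, `d` that are allowed with `c` to the left of `d`. -/
def Compatible (n : ℕ) (c d : ℤ × ℤ) : Prop :=
  ¬ (c = ((n : ℤ) - 1, (n : ℤ)) ∧ d = ((n : ℤ), -((n : ℤ) - 1))) ∧
  ¬ (c = ((n : ℤ) - 1, -(n : ℤ)) ∧ d = (-(n : ℤ), -((n : ℤ) - 1)))

/-- The condition on neighbouring columns of a Kashiwara–Nakashima tableau. -/
def NoConfig (c d : ℤ × ℤ) : Prop :=
  ¬ (d.2 = -d.1 ∧ c.1 = d.1) ∧ ¬ (c.2 = -c.1 ∧ d.2 = c.2)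

/-- The condition on a single column of a tableau. -/
def IsColumn (n : ℕ) (c : ℤ × ℤ) : Prop :=
  (IsLetter n c.1 ∧ IsLetter n c.2) ∧ ¬ leLetter n c.2 c.1

/-- Transitivity of `leCol` turns the condition on neighbours into one on all pairs, which passes to
sublists. -/
theorem isTableau_iff {n : ℕ} {T : List (ℤ × ℤ)} : IsTableau n T ↔
    (∀ c ∈ T, IsColumn n c) ∧ T.Pairwise (leCol n) ∧ T.Pairwise (Compatible n) := by
  constructor
  · intro h
    exact ⟨fun c hc => ⟨h.letters c hc, h.cols c hc⟩,
      (List.isChain_iff_pairwise (R := leCol n)).1 h.rows,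
      h.noPair⟩
  · rintro ⟨h1, h2, h3⟩
    exact ⟨fun c hc => (h1 c hc).1, (List.isChain_iff_pairwise (R := leCol n)).2 h2, fun c hc => (h1 c hc).2, h3⟩

theorem isKN_iff {n : ℕ} {T : List (ℤ × ℤ)} : IsKN n T ↔
    (∀ c ∈ T, IsColumn n c) ∧ T.Pairwise (leCol n) ∧ T.Pairwise (Compatible n) ∧
      T.IsChain NoConfig ∧ ((1 : ℤ), (-1 : ℤ)) ∉ T := by
  constructor
  · intro h
    have := isTableau_iff.1 h.toIsTableau
    exact ⟨this.1, this.2.1, this.2.2, h.noConfig, h.noOne⟩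
  · rintro ⟨h1, h2, h3, h4, h5⟩
    exact ⟨isTableau_iff.2 ⟨h1, h2, h3⟩, h4, h5⟩

/-! ## The Kashiwara–Nakashima tableaux are stable under `e_i` -/

theorem exists_split_of_colWord {t : List (ℤ × ℤ)} {u v : List ℤ} {x : ℤ}
    (h : colWord t = u ++ x :: v) :
    (∃ L c R, t = L ++ c :: R ∧ u = colWord L ∧ x = c.2 ∧ v = c.1 :: colWord R) ∨
    (∃ L c R, t = L ++ c :: R ∧ u = colWord L ++ [c.2] ∧ x = c.1 ∧ v = colWord R) := by
  induction t generalizing u with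
  | nil => simp [colWord] at h
  | cons c t ih =>
    match u, h with
    | [], h =>
      simp only [colWord, List.nil_append, List.cons.injEq] at h
      exact Or.inl ⟨[], c, t, rfl, rfl, h.1.symm, h.2.symm⟩
    | [_], h =>
      simp only [colWord, List.cons_append, List.nil_append, List.cons.injEq] at h
      refine Or.inr ⟨[], c, t, rfl, ?_, h.2.1.symm, h.2.2.symm⟩
      simp [colWord, h.1]
    | b :: a :: u, h =>
      simp only [colWord, List.cons_append, List.cons.injEq] at h
      obtain ⟨rfl, rfl, h⟩ := h
      rcases ih h with ⟨L, d, R, rfl, rfl, h2, h3⟩ | ⟨L, d, R, rfl, rfl, h2, h3⟩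
      · exact Or.inl ⟨c :: L, d, R, rfl, rfl, h2, h3⟩
      · exact Or.inr ⟨c :: L, d, R, rfl, rfl, h2, h3⟩

/-- The column in which `e_i` acts on a tableau: either on its top or on its bottom entry. -/
theorem exists_split_of_knE {n i : ℕ} (hn : 4 ≤ n) (hi : 1 ≤ i) {t t' : List (ℤ × ℤ)}
    (h : knE n i t = some t') : ∃ (L R : List (ℤ × ℤ)) (a b x : ℤ), t = L ++ (a, b) :: R ∧
      ((t' = L ++ (x, b) :: R ∧ letterE n i a = some x ∧ letterEps n i b = 0 ∧
          ∀ L₁ d L₂, L = L₁ ++ d :: L₂ → (letterEps n i d.1 = 1 →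
            letterPhi n i b = 1 ∨ ∃ q ∈ colWord L₂, letterPhi n i q = 1)) ∨
        (t' = L ++ (a, x) :: R ∧ letterE n i b = some x ∧ letterPhi n i a = 0 ∧
          ∀ L₁ d L₂, L = L₁ ++ d :: L₂ →
            (letterEps n i d.1 = 1 → ∃ q ∈ colWord L₂, letterPhi n i q = 1) ∧
            (letterEps n i d.2 = 1 → letterPhi n i d.1 = 1 ∨
              ∃ q ∈ colWord L₂, letterPhi n i q = 1))) := by
  obtain ⟨u, v, x, y, h1, h2, h3, h4, h5⟩ := exists_split_of_wordE hn hi (knE_eq_some.1 h)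
  rcases exists_split_of_colWord h1 with ⟨L, c, R, rfl, rfl, rfl, rfl⟩ | ⟨L, c, R, rfl, rfl, rfl, rfl⟩
  · refine ⟨L, R, c.1, c.2, y, rfl, Or.inr ⟨colWord_injective ?_, h3, ?_, ?_⟩⟩
    · rw [h2, colWord_append]; rfl
    · rw [wordPhi] at h4; omega
    · intro L₁ d L₂ hL
      constructor
      · exact fun hd => h5 (colWord L₁ ++ [d.2]) d.1 (colWord L₂)
          (by rw [hL, colWord_append]; simp [colWord]) hd
      · intro hd
        have := h5 (colWord L₁) d.2 (d.1 :: colWord L₂)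
          (by rw [hL, colWord_append]; simp [colWord]) hd
        simpa using this
  · refine ⟨L, R, c.1, c.2, y, rfl, Or.inl ⟨colWord_injective ?_, h3, ?_, ?_⟩⟩
    · rw [h2, colWord_append]; simp [colWord]
    -- `c.2` is read immediately before `c.1`, so there is no letter in between to cancel it.
    · by_contra h0
      have := letterEps_le_one n i c.2
      have := h5 (colWord L) c.2 [] rfl (by omega)
      simp at this
    · intro L₁ d L₂ hL hd
      have := h5 (colWord L₁ ++ [d.2]) d.1 (colWord L₂ ++ [c.2])
          (by rw [hL, colWord_append]; simp [colWord]) hd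
      obtain ⟨q, hq, h6⟩ := this
      rw [List.mem_append, List.mem_singleton] at hq
      rcases hq with hq | rfl
      · exact Or.inr ⟨q, hq, h6⟩
      · exact Or.inl h6

/-- A local modification of a Kashiwara–Nakashima tableau. -/
theorem IsKN.replace {n : ℕ} {L R : List (ℤ × ℤ)} {c c' : ℤ × ℤ} (h : IsKN n (L ++ c :: R))
    (hc : IsColumn n c') (h1 : c' ≠ (1, -1))
    (hL : ∀ L' d, L = L' ++ [d] → leCol n d c' ∧ NoConfig d c')
    (hR : ∀ d ∈ R, leCol n c' d) (hR' : ∀ d, R.head? = some d → NoConfig c' d)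
    (hLc : ∀ d ∈ L, Compatible n d c') (hRc : ∀ d ∈ R, Compatible n c' d) :
    IsKN n (L ++ c' :: R) := by
  rw [isKN_iff] at h ⊢
  obtain ⟨a1, a2, a3, a4, a5⟩ := h
  rw [List.pairwise_append, List.pairwise_cons] at a2 a3
  rw [List.isChain_append, List.isChain_cons] at a4
  refine ⟨?_, ?_, ?_, ?_, ?_⟩
  · intro d hd
    simp only [List.mem_append, List.mem_cons] at hd a1
    rcases hd with hd | rfl | hd
    · exact a1 d (Or.inl hd)
    · exact hc
    · exact a1 d (Or.inr (Or.inr hd))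
  · rw [List.pairwise_append, List.pairwise_cons]
    refine ⟨a2.1, ⟨hR, a2.2.1.2⟩, ?_⟩
    intro d hd e he
    rw [List.mem_cons] at he
    rcases he with rfl | he
    · rcases List.eq_nil_or_concat L with rfl | ⟨L', f, rfl⟩
      · simp at hd
      · have h2 := (hL L' f (by simp)).1
        rw [List.concat_eq_append, List.mem_append, List.mem_singleton] at hd
        rcases hd with hd | rfl
        · have := a2.1
          rw [List.concat_eq_append, List.pairwise_append] at this
          exact (this.2.2 d hd f (by simp)).trans h2
        · exact h2
    · exact a2.2.2 d hd e (by simp [he])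
  · rw [List.pairwise_append, List.pairwise_cons]
    refine ⟨a3.1, ⟨hRc, a3.2.1.2⟩, ?_⟩
    intro d hd e he
    rw [List.mem_cons] at he
    rcases he with rfl | he
    · exact hLc d hd
    · exact a3.2.2 d hd e (by simp [he])
  · rw [List.isChain_append, List.isChain_cons]
    refine ⟨a4.1, ⟨fun d hd => hR' d hd, a4.2.1.2⟩, ?_⟩
    intro d hd e he
    simp only [List.head?_cons, Option.mem_def, Option.some.injEq] at he
    subst he
    obtain ⟨L', rfl⟩ := List.getLast?_eq_some_iff.1 hd
    exact (hL L' d rfl).2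
  · simp only [List.mem_append, List.mem_cons] at a5 ⊢
    push Not at a5 ⊢
    exact ⟨a5.1, fun h => h1 h.symm, a5.2.2⟩

/-! ### Effect of one step of e_i on a column and on its relation to other columns. -/

theorem isColumn_letterE_fst {n i : ℕ} (hn : 4 ≤ n) (hi : 1 ≤ i) {a b x : ℤ}
    (hc : IsColumn n (a, b)) (h : letterE n i a = some x) : IsColumn n (x, b) := by
  refine ⟨⟨hc.1.1.letterE hn hi h, hc.1.2⟩, fun hb => hc.2 (hb.trans (Or.inr ?_))⟩
  have := height_letterE hn hi h
  unfold ltLetter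
  dsimp only
  omega

theorem isColumn_letterE_snd {n i : ℕ} (hn : 4 ≤ n) (hi : 1 ≤ i) {a b x : ℤ}
    (hc : IsColumn n (a, b)) (h : letterE n i b = some x) (ha : letterPhi n i a = 0) :
    IsColumn n (a, x) := by
  refine ⟨⟨hc.1.1, hc.1.2.letterE hn hi h⟩, fun hb => ?_⟩
  have h1 := hc.1.1.bounds
  have h2 := hc.1.2.bounds
  have h3 := hc.2
  have e1 := height_cases n a
  have e2 := height_cases n b
  have e3 := height_cases n x
  rw [letterPhi_eq_zero] at ha
  unfold leLetter ltLetter at *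
  dsimp only at *
  rcases letterE_eq_some.1 h with h | h | h | h <;> obtain ⟨h, rfl, h⟩ := h <;> omega

/-- The order can fail only if `d.1 = a`, or if `d.1` and `x` are the incomparable letters n, n̄. In
both cases ε_i(d.1) = 1, hence φ_i(b) = 1. For a column (a,b) this leaves only b = ā with `d.1 = a`,
which `NoConfig` excludes. -/
theorem leCol_letterE_fst {n i : ℕ} (hn : 4 ≤ n) (hi : 1 ≤ i) {a b x : ℤ} {d : ℤ × ℤ}
    (hc : IsColumn n (a, b)) (hd : IsColumn n d) (h : letterE n i a = some x)
    (hdc : leCol n d (a, b)) (hN : NoConfig d (a, b))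
    (hd1 : letterEps n i d.1 = 1 → letterPhi n i b = 1) : leCol n d (x, b) := by
  refine ⟨?_, hdc.2⟩
  obtain ⟨p, q⟩ := d
  have g1 := hdc.1
  have h1 := hc.1.1.bounds
  have h2 := hc.1.2.bounds
  have h3 := hc.2
  have h4 := hd.1.1.bounds
  have e1 := height_cases n a
  have e2 := height_cases n b
  have e3 := height_cases n x
  have e4 := height_cases n p
  rw [letterEps_eq_one, letterPhi_eq_one] at hd1
  have hN := hN.1
  unfold leLetter ltLetter at *
  dsimp only at *
  rcases letterE_eq_some.1 h with h | h | h | h <;> obtain ⟨h, rfl, h⟩ := h <;> omega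

/-- If `d.2 = b`, then ε_i(d.2) = 1 and so φ_i(d.1) = 1. Either `d` is a column (p,p̄), excluded by
`NoConfig`, or `a` is squeezed between `d.1` and `b` and would have φ_i(a) = 1. -/
theorem leCol_letterE_snd {n i : ℕ} (hn : 4 ≤ n) (hi : 1 ≤ i) {a b x : ℤ} {d : ℤ × ℤ}
    (hc : IsColumn n (a, b)) (hd : IsColumn n d) (h : letterE n i b = some x)
    (ha : letterPhi n i a = 0) (hdc : leCol n d (a, b)) (hN : NoConfig d (a, b))
    (hP : Compatible n d (a, b))
    (hd2 : letterEps n i d.2 = 1 → letterPhi n i d.1 = 1) : leCol n d (a, x) := by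
  refine ⟨hdc.1, ?_⟩
  obtain ⟨p, q⟩ := d
  have g1 := hdc.1
  have g2 := hdc.2
  have h1 := hc.1.1.bounds
  have h2 := hc.1.2.bounds
  have h3 := hc.2
  have h4 := hd.1.1.bounds
  have h5 := hd.1.2.bounds
  have h6 := hd.2
  have e1 := height_cases n a
  have e2 := height_cases n b
  have e3 := height_cases n x
  have e4 := height_cases n p
  have e5 := height_cases n q
  rw [letterEps_eq_one, letterPhi_eq_one] at hd2
  rw [letterPhi_eq_zero] at ha
  have hN := hN.2
  simp only [Compatible, Prod.mk.injEq] at hP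
  unfold leLetter ltLetter at *
  dsimp only at *
  have h7 := height_letterE hn hi h
  have h8 := letterEps_eq_one.1 (letterEps_of_letterE h)
  rcases g2 with rfl | g2
  · replace hd2 := hd2 h8
    clear h8 e5 hP
    exfalso
    rcases letterE_eq_some.1 h with h | h | h | h <;> obtain ⟨h, rfl, h⟩ := h <;>
      rcases g1 with rfl | g1 <;> omega
  -- The other obstruction: `q` and `x` are the incomparable letters n, n̄ and b is the bar of n-1.
  -- This is where `Compatible` is needed.
  · by_cases h9 : height n q < height n x
    · exact Or.inr h9
    by_cases h10 : q = x
    · exact Or.inl h10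
    exfalso
    have hx := (letterE_eq_some.1 h)
    have h13 := (hc.1.2.letterE hn hi h).bounds
    clear h8
    have h11 : height n q = n ∧ (q = n ∨ q = -n) := by
      clear ha hd2 hP g1 hN e1 e4 h3 h6
      clear hx
      omega
    have h12 : b = -(n - 1) := by
      clear ha hd2 hP g1 hN e1 e4 h3 h6
      clear hx
      omega
    subst h12
    clear e5 e3 e2
    rcases h11.2 with rfl | rfl <;> rcases hx with h | h | h | h <;> obtain ⟨h, h', h''⟩ := h <;>
      rcases g1 with rfl | g1 <;> omega

/-- Barring reverses the arrows of B(ϖ₁). This prevents new configurations: an uncancelled ȳ just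
before the changed letter would have received the action itself. So the column does not become (y,ȳ)
when its top changes to y, and its left neighbour does not have top entry ȳ when its bottom changes
to y. -/
theorem eps_neg_of_letterE {n i : ℕ} (hn : 4 ≤ n) (hi : 1 ≤ i) {x y : ℤ}
    (h : letterE n i x = some y) : letterEps n i (-y) = 1 := by
  rw [letterE_eq_some] at h
  rw [letterEps_eq_one]
  omega

theorem ne_neg_letterE_fst {n i : ℕ} {a b x : ℤ} (hn : 4 ≤ n) (hi : 1 ≤ i)
    (h : letterE n i a = some x) (hb : letterEps n i b = 0) : b ≠ -x := by
  rintro rfl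
  rw [eps_neg_of_letterE hn hi h] at hb
  exact one_ne_zero hb

theorem not_leLetter_letterE {n i : ℕ} (hn : 4 ≤ n) (hi : 1 ≤ i) {x y : ℤ}
    (h : letterE n i x = some y) : ¬ leLetter n x y := by
  intro h1
  have := height_letterE hn hi h
  have := h1.height_le
  omega

theorem leLetter_letterE {n i : ℕ} (hn : 4 ≤ n) (hi : 1 ≤ i) {x y : ℤ}
    (h : letterE n i x = some y) : leLetter n y x := by
  have := height_letterE hn hi h
  exact Or.inr (by unfold ltLetter; omega)

theorem letterE_ne_neg_one {n i : ℕ} (hn : 4 ≤ n) (hi : 1 ≤ i) {x y : ℤ}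
    (h : letterE n i x = some y) : y ≠ -1 := by
  rw [letterE_eq_some] at h
  omega

theorem compatible_letterE_fst_left {n i : ℕ} (hn : 4 ≤ n) {a b x : ℤ}
    (hc : IsColumn n (a, b)) (h : letterE n i a = some x) (d : ℤ × ℤ) :
    Compatible n d (x, b) := by
  have h1 : b ≠ a := fun h => hc.2 (Or.inl h)
  obtain ⟨p, q⟩ := d
  simp only [Compatible, Prod.mk.injEq]
  rw [letterE_eq_some] at h
  omega

/-- In a forbidden pair x = n-1, so a is n or n̄ and b = ā; then `e` would have top entry b,
incomparable with a. -/
theorem compatible_letterE_fst_right {n i : ℕ} (hn : 4 ≤ n) {a b x : ℤ} {e : ℤ × ℤ}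
    (hc : IsColumn n (a, b)) (h : letterE n i a = some x) (hce : leCol n (a, b) e) :
    Compatible n (x, b) e := by
  have h1 : b ≠ a := fun h => hc.2 (Or.inl h)
  obtain ⟨p, q⟩ := e
  have h2 := hce.1
  have e1 := height_cases n a
  have e2 := height_cases n p
  unfold leLetter ltLetter at h2
  simp only [Compatible, Prod.mk.injEq]
  dsimp only at *
  rw [letterE_eq_some] at h
  constructor
  · rintro ⟨⟨rfl, rfl⟩, rfl, rfl⟩
    omega
  · rintro ⟨⟨rfl, rfl⟩, rfl, rfl⟩
    omega

/-- A forbidden pair would need a = n-1 and both b and `e.2` equal to the bar of n-1. The bottom row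
is then constant from (a,b) to `e`, so (a,ā) has a right neighbour with bottom entry ā. -/
theorem compatible_letterE_snd_right {n i : ℕ} {a b x : ℤ} {R : List (ℤ × ℤ)}
    (hn : 4 ≤ n) (h : letterE n i b = some x)
    (hR : ((a, b) :: R).Pairwise (leCol n)) (hN : ∀ d, R.head? = some d → NoConfig (a, b) d)
    {e : ℤ × ℤ} (he : e ∈ R) : Compatible n (a, x) e := by
  have key : ¬ (a = n - 1 ∧ b = -(n - 1) ∧ e.2 = -(n - 1)) := by
    rintro ⟨rfl, rfl, h2⟩
    cases R with
    | nil => simp at he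
    | cons r R =>
      rw [List.pairwise_cons, List.pairwise_cons] at hR
      have h3 := (hR.1 r (by simp)).2
      have h4 : leLetter n r.2 e.2 := by
        rcases List.mem_cons.1 he with rfl | he
        · exact leLetter.refl _ _
        · exact (hR.2.1 e he).2
      rw [h2] at h4
      exact (hN r rfl).2 ⟨rfl, h4.antisymm h3⟩
  obtain ⟨p, q⟩ := e
  simp only [Compatible, Prod.mk.injEq]
  dsimp only at key
  rw [letterE_eq_some] at h
  omega

/-- A forbidden pair forces i = n-2 and `d.1 = n - 1`, so ε_i(d.1) = 1 must be cancelled by a letter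
strictly between the two columns. Row order and compatibility with `d` put that letter in a column
with entries n-1 and its bar, whose left neighbour also has top entry n-1: a configuration. -/
theorem compatible_letterE_snd_left {n i : ℕ} {a b x : ℤ} {L₁ L₂ : List (ℤ × ℤ)} {d : ℤ × ℤ}
    (hn : 4 ≤ n) (h : letterE n i b = some x)
    (hcol : ∀ e ∈ L₁ ++ d :: L₂ ++ [(a, b)], IsColumn n e)
    (hL : (L₁ ++ d :: L₂ ++ [(a, b)]).Pairwise (leCol n))
    (hC : (L₁ ++ d :: L₂).Pairwise (Compatible n)) (hN : (L₁ ++ d :: L₂).IsChain NoConfig)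
    (hd : letterEps n i d.1 = 1 → ∃ q ∈ colWord L₂, letterPhi n i q = 1) :
    Compatible n d (a, x) := by
  by_contra hcon
  have hd' : d.1 = n - 1 ∧ (d.2 = n ∨ d.2 = -n) ∧ d.2 = a ∧ x = -(n - 1) := by
    obtain ⟨p, q⟩ := d
    simp only [Compatible, Prod.mk.injEq] at hcon
    dsimp only
    omega
  obtain ⟨hd1, hd2, hda, rfl⟩ := hd'
  rw [letterE_eq_some] at h
  have hi : (i : ℤ) = n - 2 := by omega
  obtain ⟨q, hq, hq1⟩ := hd (letterEps_eq_one.2 (by omega))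
  rw [letterPhi_eq_one] at hq1
  obtain ⟨e, he, hqe⟩ := mem_colWord.1 hq
  have hec := hcol e (by simp [he])
  rw [List.append_assoc, List.pairwise_append, List.cons_append, List.pairwise_cons,
    List.pairwise_append] at hL
  have hde := hL.2.1.1 e (by simp [he])
  have hec' := hL.2.1.2.2.2 e he (a, b) (by simp)
  have hCde : Compatible n d e := by
    rw [List.pairwise_append, List.pairwise_cons] at hC
    exact hC.2.1.1 e he
  have he1 : e.1 = n - 1 ∧ e.2 = -(n - 1) := by
    obtain ⟨p, r⟩ := e
    obtain ⟨p', r'⟩ := d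
    simp only [Compatible, Prod.mk.injEq] at hCde
    have g1 := hde.1
    have g2 := hde.2
    have g3 := hec'.1
    have b1 := hec.1.1.bounds
    have e1 := height_cases n p
    have e2 := height_cases n r
    have e3 := height_cases n p'
    have e4 := height_cases n r'
    clear hd hq hN hC hL
    unfold leLetter ltLetter at g1 g2 g3
    dsimp only at *
    subst hd1 hda
    rcases hd2 with rfl | rfl <;> omega
  obtain ⟨L₃, L₄, rfl⟩ := List.append_of_mem he
  -- `f` is the left neighbour of `e`, possibly `d` itself.
  obtain ⟨M, f, hf⟩ : ∃ M f, L₁ ++ d :: L₃ = M ++ [f] :=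
    ⟨_, _, (List.dropLast_append_getLast (by simp)).symm⟩
  have hfd : f.1 = n - 1 := by
    have hf' : f ∈ d :: L₃ := by
      have : (L₁ ++ d :: L₃).getLast? = some f := by rw [hf]; simp
      rw [List.getLast?_append] at this
      simp only [List.getLast?_cons, Option.some_or, Option.some.injEq] at this
      rw [← this]
      cases h : L₃.getLast? with
      | none => simp
      | some y => simp [List.mem_of_getLast? h]
    rcases List.mem_cons.1 hf' with rfl | hf'
    · exact hd1
    · have h1 := (hL.2.1.1 f (by simp [hf'])).1
      have h2 := hL.2.1.2.1
      rw [List.pairwise_append] at h2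
      have h3 := (h2.2.2 f hf' e (by simp)).1
      rw [he1.1] at h3
      rw [hd1] at h1
      exact h3.antisymm h1
  have h4 : L₁ ++ d :: (L₃ ++ e :: L₄) = M ++ [f] ++ e :: L₄ := by rw [← hf]; simp
  rw [h4, List.isChain_append] at hN
  exact (hN.2.2 f (by simp) e (by simp)).1 ⟨by omega, by omega⟩

/-- The Kashiwara–Nakashima tableaux with two rows are stable under `e_i`. -/
theorem IsKN.knE {n i : ℕ} (hn : 4 ≤ n) (hi : 1 ≤ i) {t t' : List (ℤ × ℤ)} (ht : IsKN n t)
    (h : knE n i t = some t') : IsKN n t' := by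
  obtain ⟨L, R, a, b, x, rfl, h'⟩ := exists_split_of_knE hn hi h
  clear h
  obtain ⟨a1, a2, a3, a4, a5⟩ := isKN_iff.1 ht
  have hc := a1 (a, b) (by simp)
  have hLc : ∀ d ∈ L, leCol n d (a, b) := fun d hd => (List.pairwise_append.1 a2).2.2 d hd _ (by simp)
  have hRp := (List.pairwise_append.1 a2).2.1
  have hRc := (List.pairwise_cons.1 hRp).1
  have hLN : ∀ L' d, L = L' ++ [d] → NoConfig d (a, b) := fun L' d hd =>
    (List.isChain_append.1 a4).2.2 d (by simp [hd]) _ (by simp)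
  have hRN : ∀ d, R.head? = some d → NoConfig (a, b) d := fun d hd =>
    (List.isChain_cons.1 (List.isChain_append.1 a4).2.1).1 d hd
  rcases h' with ⟨rfl, h, hb, hp⟩ | ⟨rfl, h, ha, hp⟩
  · have hne := ne_neg_letterE_fst hn hi h hb
    refine ht.replace (isColumn_letterE_fst hn hi hc h) ?_ ?_ ?_ ?_ ?_ ?_
    · rw [ne_eq, Prod.mk.injEq]
      rintro ⟨rfl, h2⟩
      exact hne h2
    · intro L' d hL
      have hp' := hp L' d [] hL
      simp only [colWord, List.not_mem_nil, false_and, exists_false, or_false] at hp'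
      have hdL : d ∈ L := by simp [hL]
      exact ⟨leCol_letterE_fst hn hi hc (a1 d (by simp [hdL])) h (hLc d hdL) (hLN L' d hL) hp',
        fun h1 => hne h1.1, (hLN L' d hL).2⟩
    · exact fun d hd => leCol.trans (d := (a, b))
        ⟨leLetter_letterE hn hi h, leLetter.refl _ _⟩ (hRc d hd)
    · intro d hd
      refine ⟨fun h1 => not_leLetter_letterE hn hi h ?_, fun h1 => hne h1.1⟩
      have := (hRc d (List.mem_of_mem_head? hd)).1
      rwa [← h1.2] at this
    · exact fun d hd => compatible_letterE_fst_left hn hc h d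
    · exact fun d hd => compatible_letterE_fst_right hn hc h (hRc d hd)
  · have hx := eps_neg_of_letterE hn hi h
    have key : ∀ L' d, L = L' ++ [d] → d.1 ≠ -x := by
      intro L' d hL hdx
      rw [← hdx] at hx
      have := (hp L' d [] hL).1 hx
      simp [colWord] at this
    refine ht.replace (isColumn_letterE_snd hn hi hc h ha) ?_ ?_ ?_ ?_ ?_ ?_
    · rw [ne_eq, Prod.mk.injEq]
      exact fun h1 => letterE_ne_neg_one hn hi h h1.2
    · intro L' d hL
      have hp' := (hp L' d [] hL).2
      simp only [colWord, List.not_mem_nil, false_and, exists_false, or_false] at hp'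
      have hdL : d ∈ L := by simp [hL]
      have hdL' : d ∈ L ++ (a, b) :: R := by simp [hdL]
      have hP := (List.pairwise_append.1 a3).2.2 d hdL _ (List.mem_cons_self ..)
      have := key L' d hL
      refine ⟨leCol_letterE_snd hn hi hc (a1 d hdL') h ha (hLc d hdL) (hLN L' d hL) hP hp', ?_, ?_⟩
      · dsimp only
        omega
      · dsimp only
        omega
    · exact fun d hd => leCol.trans (d := (a, b))
        ⟨leLetter.refl _ _, leLetter_letterE hn hi h⟩ (hRc d hd)
    · intro d hd
      refine ⟨(hRN d hd).1, fun h1 => not_leLetter_letterE hn hi h ?_⟩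
      have := (hRc d (List.mem_of_mem_head? hd)).2
      rwa [h1.2] at this
    · intro d hd
      obtain ⟨L₁, L₂, rfl⟩ := List.append_of_mem hd
      have hs : (L₁ ++ d :: L₂ ++ [(a, b)]).Sublist (L₁ ++ d :: L₂ ++ (a, b) :: R) :=
        List.Sublist.append_left (by simp) _
      exact compatible_letterE_snd_left hn h (fun e he => a1 e (hs.subset he)) (a2.sublist hs)
        (List.pairwise_append.1 a3).1 (List.isChain_append.1 a4).1 (hp L₁ d L₂ rfl).1
    · exact fun d hd => compatible_letterE_snd_right hn h hRp hRN hd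

/-! ## Splitting a tableau at the columns `(a, ā)` -/

/-- The columns `(a, b)` with `a < b̄`. -/
abbrev IsPos (n : ℕ) (c : ℤ × ℤ) : Prop := height n c.1 < height n (-c.2)

/-- The columns `(a, b)` with `b̄ < a`. -/
abbrev IsNeg (n : ℕ) (c : ℤ × ℤ) : Prop := height n (-c.2) < height n c.1

theorem isPos_or_isNeg_or_eq {n : ℕ} {c : ℤ × ℤ} (hc : IsColumn n c) :
    IsPos n c ∨ IsNeg n c ∨ c = (c.1, -c.1) := by
  obtain ⟨a, b⟩ := c
  have h1 := hc.1.1.bounds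
  have h2 := hc.1.2.bounds
  have h3 := hc.2
  have e1 := height_cases n a
  have e2 := height_cases n b
  have e3 := height_cases n (-b)
  unfold leLetter ltLetter at h3
  simp only [IsPos, IsNeg, Prod.mk.injEq, true_and]
  dsimp only at *
  omega

theorem not_isNeg_zero {n : ℕ} (a : ℤ) : ¬ IsNeg n (a, -a) := by simp [IsNeg]

theorem IsPos.of_leCol {n : ℕ} {c d : ℤ × ℤ} (hc : IsColumn n c) (hd : IsColumn n d)
    (h : leCol n c d) (hp : IsPos n d) : IsPos n c := by
  have h1 := h.1.height_le
  have h2 := (leLetter.neg hc.1.2 hd.1.2 h.2).height_le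
  unfold IsPos at *
  omega

theorem IsPos.of_leCol_zero {n : ℕ} {c : ℤ × ℤ} {a : ℤ} (hc : IsColumn n c)
    (hd : IsColumn n (a, -a)) (h : leCol n c (a, -a)) (hne : c ≠ (a, -a)) : IsPos n c := by
  have h1 := h.1
  have h2 := leLetter.neg hc.1.2 hd.1.2 h.2
  obtain ⟨p, q⟩ := c
  simp only [neg_neg, ne_eq, Prod.mk.injEq] at h1 h2 hne
  unfold IsPos
  rcases h1 with rfl | h1
  · rcases h2 with h2 | h2
    · omega
    · exact h2
  · have := h2.height_le
    unfold ltLetter at h1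
    dsimp only
    omega

theorem IsNeg.of_leCol_zero {n : ℕ} {c : ℤ × ℤ} {a : ℤ} (hc : IsColumn n c)
    (hd : IsColumn n (a, -a)) (h : leCol n (a, -a) c) (hne : c ≠ (a, -a)) : IsNeg n c := by
  have h1 := h.1
  have h2 := leLetter.neg hd.1.2 hc.1.2 h.2
  obtain ⟨p, q⟩ := c
  simp only [neg_neg, ne_eq, Prod.mk.injEq] at h1 h2 hne
  unfold IsNeg
  rcases h1 with rfl | h1
  · rcases h2 with h2 | h2
    · omega
    · exact h2
  · have := h2.height_le
    unfold ltLetter at h1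
    dsimp only
    omega

/-- Along a tableau the tops increase and the barred bottoms decrease, so positive columns come
first and negative ones last. Two columns (a,ā) comparable in `leCol` coincide, so the middle is a
single block. -/
theorem exists_split {n : ℕ} {T : List (ℤ × ℤ)} (hT : IsTableau n T) :
    ∃ (P N : List (ℤ × ℤ)) (m : ℕ) (a : ℤ), T = P ++ List.replicate m (a, -a) ++ N ∧
      (∀ c ∈ P, IsPos n c) ∧ ∀ c ∈ N, IsNeg n c := by
  rw [isTableau_iff] at hT
  obtain ⟨h1, h2, -⟩ := hT
  induction T with
  | nil => exact ⟨[], [], 0, 0, by simp⟩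
  | cons c T ih =>
    rw [List.pairwise_cons] at h2
    obtain ⟨P, N, m, a, hT, hP, hN⟩ := ih (fun d hd => h1 d (by simp [hd])) h2.2
    have hc := h1 c (by simp)
    have hpos : ∀ d ∈ P, IsPos n c := fun d hd => by
      have hd' : d ∈ T := by simp [hT, hd]
      exact (hP d hd).of_leCol hc (h1 d (by simp [hd'])) (h2.1 d hd')
    have hzero : 1 ≤ m → c ≠ (a, -a) → IsPos n c := fun hm hne => by
      have hd' : (a, -a) ∈ T := by
        rw [hT]
        simp only [List.mem_append, List.mem_replicate]
        exact Or.inl (Or.inr (by simp; omega))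
      exact IsPos.of_leCol_zero hc (h1 _ (by simp [hd'])) (h2.1 _ hd') hne
    by_cases hcp : IsPos n c
    · refine ⟨c :: P, N, m, a, by simp [hT], ?_, hN⟩
      intro d hd
      rcases List.mem_cons.1 hd with rfl | hd
      exacts [hcp, hP d hd]
    have hPe : P = [] := List.eq_nil_iff_forall_not_mem.2 fun d hd => hcp (hpos d hd)
    subst hPe
    rcases isPos_or_isNeg_or_eq hc with h | h | h
    · exact absurd h hcp
    · have hm : m = 0 := by
        by_contra hm
        refine hcp (hzero (by omega) fun hca => ?_)
        rw [hca] at h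
        exact not_isNeg_zero a h
      subst hm
      refine ⟨[], c :: N, 0, 0, by simp [hT], by simp, ?_⟩
      intro d hd
      rcases List.mem_cons.1 hd with rfl | hd
      exacts [h, hN d hd]
    · rcases Nat.eq_zero_or_pos m with rfl | hm
      · exact ⟨[], N, 1, c.1, by simpa [hT] using h, by simp, hN⟩
      · have hca : c = (a, -a) := by
          by_contra hne
          exact hcp (hzero hm hne)
        exact ⟨[], N, m + 1, a, by simp [hT, List.replicate_succ, hca], by simp, hN⟩

theorem filter_isPos_split {n : ℕ} {P N : List (ℤ × ℤ)} (m : ℕ) (a : ℤ)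
    (hP : ∀ c ∈ P, IsPos n c) (hN : ∀ c ∈ N, IsNeg n c) :
    (P ++ List.replicate m (a, -a) ++ N).filter (fun c => IsPos n c) = P := by
  rw [List.filter_append, List.filter_append, List.filter_eq_self.2 (by simpa using hP),
    List.filter_eq_nil_iff.2, List.filter_eq_nil_iff.2]
  · simp
  · intro c hc
    have := hN c hc
    unfold IsNeg IsPos at *
    simp
    omega
  · intro c hc
    rw [List.eq_of_mem_replicate hc]
    simp

theorem filter_isNeg_split {n : ℕ} {P N : List (ℤ × ℤ)} (m : ℕ) (a : ℤ)
    (hP : ∀ c ∈ P, IsPos n c) (hN : ∀ c ∈ N, IsNeg n c) :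
    (P ++ List.replicate m (a, -a) ++ N).filter (fun c => IsNeg n c) = N := by
  rw [List.filter_append, List.filter_append, List.filter_eq_nil_iff.2, List.filter_eq_nil_iff.2,
    List.filter_eq_self.2 (by simpa using hN)]
  · simp
  · intro c hc
    rw [List.eq_of_mem_replicate hc]
    simp
  · intro c hc
    have := hP c hc
    unfold IsNeg IsPos at *
    simp
    omega

/-- The outer parts are recovered by filtering for `IsPos` and `IsNeg`; what remains is the block.
-/
theorem split_unique {n : ℕ} {P N L R : List (ℤ × ℤ)} {m k : ℕ} {a b : ℤ}
    (hP : ∀ c ∈ P, IsPos n c) (hN : ∀ c ∈ N, IsNeg n c)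
    (hL : ∀ c ∈ L, IsPos n c) (hR : ∀ c ∈ R, IsNeg n c)
    (h : P ++ List.replicate m (a, -a) ++ N = L ++ List.replicate k (b, -b) ++ R) :
    P = L ∧ N = R ∧ m = k ∧ (1 ≤ m → a = b) := by
  have h1 : P = L := by
    rw [← filter_isPos_split m a hP hN, h, filter_isPos_split k b hL hR]
  have h2 : N = R := by
    rw [← filter_isNeg_split m a hP hN, h, filter_isNeg_split k b hL hR]
  subst h1 h2
  rw [List.append_cancel_right_eq, List.append_cancel_left_eq] at h
  have h3 : m = k := by simpa using congrArg List.length h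
  subst h3
  refine ⟨rfl, rfl, rfl, fun hm => ?_⟩
  have h4 : (a, -a) ∈ List.replicate m (b, -b) := by
    rw [← h, List.mem_replicate]
    exact ⟨by omega, rfl⟩
  exact congrArg Prod.fst (List.eq_of_mem_replicate h4)

theorem IsTableau.sublist {n : ℕ} {T t : List (ℤ × ℤ)} (h : IsTableau n T) (ht : t.Sublist T) :
    IsTableau n t := by
  rw [isTableau_iff] at h ⊢
  exact ⟨fun c hc => h.1 c (ht.subset hc), h.2.1.sublist ht, h.2.2.sublist ht⟩

theorem compatible_zero_left {n : ℕ} (hn : 4 ≤ n) (a : ℤ) (d : ℤ × ℤ) :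
    Compatible n (a, -a) d := by
  simp only [Compatible, Prod.mk.injEq]
  omega

theorem compatible_zero_right {n : ℕ} (hn : 4 ≤ n) (a : ℤ) (d : ℤ × ℤ) :
    Compatible n d (a, -a) := by
  obtain ⟨p, q⟩ := d
  simp only [Compatible, Prod.mk.injEq]
  omega

theorem IsTableau.insert {n : ℕ} (hn : 4 ≤ n) {P N : List (ℤ × ℤ)} (m : ℕ) {a : ℤ}
    (h : IsTableau n (P ++ N)) (ha : IsColumn n (a, -a)) (hP : ∀ c ∈ P, leCol n c (a, -a))
    (hN : ∀ c ∈ N, leCol n (a, -a) c) : IsTableau n (P ++ List.replicate m (a, -a) ++ N) := by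
  rw [isTableau_iff] at h ⊢
  obtain ⟨h1, h2, h3⟩ := h
  simp only [List.mem_append] at h1
  rw [List.pairwise_append] at h2 h3
  refine ⟨?_, ?_, ?_⟩
  · intro c hc
    simp only [List.mem_append] at hc
    rcases hc with (hc | hc) | hc
    · exact h1 c (Or.inl hc)
    · rwa [List.eq_of_mem_replicate hc]
    · exact h1 c (Or.inr hc)
  · rw [List.append_assoc, List.pairwise_append, List.pairwise_append, List.pairwise_replicate]
    refine ⟨h2.1, ⟨Or.inr ⟨leLetter.refl _ _, leLetter.refl _ _⟩, h2.2.1, ?_⟩, ?_⟩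
    · intro c hc d hd
      rw [List.eq_of_mem_replicate hc]
      exact hN d hd
    · intro c hc d hd
      rcases List.mem_append.1 hd with hd | hd
      · rw [List.eq_of_mem_replicate hd]
        exact hP c hc
      · exact h2.2.2 c hc d hd
  · rw [List.append_assoc, List.pairwise_append, List.pairwise_append, List.pairwise_replicate]
    refine ⟨h3.1, ⟨Or.inr (compatible_zero_left hn _ _), h3.2.1, ?_⟩, ?_⟩
    · intro c hc d hd
      rw [List.eq_of_mem_replicate hc]
      exact compatible_zero_left hn _ _
    · intro c hc d hd
      rcases List.mem_append.1 hd with hd | hd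
      · rw [List.eq_of_mem_replicate hd]
        exact compatible_zero_right hn _ _
      · exact h3.2.2 c hc d hd

/-- A tableau is split by a maximal block of columns `(a, ā)`. -/
theorem IsTableau.isPos_and_isNeg_of_block {n : ℕ} {L R : List (ℤ × ℤ)} {m : ℕ} {a : ℤ}
    (h : IsTableau n (L ++ List.replicate m (a, -a) ++ R)) (hm : 1 ≤ m)
    (hL : L.getLast? ≠ some (a, -a)) (hR : R.head? ≠ some (a, -a)) :
    (∀ c ∈ L, IsPos n c) ∧ ∀ c ∈ R, IsNeg n c := by
  rw [isTableau_iff] at h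
  obtain ⟨h1, h2, -⟩ := h
  have hz : (a, -a) ∈ List.replicate m (a, -a) := List.mem_replicate.2 ⟨by omega, rfl⟩
  have hzc := h1 (a, -a) (List.mem_append_left _ (List.mem_append_right _ hz))
  rw [List.append_assoc, List.pairwise_append, List.pairwise_append] at h2
  -- By antisymmetry, a copy farther away would make the neighbour of the block a copy as well,
  -- against maximality.
  have hL' : (a, -a) ∉ L := by
    intro hz'
    rcases List.eq_nil_or_concat L with rfl | ⟨L', e, rfl⟩
    · simp at hz'
    · rw [List.concat_eq_append] at *
      have h3 := h2.2.2 e (by simp) (a, -a) (List.mem_append_left _ hz)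
      rcases List.mem_append.1 hz' with hz' | hz'
      · have h4 := (List.pairwise_append.1 h2.1).2.2 _ hz' e (by simp)
        exact hL (by simp [h3.antisymm h4])
      · simp at hz'
        exact hL (by simp [hz'])
  have hR' : (a, -a) ∉ R := by
    intro hz'
    cases R with
    | nil => simp at hz'
    | cons e R =>
      have h3 := h2.2.1.2.2 _ hz e (by simp)
      rcases List.mem_cons.1 hz' with hz' | hz'
      · exact hR (by simp [hz'])
      · have h4 := (List.pairwise_cons.1 h2.2.1.2.1).1 _ hz'
        exact hR (by simp [h4.antisymm h3])
  constructor
  · intro c hc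
    refine IsPos.of_leCol_zero (h1 c (by simp [hc])) hzc
      (h2.2.2 c hc _ (List.mem_append_left _ hz)) fun h => hL' (h ▸ hc)
  · intro c hc
    refine IsNeg.of_leCol_zero (h1 c (by simp [hc])) hzc
      (h2.2.1.2.2 _ hz c hc) fun h => hR' (h ▸ hc)

/-- A block of columns `(a, ā)` between `P` and `N` has a left neighbour with top entry `a` or a
right neighbour with bottom entry `ā`. -/
def Touches (P N : List (ℤ × ℤ)) (a : ℤ) : Prop :=
  (∃ b, P.getLast? = some (a, b)) ∨ ∃ d, N.head? = some (d, -a)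

theorem noConfig_of_ne_zero {c d : ℤ × ℤ} (hc : c.2 ≠ -c.1) (hd : d.2 ≠ -d.1) : NoConfig c d :=
  ⟨fun h => hd h.1, fun h => hc h.1⟩

theorem IsPos.ne_zero {n : ℕ} {c : ℤ × ℤ} (h : IsPos n c) : c.2 ≠ -c.1 := by
  intro h'
  simp [IsPos, h'] at h

theorem IsNeg.ne_zero {n : ℕ} {c : ℤ × ℤ} (h : IsNeg n c) : c.2 ≠ -c.1 := by
  intro h'
  simp [IsNeg, h'] at h

/-- `P` and `N` contain no column (c,c̄), so only the block can violate the extra conditions. -/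
theorem isKN_split_iff {n : ℕ} {P N : List (ℤ × ℤ)} {m : ℕ} {a : ℤ}
    (hP : ∀ c ∈ P, IsPos n c) (hN : ∀ c ∈ N, IsNeg n c)
    (h : IsTableau n (P ++ List.replicate m (a, -a) ++ N)) :
    IsKN n (P ++ List.replicate m (a, -a) ++ N) ↔ m = 0 ∨ (m = 1 ∧ ¬ Touches P N a ∧ a ≠ 1) := by
  have h1 : ((1 : ℤ), (-1 : ℤ)) ∉ P := fun h => (hP _ h).ne_zero rfl
  have h2 : ((1 : ℤ), (-1 : ℤ)) ∉ N := fun h => (hN _ h).ne_zero rfl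
  have hPP : P.IsChain NoConfig := List.Pairwise.isChain <| List.pairwise_iff_forall_sublist.2
    fun hs => noConfig_of_ne_zero (hP _ (hs.subset (by simp))).ne_zero
      (hP _ (hs.subset (by simp))).ne_zero
  have hNN : N.IsChain NoConfig := List.Pairwise.isChain <| List.pairwise_iff_forall_sublist.2
    fun hs => noConfig_of_ne_zero (hN _ (hs.subset (by simp))).ne_zero
      (hN _ (hs.subset (by simp))).ne_zero
  constructor
  · intro hK
    have h3 := hK.noConfig
    have h4 := hK.noOne
    change List.IsChain NoConfig _ at h3
    rw [List.append_assoc, List.isChain_append] at h3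
    match m with
    | 0 => exact Or.inl rfl
    | 1 =>
      refine Or.inr ⟨rfl, ?_, ?_⟩
      · rintro (⟨b, hb⟩ | ⟨d, hd⟩)
        · exact (h3.2.2 _ hb (a, -a) (by simp)).1 ⟨rfl, rfl⟩
        · have h5 := h3.2.1
          rw [List.replicate_one, List.singleton_append, List.isChain_cons] at h5
          exact (h5.1 _ hd).2 ⟨rfl, rfl⟩
      · rintro rfl
        exact h4 (by simp)
    | m + 2 =>
      have h5 := h3.2.1
      rw [List.replicate_succ, List.replicate_succ, List.cons_append, List.cons_append,
        List.isChain_cons_cons] at h5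
      exact absurd ⟨rfl, rfl⟩ h5.1.1
  · rintro (rfl | ⟨rfl, ht, ha⟩)
    · refine ⟨h, ?_, ?_⟩
      · change List.IsChain NoConfig _
        simp only [List.replicate_zero, List.append_nil]
        exact List.isChain_append.2 ⟨hPP, hNN, fun c hc d hd => noConfig_of_ne_zero
          (hP c (List.mem_of_getLast? hc)).ne_zero (hN d (List.mem_of_mem_head? hd)).ne_zero⟩
      · simp [h1, h2]
    · refine ⟨h, ?_, ?_⟩
      · change List.IsChain NoConfig _
        rw [List.append_assoc, List.replicate_one, List.singleton_append, List.isChain_append,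
          List.isChain_cons]
        refine ⟨hPP, ⟨?_, hNN⟩, ?_⟩
        · rintro ⟨p, q⟩ hd
          refine ⟨fun h5 => (hN _ (List.mem_of_mem_head? hd)).ne_zero h5.1, fun h5 => ?_⟩
          have h6 : q = -a := h5.2
          subst h6
          exact ht (Or.inr ⟨p, hd⟩)
        · rintro ⟨p, q⟩ hd e he
          simp only [List.head?_cons, Option.mem_def, Option.some.injEq] at he
          subst he
          refine ⟨fun h5 => ?_, fun h5 => (hP _ (List.mem_of_getLast? hd)).ne_zero h5.1⟩
          have h6 : p = a := h5.2
          subst h6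
          exact ht (Or.inl ⟨q, hd⟩)
      · simp only [List.replicate_one, List.mem_append, h1, h2, List.mem_singleton, Prod.mk.injEq,
          false_or, or_false]
        exact fun h5 => ha h5.1.symm

/-! ## The drop map -/

/-- Each form of `ConfigDrop` exhibits a maximal block, so by `split_unique` it is the given
splitting, and `Touches` alone decides the outcome. -/
theorem configDrop_split {n : ℕ} {P N t : List (ℤ × ℤ)} {m : ℕ} {a : ℤ}
    (hP : ∀ c ∈ P, IsPos n c) (hN : ∀ c ∈ N, IsNeg n c)
    (hT : IsTableau n (P ++ List.replicate m (a, -a) ++ N))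
    (h : ConfigDrop n (P ++ List.replicate m (a, -a) ++ N) t) :
    (Touches P N a ∧ t = P ++ N) ∨ (¬ Touches P N a ∧ t = P ++ [(a, -a)] ++ N) := by
  obtain ⟨b, k, L, R, -, hk, h⟩ := h
  rcases h with ⟨h, rfl, ⟨c, hc, hcb⟩, hR⟩ | ⟨h, rfl, ⟨c, hc, hcb⟩, hL⟩ | ⟨h, rfl, hL, hR⟩
  · rw [h] at hT
    obtain ⟨hL', hR'⟩ := hT.isPos_and_isNeg_of_block hk (by rw [hc]; simpa using hcb) hR
    obtain ⟨rfl, rfl, rfl, h5⟩ := split_unique hP hN hL' hR' h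
    obtain rfl := h5 hk
    exact Or.inl ⟨Or.inl ⟨c, hc⟩, rfl⟩
  · rw [h] at hT
    obtain ⟨hL', hR'⟩ := hT.isPos_and_isNeg_of_block hk hL (by rw [hc]; simpa using hcb)
    obtain ⟨rfl, rfl, rfl, h5⟩ := split_unique hP hN hL' hR' h
    obtain rfl := h5 hk
    exact Or.inl ⟨Or.inr ⟨c, hc⟩, rfl⟩
  · rw [h] at hT
    obtain ⟨hL', hR'⟩ := hT.isPos_and_isNeg_of_block (by omega)
      (fun h => hL _ h rfl) (fun h => hR _ h rfl)
    obtain ⟨rfl, rfl, rfl, h5⟩ := split_unique hP hN hL' hR' h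
    obtain rfl := h5 (by omega)
    refine Or.inr ⟨?_, rfl⟩
    rintro (⟨c, hc⟩ | ⟨c, hc⟩)
    · exact hL _ hc rfl
    · exact hR _ hc rfl

theorem IsColumn.zero_range {n : ℕ} {a : ℤ} (h : IsColumn n (a, -a)) :
    (1 ≤ a ∧ a ≤ n) ∨ a = -n := by
  have h1 := h.1.1.bounds
  have h2 := h.2
  have e1 := height_cases n a
  have e2 := height_cases n (-a)
  unfold leLetter ltLetter at h2
  dsimp only at *
  omega

theorem isColumn_of_split {n : ℕ} {P N : List (ℤ × ℤ)} {m : ℕ} {a : ℤ}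
    (hT : IsTableau n (P ++ List.replicate m (a, -a) ++ N)) (hm : 1 ≤ m) : IsColumn n (a, -a) :=
  (isTableau_iff.1 hT).1 _ (List.mem_append_left _ (List.mem_append_right _
    (List.mem_replicate.2 ⟨by omega, rfl⟩)))

theorem leCol_of_split_left {n : ℕ} {P N : List (ℤ × ℤ)} {m : ℕ} {a : ℤ}
    (hT : IsTableau n (P ++ List.replicate m (a, -a) ++ N)) (hm : 1 ≤ m) :
    ∀ c ∈ P, leCol n c (a, -a) := by
  have h := (isTableau_iff.1 hT).2.1
  rw [List.append_assoc, List.pairwise_append] at h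
  exact fun c hc => h.2.2 c hc _ (List.mem_append_left _ (List.mem_replicate.2 ⟨by omega, rfl⟩))

theorem leCol_of_split_right {n : ℕ} {P N : List (ℤ × ℤ)} {m : ℕ} {a : ℤ}
    (hT : IsTableau n (P ++ List.replicate m (a, -a) ++ N)) (hm : 1 ≤ m) :
    ∀ c ∈ N, leCol n (a, -a) c := by
  have h := (isTableau_iff.1 hT).2.1
  rw [List.pairwise_append] at h
  exact fun c hc => h.2.2 _ (List.mem_append_right _ (List.mem_replicate.2 ⟨by omega, rfl⟩)) c hc

theorem configDrop_of_split {n : ℕ} {P N : List (ℤ × ℤ)} {m : ℕ} {a : ℤ}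
    (hP : ∀ c ∈ P, IsPos n c) (hN : ∀ c ∈ N, IsNeg n c)
    (hT : IsTableau n (P ++ List.replicate m (a, -a) ++ N)) (hm : 1 ≤ m)
    (ht : Touches P N a) : ConfigDrop n (P ++ List.replicate m (a, -a) ++ N) (P ++ N) := by
  refine ⟨a, m, P, N, (isColumn_of_split hT hm).zero_range, hm, ?_⟩
  rcases ht with ⟨b, hb⟩ | ⟨b, hb⟩
  · exact Or.inl ⟨rfl, rfl, ⟨b, hb, (hP _ (List.mem_of_getLast? hb)).ne_zero⟩,
      fun h => (hN _ (List.mem_of_mem_head? h)).ne_zero rfl⟩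
  · exact Or.inr (Or.inl ⟨rfl, rfl, ⟨b, hb, fun h => (hN _ (List.mem_of_mem_head? hb)).ne_zero
      (by simp [h])⟩, fun h => (hP _ (List.mem_of_getLast? h)).ne_zero rfl⟩)

theorem configDrop_of_split' {n : ℕ} {P N : List (ℤ × ℤ)} {m : ℕ} {a : ℤ}
    (hT : IsTableau n (P ++ List.replicate (m + 1) (a, -a) ++ N)) (hm : 1 ≤ m)
    (ht : ¬ Touches P N a) :
    ConfigDrop n (P ++ List.replicate (m + 1) (a, -a) ++ N) (P ++ [(a, -a)] ++ N) := by
  refine ⟨a, m, P, N, (isColumn_of_split hT (by omega)).zero_range, hm, ?_⟩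
  refine Or.inr (Or.inr ⟨rfl, rfl, ?_, ?_⟩)
  · rintro ⟨p, q⟩ h rfl
    exact ht (Or.inl ⟨q, h⟩)
  · rintro ⟨p, q⟩ h h'
    dsimp only at h'
    subst h'
    exact ht (Or.inr ⟨p, h⟩)

theorem drop_eq {n s : ℕ} {T : Tab n s} {t : List (ℤ × ℤ)} (h : DropsTo n T.1 t)
    (h' : ∀ t', DropsTo n T.1 t' → t' = t) : drop T = t := by
  have h0 : ∃ t, DropsTo n T.1 t := ⟨t, h⟩
  rw [drop, dif_pos h0]
  exact h' _ h0.choose_spec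

theorem drop_of_isKN {n s : ℕ} {T : Tab n s} (h : IsKN n T.1) : drop T = T.1 := by
  refine drop_eq (Or.inl ⟨h, rfl⟩) ?_
  rintro t' (h' | h' | h')
  · exact h'.2
  · exact absurd h h'.1
  · exact absurd h h'.1

/-- Since 1 and 1̄ are the extreme letters, a column to the left of (1,1̄) has top entry 1 and a
column to the right has bottom entry 1̄. -/
theorem touches_one {n : ℕ} (hn : 4 ≤ n) {P N : List (ℤ × ℤ)} {m : ℕ}
    (hT : IsTableau n (P ++ List.replicate m ((1 : ℤ), -1) ++ N)) (hm : 1 ≤ m)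
    (h : ¬ (P = [] ∧ N = [])) : Touches P N 1 := by
  have hcol := (isTableau_iff.1 hT).1
  rcases List.eq_nil_or_concat P with rfl | ⟨P', ⟨p, q⟩, rfl⟩
  · cases N with
    | nil => simp at h
    | cons e N =>
      obtain ⟨p, q⟩ := e
      have h1 := (leCol_of_split_right hT hm (p, q) (by simp)).2
      have h2 := (hcol (p, q) (by simp)).1.2.bounds
      have e1 := height_cases n q
      have e2 := height_cases n (-1)
      unfold leLetter ltLetter at h1
      dsimp only at h1 h2
      obtain rfl : q = -1 := by omega
      exact Or.inr ⟨p, rfl⟩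
  · rw [List.concat_eq_append] at *
    have h1 := (leCol_of_split_left hT hm (p, q) (by simp)).1
    have h2 := (hcol (p, q) (by simp)).1.1.bounds
    have e1 := height_cases n p
    have e2 := height_cases n 1
    unfold leLetter ltLetter at h1
    dsimp only at h1 h2
    obtain rfl : p = 1 := by omega
    exact Or.inl ⟨q, by simp⟩

/-- This replaces the choice in the definition of `drop`: the facts about the drop map are read off
from these four cases. -/
theorem drop_split {n s : ℕ} (hn : 4 ≤ n) {T : Tab n s} {P N : List (ℤ × ℤ)} {m : ℕ} {a : ℤ}
    (hT : T.1 = P ++ List.replicate m (a, -a) ++ N)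
    (hP : ∀ c ∈ P, IsPos n c) (hN : ∀ c ∈ N, IsNeg n c) :
    (m = 0 ∧ drop T = P ++ N) ∨ (1 ≤ m ∧ P = [] ∧ N = [] ∧ a = 1 ∧ drop T = []) ∨
    (1 ≤ m ∧ Touches P N a ∧ drop T = P ++ N) ∨
    (1 ≤ m ∧ ¬ Touches P N a ∧ a ≠ 1 ∧ drop T = P ++ [(a, -a)] ++ N) := by
  have hTab : IsTableau n (P ++ List.replicate m (a, -a) ++ N) := hT ▸ T.2.2
  have hKN := isKN_split_iff hP hN hTab
  have hall : 1 ≤ m → ((∀ c ∈ P ++ List.replicate m (a, -a) ++ N, c = (1, -1)) ↔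
      P = [] ∧ N = [] ∧ a = 1) := by
    intro hm
    constructor
    · intro h
      refine ⟨List.eq_nil_iff_forall_not_mem.2 fun c hc => ?_,
        List.eq_nil_iff_forall_not_mem.2 fun c hc => ?_, ?_⟩
      · refine (hP c hc).ne_zero ?_
        rw [h c (by simp [hc])]
      · refine (hN c hc).ne_zero ?_
        rw [h c (by simp [hc])]
      · exact congrArg Prod.fst (h (a, -a) (List.mem_append_left _ (List.mem_append_right _
          (List.mem_replicate.2 ⟨by omega, rfl⟩))))
    · rintro ⟨rfl, rfl, rfl⟩ c hc
      simp only [List.nil_append, List.append_nil] at hc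
      exact List.eq_of_mem_replicate hc
  rcases Nat.eq_zero_or_pos m with rfl | hm
  · refine Or.inl ⟨rfl, ?_⟩
    rw [drop_of_isKN (hT ▸ hKN.2 (Or.inl rfl)), hT]
    simp
  · right
    by_cases hN1 : P = [] ∧ N = [] ∧ a = 1
    · left
      refine ⟨hm, hN1.1, hN1.2.1, hN1.2.2, ?_⟩
      have hnot : ¬ IsKN n T.1 := by
        rw [hT, hKN]
        rintro (h | h)
        · omega
        · exact h.2.2 hN1.2.2
      refine drop_eq (Or.inr (Or.inl ⟨hnot, hT ▸ (hall hm).2 hN1, rfl⟩)) ?_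
      rintro t' (h' | h' | h')
      · exact absurd h'.1 hnot
      · exact h'.2.2
      · exact absurd (hT ▸ (hall hm).2 hN1) h'.2.1
    · right
      have hnall : ¬ ∀ c ∈ T.1, c = (1, -1) := by rw [hT, hall hm]; exact hN1
      by_cases ht : Touches P N a
      · left
        have hnot : ¬ IsKN n T.1 := by
          rw [hT, hKN]
          rintro (h | h)
          · omega
          · exact h.2.1 ht
        refine ⟨hm, ht, drop_eq (Or.inr (Or.inr ⟨hnot, hnall,
          hT ▸ configDrop_of_split hP hN hTab hm ht⟩)) ?_⟩
        rintro t' (h' | h' | h')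
        · exact absurd h'.1 hnot
        · exact absurd h'.2.1 hnall
        · have h3 := h'.2.2
          rw [hT] at h3
          rcases configDrop_split hP hN hTab h3 with h4 | h4
          · exact h4.2
          · exact absurd ht h4.1
      · right
        have ha : a ≠ 1 := by
          rintro rfl
          exact ht (touches_one hn hTab hm (by simpa using hN1))
        refine ⟨hm, ht, ha, ?_⟩
        by_cases hm1 : m = 1
        · subst hm1
          rw [drop_of_isKN (hT ▸ hKN.2 (Or.inr ⟨rfl, ht, ha⟩)), hT]
          simp
        · obtain ⟨m, rfl⟩ : ∃ k, m = k + 1 := ⟨m - 1, by omega⟩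
          have hnot : ¬ IsKN n T.1 := by
            rw [hT, hKN]
            omega
          refine drop_eq (Or.inr (Or.inr ⟨hnot, hnall,
            hT ▸ configDrop_of_split' hTab (by omega) ht⟩)) ?_
          rintro t' (h' | h' | h')
          · exact absurd h'.1 hnot
          · exact absurd h'.2.1 hnall
          · have h3 := h'.2.2
            rw [hT] at h3
            rcases configDrop_split hP hN hTab h3 with h4 | h4
            · exact absurd h4.1 ht
            · exact h4.2

theorem isKN_drop {n s : ℕ} (hn : 4 ≤ n) (T : Tab n s) : IsKN n (drop T) := by
  obtain ⟨P, N, m, a, hT, hP, hN⟩ := exists_split T.2.2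
  have hTab : IsTableau n (P ++ List.replicate m (a, -a) ++ N) := hT ▸ T.2.2
  have h0 : IsKN n (P ++ N) := by
    have := (isKN_split_iff (m := 0) (a := a) hP hN (hTab.sublist (by simp))).2 (Or.inl rfl)
    simpa using this
  rcases drop_split hn hT hP hN with ⟨-, h⟩ | ⟨-, rfl, rfl, -, h⟩ | ⟨-, -, h⟩ | ⟨h1, h2, h3, h⟩
  · rwa [h]
  · rwa [h]
  · rwa [h]
  · rw [h, ← List.replicate_one]
    refine (isKN_split_iff hP hN (hTab.sublist ?_)).2 (Or.inr ⟨rfl, h2, h3⟩)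
    refine List.Sublist.append_right (List.Sublist.append_left ?_ _) _
    exact (List.replicate_sublist_replicate _).2 h1

theorem length_drop_le {n s : ℕ} (hn : 4 ≤ n) (T : Tab n s) : (drop T).length ≤ s := by
  obtain ⟨P, N, m, a, hT, hP, hN⟩ := exists_split T.2.2
  have h1 := T.2.1
  rw [hT] at h1
  simp only [List.length_append, List.length_replicate] at h1
  rcases drop_split hn hT hP hN with ⟨-, h⟩ | ⟨-, rfl, rfl, -, h⟩ | ⟨-, -, h⟩ | ⟨h1, h2, h3, h⟩ <;>
    rw [h] <;> simp only [List.length_append, List.length_nil, List.length_cons] <;> omega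

/-- The parts `P` and `N` survive, and the length s restores m. A surviving column (a,ā) shows a. If
a touching block was deleted, a can be read from the last column of `P` or the first of `N`; if two
tableaux use different sides, each letter bounds the other and antisymmetry gives equality. -/
theorem drop_injective {n s : ℕ} (hn : 4 ≤ n) : Function.Injective (drop (n := n) (s := s)) := by
  intro T T' h
  obtain ⟨P, N, m, a, hT, hP, hN⟩ := exists_split T.2.2
  obtain ⟨P', N', m', a', hT', hP', hN'⟩ := exists_split T'.2.2
  have hTab : IsTableau n (P ++ List.replicate m (a, -a) ++ N) := hT ▸ T.2.2
  have hTab' : IsTableau n (P' ++ List.replicate m' (a', -a') ++ N') := hT' ▸ T'.2.2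
  have key : ∀ {T : Tab n s} {P N : List (ℤ × ℤ)} {m : ℕ} {a : ℤ}
      (_ : T.1 = P ++ List.replicate m (a, -a) ++ N)
      (_ : ∀ c ∈ P, IsPos n c) (_ : ∀ c ∈ N, IsNeg n c),
      ∃ k, drop T = P ++ List.replicate k (a, -a) ++ N ∧
        ((k = 0 ∧ (m = 0 ∨ (P = [] ∧ N = [] ∧ a = 1) ∨ Touches P N a)) ∨ k = 1) := by
    intro T P N m a hT hP hN
    rcases drop_split hn hT hP hN with ⟨h0, h⟩ | ⟨-, rfl, rfl, h0, h⟩ | ⟨-, h0, h⟩ |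
      ⟨h1, h2, h3, h⟩
    · exact ⟨0, by simp [h], Or.inl ⟨rfl, Or.inl h0⟩⟩
    · exact ⟨0, by simp [h], Or.inl ⟨rfl, Or.inr (Or.inl ⟨rfl, rfl, h0⟩)⟩⟩
    · exact ⟨0, by simp [h], Or.inl ⟨rfl, Or.inr (Or.inr h0)⟩⟩
    · exact ⟨1, by simp [h], Or.inr rfl⟩
  obtain ⟨k, hk, hk'⟩ := key hT hP hN
  obtain ⟨k', hl, hl'⟩ := key hT' hP' hN'
  rw [hk, hl] at h
  obtain ⟨rfl, rfl, rfl, ha⟩ := split_unique hP hN hP' hN' h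
  have hm : m = m' := by
    have h1 := T.2.1
    have h2 := T'.2.1
    rw [hT] at h1
    rw [hT'] at h2
    simp only [List.length_append, List.length_replicate] at h1 h2
    omega
  subst hm
  apply Subtype.ext
  rw [hT, hT']
  rcases Nat.eq_zero_or_pos m with rfl | hm
  · simp
  suffices a = a' by rw [this]
  rcases hk' with ⟨rfl, hk'⟩ | rfl
  · have hlt := leCol_of_split_left hTab hm
    have hlt' := leCol_of_split_left hTab' hm
    have hgt := leCol_of_split_right hTab hm
    have hgt' := leCol_of_split_right hTab' hm
    have h1 := isColumn_of_split hTab hm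
    have h2 := isColumn_of_split hTab' hm
    have hcol := (isTableau_iff.1 hTab).1
    rcases hk' with h0 | ⟨h3, h4, h5⟩ | hk'
    · omega
    · rcases hl' with ⟨-, hl'⟩ | hl'
      · rcases hl' with h0 | h0 | h0
        · omega
        · rw [h5, h0.2.2]
        · simp [Touches, h3, h4] at h0
      · omega
    · rcases hl' with ⟨-, hl'⟩ | hl'
      · rcases hl' with h0 | h0 | hl'
        · omega
        · simp [Touches, h0.1, h0.2.1] at hk'
        · rcases hk' with ⟨p, hp⟩ | ⟨p, hp⟩ <;> rcases hl' with ⟨q, hq⟩ | ⟨q, hq⟩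
          · rw [hp] at hq
            simp only [Option.some.injEq, Prod.mk.injEq] at hq
            exact hq.1
          · have h3 := (hlt' _ (List.mem_of_getLast? hp)).1
            have h4 := leLetter.neg h1.1.2 h2.1.2 (hgt _ (List.mem_of_mem_head? hq)).2
            simp only [neg_neg] at h4
            exact h3.antisymm h4
          · have h3 := (hlt _ (List.mem_of_getLast? hq)).1
            have h4 := leLetter.neg h2.1.2 h1.1.2 (hgt' _ (List.mem_of_mem_head? hp)).2
            simp only [neg_neg] at h4
            exact h4.antisymm h3
          · rw [hp] at hq
            simp only [Option.some.injEq, Prod.mk.injEq, neg_inj] at hq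
            exact hq.2
      · omega
  · exact ha le_rfl

/-! ## The fill map -/

/-- Such tops are unbarred and below n, so they are compared as integers and the pair n, n̄ causes
no trouble in `exists_touching`. -/
theorem IsPos.fst_range {n : ℕ} {c : ℤ × ℤ} (hc : IsColumn n c) (h : IsPos n c) :
    1 ≤ c.1 ∧ c.1 < n := by
  obtain ⟨a, b⟩ := c
  have h1 := hc.1.1.bounds
  have h2 := hc.1.2.bounds
  have h3 := hc.2
  have e1 := height_cases n a
  have e2 := height_cases n b
  have e3 := height_cases n (-b)
  unfold leLetter ltLetter at h3
  unfold IsPos at h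
  dsimp only at *
  omega

theorem IsNeg.snd_range {n : ℕ} {c : ℤ × ℤ} (hc : IsColumn n c) (h : IsNeg n c) :
    -n < c.2 ∧ c.2 ≤ -1 := by
  obtain ⟨a, b⟩ := c
  have h1 := hc.1.1.bounds
  have h2 := hc.1.2.bounds
  have h3 := hc.2
  have e1 := height_cases n a
  have e2 := height_cases n b
  have e3 := height_cases n (-b)
  unfold leLetter ltLetter at h3
  unfold IsNeg at h
  dsimp only at *
  omega

theorem isColumn_zero {n : ℕ} {x : ℤ} (h1 : 1 ≤ x) (h2 : x < n) : IsColumn n (x, -x) := by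
  refine ⟨⟨isLetter_of_bounds (by omega), isLetter_of_bounds (by omega)⟩, ?_⟩
  have e1 := height_cases n x
  have e2 := height_cases n (-x)
  unfold leLetter ltLetter
  dsimp only
  omega

theorem leCol_zero_of_le {n : ℕ} {c : ℤ × ℤ} (hc : IsColumn n c) {x : ℤ}
    (hx : 1 ≤ x ∧ x < n) (hp : 1 ≤ c.1) (h1 : c.1 ≤ x) (h2 : height n x ≤ height n (-c.2)) :
    leCol n c (x, -x) := by
  obtain ⟨a, b⟩ := c
  have h3 := hc.1.2.bounds
  have e1 := height_cases n a
  have e2 := height_cases n b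
  have e3 := height_cases n (-b)
  have e4 := height_cases n x
  have e5 := height_cases n (-x)
  unfold leCol leLetter ltLetter
  dsimp only at *
  omega

theorem zero_leCol_of_le {n : ℕ} {c : ℤ × ℤ} (hc : IsColumn n c) {x : ℤ}
    (hx : 1 ≤ x ∧ x < n) (hp : c.2 ≤ -1) (h1 : -c.2 ≤ x) (h2 : height n x ≤ height n c.1) :
    leCol n (x, -x) c := by
  obtain ⟨a, b⟩ := c
  have h3 := hc.1.1.bounds
  have e1 := height_cases n a
  have e2 := height_cases n b
  have e4 := height_cases n x
  have e5 := height_cases n (-x)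
  unfold leCol leLetter ltLetter
  dsimp only at *
  omega

/-- The letter is the larger of the top of the last column of `P` and the barred bottom of the first
column of `N`, or the one available if the other part is empty. -/
theorem exists_touching {n : ℕ} {P N : List (ℤ × ℤ)}
    (hP : ∀ c ∈ P, IsPos n c) (hN : ∀ c ∈ N, IsNeg n c) (hT : IsTableau n (P ++ N))
    (h : ¬ (P = [] ∧ N = [])) : ∃ x, IsColumn n (x, -x) ∧ Touches P N x ∧
      (∀ c ∈ P, leCol n c (x, -x)) ∧ ∀ c ∈ N, leCol n (x, -x) c := by
  rw [isTableau_iff, List.pairwise_append] at hT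
  obtain ⟨h1, ⟨hPP, hNN, hPN⟩, -⟩ := hT
  have hPlast : ∀ {P' c}, P = P' ++ [c] → ∀ z, leCol n c z → ∀ e ∈ P, leCol n e z := by
    intro P' c hP' z hz e he
    rw [hP'] at hPP he
    rcases List.mem_append.1 he with he | he
    · exact ((List.pairwise_append.1 hPP).2.2 e he c (by simp)).trans hz
    · rwa [List.mem_singleton.1 he]
  have hNhead : ∀ {N' c}, N = c :: N' → ∀ z, leCol n z c → ∀ e ∈ N, leCol n z e := by
    intro N' c hN' z hz e he
    rw [hN'] at hNN he
    rcases List.mem_cons.1 he with rfl | he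
    · exact hz
    · exact hz.trans ((List.pairwise_cons.1 hNN).1 e he)
  rcases List.eq_nil_or_concat P with hP0 | ⟨P', c, hP0⟩
  · cases N with
    | nil => simp [hP0] at h
    | cons d N' =>
      have hd := h1 d (by simp)
      have hdr := (hN d (by simp)).snd_range hd
      have hx : 1 ≤ -d.2 ∧ -d.2 < n := by omega
      refine ⟨-d.2, isColumn_zero hx.1 hx.2, Or.inr ⟨d.1, by simp⟩, by simp [hP0], ?_⟩
      refine hNhead rfl _ (zero_leCol_of_le hd hx hdr.2 le_rfl ?_)
      exact (hN d (by simp)).le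
  · rw [List.concat_eq_append] at hP0
    have hcP : c ∈ P := by simp [hP0]
    have hc := h1 c (by simp [hcP])
    have hcr := (hP c hcP).fst_range hc
    have hcl : Touches P N c.1 := Or.inl ⟨c.2, by simp [hP0]⟩
    cases N with
    | nil =>
      refine ⟨c.1, isColumn_zero hcr.1 hcr.2, hcl, ?_, by simp⟩
      exact hPlast hP0 _ (leCol_zero_of_le hc hcr hcr.1 le_rfl (hP c hcP).le)
    | cons d N' =>
      have hd := h1 d (by simp)
      have hdr := (hN d (by simp)).snd_range hd
      have hcd := hPN c hcP d (by simp)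
      rcases le_total c.1 (-d.2) with hle | hle
      · have hx : 1 ≤ -d.2 ∧ -d.2 < n := by omega
        refine ⟨-d.2, isColumn_zero hx.1 hx.2, Or.inr ⟨d.1, by simp⟩, ?_, ?_⟩
        · refine hPlast hP0 _ (leCol_zero_of_le hc hx hcr.1 hle ?_)
          exact (leLetter.neg hc.1.2 hd.1.2 hcd.2).height_le
        · exact hNhead rfl _ (zero_leCol_of_le hd hx hdr.2 le_rfl (hN d (by simp)).le)
      · refine ⟨c.1, isColumn_zero hcr.1 hcr.2, hcl, ?_, ?_⟩
        · exact hPlast hP0 _ (leCol_zero_of_le hc hcr hcr.1 le_rfl (hP c hcP).le)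
        · exact hNhead rfl _ (zero_leCol_of_le hd hcr hdr.2 hle hcd.1.height_le)

/-- To fill up to s columns, repeat the column (a,ā) if there is one, otherwise insert a touching
block, and for the empty tableau take columns (1,1̄). -/
theorem exists_drop_eq {n s : ℕ} (hn : 4 ≤ n) {t : List (ℤ × ℤ)} (ht : IsKN n t)
    (hs : t.length ≤ s) : ∃ T : Tab n s, drop T = t := by
  rcases Nat.eq_or_lt_of_le hs with hs | hs
  · exact ⟨⟨t, hs, ht.toIsTableau⟩, drop_of_isKN ht⟩
  obtain ⟨P, N, m, a, rfl, hP, hN⟩ := exists_split ht.toIsTableau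
  have hins : ∀ k : ℕ, ∀ x : ℤ, k + P.length + N.length = s →
      IsTableau n (P ++ List.replicate k (x, -x) ++ N) →
      ∃ T : Tab n s, T.1 = P ++ List.replicate k (x, -x) ++ N := fun k x h1 h2 =>
    ⟨⟨_, by simp only [List.length_append, List.length_replicate]; omega, h2⟩, rfl⟩
  have hPN : IsTableau n (P ++ N) := ht.toIsTableau.sublist (by simp)
  simp only [List.length_append, List.length_replicate] at hs
  have hk : (s - P.length - N.length) + P.length + N.length = s := by omega
  rcases (isKN_split_iff hP hN ht.toIsTableau).1 ht with rfl | ⟨rfl, h1, h2⟩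
  · simp only [List.replicate_zero, List.append_nil]
    by_cases h0 : P = [] ∧ N = []
    · obtain ⟨rfl, rfl⟩ := h0
      obtain ⟨T, hT⟩ := hins s 1 (by simp) (hPN.insert hn s (isColumn_zero le_rfl (by omega))
        (by simp) (by simp))
      refine ⟨T, ?_⟩
      rcases drop_split hn hT hP hN with h | h | h | h
      · simpa using h.2
      · exact h.2.2.2.2
      · simpa using h.2.2
      · exact absurd rfl h.2.2.1
    · obtain ⟨x, hx, hx1, hx2, hx3⟩ := exists_touching hP hN hPN h0
      obtain ⟨T, hT⟩ := hins _ x hk (hPN.insert hn _ hx hx2 hx3)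
      refine ⟨T, ?_⟩
      rcases drop_split hn hT hP hN with h | h | h | h
      · exact h.2
      · exact absurd ⟨h.2.1, h.2.2.1⟩ h0
      · exact h.2.2
      · exact absurd hx1 h.2.1
  · have ha := isColumn_of_split ht.toIsTableau le_rfl
    obtain ⟨T, hT⟩ := hins _ a hk (hPN.insert hn _ ha (leCol_of_split_left ht.toIsTableau le_rfl)
      (leCol_of_split_right ht.toIsTableau le_rfl))
    refine ⟨T, ?_⟩
    rcases drop_split hn hT hP hN with h | h | h | h
    · omega
    · exact absurd h.2.2.2.1 h2
    · exact absurd h.2.1 h1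
    · simpa using h.2.2.2

theorem fill_eq_some {n s : ℕ} (hn : 4 ≤ n) {t : List (ℤ × ℤ)} {T : Tab n s} :
    fill t = some T ↔ drop T = t := by
  unfold fill
  constructor
  · intro h
    split_ifs at h with h0
    rw [← Option.some.inj h]
    exact h0.choose_spec
  · intro h
    have h0 : ∃ T : Tab n s, drop T = t := ⟨T, h⟩
    rw [dif_pos h0]
    exact congrArg some (drop_injective hn (h0.choose_spec.trans h.symm))

theorem drop_uZero {n s : ℕ} (hn : 4 ≤ n) : drop (uZero n s hn) = [] := by
  rcases drop_split (P := []) (N := []) (m := s) (a := 1) hn (T := uZero n s hn)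
    (by simp [uZero]) (by simp) (by simp) with h | h | h | h
  · simpa using h.2
  · exact h.2.2.2.2
  · simpa using h.2.2
  · exact absurd rfl h.2.2.1

/-! ## The classical operators on `𝒯(s)` -/

theorem clE_eq_some {n s i : ℕ} (hn : 4 ≤ n) {T T' : Tab n s} :
    clE i T = some T' ↔ knE n i (drop T) = some (drop T') := by
  unfold clE
  rw [Option.bind_eq_some_iff]
  constructor
  · rintro ⟨t, ht, h⟩
    rw [fill_eq_some hn] at h
    rw [ht, h]
  · exact fun h => ⟨_, h, (fill_eq_some hn).2 rfl⟩

theorem clF_eq_some {n s i : ℕ} (hn : 4 ≤ n) {T T' : Tab n s} :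
    clF i T = some T' ↔ knF n i (drop T) = some (drop T') := by
  unfold clF
  rw [Option.bind_eq_some_iff]
  constructor
  · rintro ⟨t, ht, h⟩
    rw [fill_eq_some hn] at h
    rw [ht, h]
  · exact fun h => ⟨_, h, (fill_eq_some hn).2 rfl⟩

/-- Both vertices are given, so their drops are already Kashiwara–Nakashima tableaux; no stability
under f_i enters. -/
theorem clF_eq_some_iff {n s i : ℕ} (hn : 4 ≤ n) (hi : 1 ≤ i) {T T' : Tab n s} :
    clF i T = some T' ↔ clE i T' = some T := by
  rw [clF_eq_some hn, clE_eq_some hn, knF_eq_some_iff hn hi]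

/-- Stability under e_i is used here: `fill` never turns a nonzero e_i into `none`. -/
theorem exists_clE {n s i : ℕ} (hn : 4 ≤ n) (hi : 1 ≤ i) {T : Tab n s} {t : List (ℤ × ℤ)}
    (h : knE n i (drop T) = some t) : ∃ T', clE i T = some T' ∧ drop T' = t := by
  obtain ⟨T', hT'⟩ := exists_drop_eq (s := s) hn ((isKN_drop hn T).knE hn hi h)
    ((length_knE h).trans_le (length_drop_le hn T))
  exact ⟨T', (clE_eq_some hn).2 (by rw [h, hT']), hT'⟩

theorem clE_eq_none {n s i : ℕ} (hn : 4 ≤ n) (hi : 1 ≤ i) {T : Tab n s} :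
    clE i T = none ↔ knE n i (drop T) = none := by
  constructor
  · intro h
    by_contra h0
    obtain ⟨t, ht⟩ := Option.ne_none_iff_exists'.1 h0
    obtain ⟨T', hT', -⟩ := exists_clE hn hi ht
    rw [h] at hT'
    simp at hT'
  · intro h
    simp [clE, h]

/-- The sum of the heights of the letters. -/
def totalHeight (n : ℕ) (w : List ℤ) : ℤ := (w.map (height n)).sum

theorem totalHeight_wordE {n i : ℕ} (hn : 4 ≤ n) (hi : 1 ≤ i) {w w' : List ℤ}
    (h : wordE n i w = some w') : totalHeight n w' = totalHeight n w - 1 := by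
  obtain ⟨u, v, x, y, rfl, rfl, hxy, -⟩ := exists_split_of_wordE hn hi h
  have := height_letterE hn hi hxy
  simp only [totalHeight, List.map_append, List.map_cons, List.sum_append, List.sum_cons]
  omega

theorem totalHeight_nonneg {n : ℕ} {w : List ℤ} (h : ∀ x ∈ w, IsLetter n x) :
    0 ≤ totalHeight n w := by
  refine List.sum_nonneg fun y hy => ?_
  obtain ⟨x, hx, rfl⟩ := List.mem_map.1 hy
  have := (h x hx).bounds
  have := height_cases n x
  omega

theorem IsTableau.isLetter_of_mem_colWord {n : ℕ} {t : List (ℤ × ℤ)} (h : IsTableau n t) {x : ℤ}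
    (hx : x ∈ colWord t) : IsLetter n x := by
  obtain ⟨c, hc, rfl | rfl⟩ := mem_colWord.1 hx
  exacts [(h.letters c hc).1, (h.letters c hc).2]

/-- The height of a vertex of `𝒯(s)`; each classical `e_i` lowers it by one. -/
noncomputable def ht {n s : ℕ} (T : Tab n s) : ℕ := (totalHeight n (colWord (drop T))).toNat

theorem ht_clE {n s i : ℕ} (hn : 4 ≤ n) (hi : 1 ≤ i) {T T' : Tab n s} (h : clE i T = some T') :
    ht T' + 1 = ht T := by
  have h1 := totalHeight_wordE hn hi (knE_eq_some.1 ((clE_eq_some hn).1 h))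
  have h2 := totalHeight_nonneg fun _ hx =>
    (isKN_drop hn T).toIsTableau.isLetter_of_mem_colWord hx
  have h3 := totalHeight_nonneg fun _ hx =>
    (isKN_drop hn T').toIsTableau.isLetter_of_mem_colWord hx
  unfold ht
  omega

/-! ## Weights -/

/-- The coefficient of `ε_j` in the weight of a word. -/
def wordWt (w : List ℤ) (j : ℕ) : ℤ := (w.count (j : ℤ) : ℤ) - (w.count (-(j : ℤ)) : ℤ)

theorem wordWt_append (u v : List ℤ) (j : ℕ) : wordWt (u ++ v) j = wordWt u j + wordWt v j := by
  simp only [wordWt, List.count_append]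
  push_cast
  ring

theorem wordWt_cons (x : ℤ) (v : List ℤ) (j : ℕ) :
    wordWt (x :: v) j = ((if x = j then 1 else 0) - if x = -j then 1 else 0) + wordWt v j := by
  simp only [wordWt, List.count_cons, beq_iff_eq]
  push_cast
  ring

theorem wordWt_nil (j : ℕ) : wordWt [] j = 0 := by simp [wordWt]

theorem wordWt_colWord_replicate (m : ℕ) (c : ℤ × ℤ) (j : ℕ) :
    wordWt (colWord (List.replicate m c)) j = m * wordWt [c.2, c.1] j := by
  induction m with
  | zero => simp [colWord, wordWt]
  | succ m ih =>
    have : colWord (List.replicate (m + 1) c) = [c.2, c.1] ++ colWord (List.replicate m c) := rfl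
    rw [this, wordWt_append, ih]
    push_cast
    ring

theorem wordWt_zero_column (a : ℤ) (j : ℕ) : wordWt [-a, a] j = 0 := by
  simp only [wordWt_cons, wordWt_nil]
  split_ifs <;> omega

/-- The deleted columns (a,ā) have weight zero. -/
theorem wt_eq_drop {n s : ℕ} (hn : 4 ≤ n) (T : Tab n s) (j : ℕ) :
    wt T j = wordWt (colWord (drop T)) j := by
  obtain ⟨P, N, m, a, hT, hP, hN⟩ := exists_split T.2.2
  have h0 : wt T j = wordWt (colWord P) j + wordWt (colWord N) j := by
    change wordWt (colWord T.1) j = _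
    rw [hT, colWord_append, colWord_append, wordWt_append, wordWt_append,
      wordWt_colWord_replicate, wordWt_zero_column]
    ring
  rw [h0]
  rcases drop_split hn hT hP hN with ⟨-, h⟩ | ⟨-, rfl, rfl, -, h⟩ | ⟨-, -, h⟩ | ⟨-, -, -, h⟩
  · rw [h, colWord_append, wordWt_append]
  · rw [h]; simp [colWord, wordWt]
  · rw [h, colWord_append, wordWt_append]
  · rw [h, ← List.replicate_one, colWord_append, colWord_append, wordWt_append, wordWt_append,
      wordWt_colWord_replicate, wordWt_zero_column]
    ring

/-- The number of columns cancels, so replacing the rank R by 2s - R negates the coefficient of ε₁.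
-/
theorem rank_eq {n s : ℕ} (T : Tab n s) : rank T = s - wt T 1 := by
  unfold rank
  ring

theorem wordWt_wordE {n i : ℕ} (hn : 4 ≤ n) (hi : 1 ≤ i) {w w' : List ℤ}
    (h : wordE n i w = some w') : wordWt w' 1 = wordWt w 1 + if i = 1 then 1 else 0 := by
  obtain ⟨u, v, x, y, rfl, rfl, hxy, -⟩ := exists_split_of_wordE hn hi h
  simp only [wordWt_append, wordWt_cons]
  rw [letterE_eq_some] at hxy
  split_ifs <;> omega

theorem wt_clE {n s i : ℕ} (hn : 4 ≤ n) (hi : 1 ≤ i) {T T' : Tab n s} (h : clE i T = some T') :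
    wt T' 1 = wt T 1 + if i = 1 then 1 else 0 := by
  rw [wt_eq_drop hn, wt_eq_drop hn]
  exact wordWt_wordE hn hi (knE_eq_some.1 ((clE_eq_some hn).1 h))

/-- No column contains 1 twice or 1̄ twice. -/
theorem abs_wt_le_comp {n s : ℕ} (hn : 4 ≤ n) (T : Tab n s) :
    -(comp T : ℤ) ≤ wt T 1 ∧ wt T 1 ≤ comp T := by
  rw [wt_eq_drop hn, comp]
  have h := (isTableau_iff.1 (isKN_drop hn T).toIsTableau).1
  generalize drop T = t at h ⊢
  induction t with
  | nil => simp [colWord, wordWt]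
  | cons c t ih =>
    have h1 := ih fun d hd => h d (by simp [hd])
    have hc := h c (by simp)
    obtain ⟨a, b⟩ := c
    have h2 := hc.1.1.bounds
    have h3 := hc.1.2.bounds
    have h4 := hc.2
    have e1 := height_cases n a
    have e2 := height_cases n b
    unfold leLetter ltLetter at h4
    dsimp only at *
    simp only [colWord, wordWt_cons, List.length_cons]
    push_cast
    split_ifs <;> omega

/-! ## Highest weight vectors -/

/-- A letter x > k is changed by e_{x-1}, and a letter x̄ with x ≥ k by e_x. -/
theorem IsLetter.range_of_eps {n k : ℕ} (hk : 1 ≤ k) {x : ℤ} (hx : IsLetter n x)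
    (h : ∀ i, k ≤ i → i ≤ n → letterEps n i x = 0) : x ≤ k ∧ -k < x := by
  have h1 := hx.bounds
  constructor
  · by_contra h2
    have := h (x - 1).toNat (by omega) (by omega)
    rw [letterEps_eq_zero] at this
    omega
  · by_contra h2
    have := h (-x).toNat (by omega) (by omega)
    rw [letterEps_eq_zero] at this
    omega

/-- The last column has nothing to its right that cancels: its top must be 1, and then its bottom is
2. Any earlier column is at most (1,2) in the row order, hence equal to it. -/
theorem eq_replicate_of_highest {n : ℕ} (hn : 4 ≤ n) {t : List (ℤ × ℤ)} (ht : IsKN n t)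
    (h : ∀ i, 1 ≤ i → i ≤ n → knE n i t = none) : t = List.replicate t.length (1, 2) := by
  obtain ⟨h1, h2, -, -, h3⟩ := isKN_iff.1 ht
  clear ht
  simp only [knE_eq_none] at h
  induction t with
  | nil => rfl
  | cons c t ih =>
    obtain ⟨a, b⟩ := c
    rw [List.pairwise_cons] at h2
    have hc := h1 (a, b) (by simp)
    have hb : ∀ i, 1 ≤ i → i ≤ n → letterEps n i b ≤ wordPhi n i (a :: colWord t) :=
      fun i h4 h5 => (wordE_cons_eq_none (h i h4 h5)).1
    have ha : ∀ i, 1 ≤ i → i ≤ n → letterEps n i a ≤ wordPhi n i (colWord t) :=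
      fun i h4 h5 => (wordE_cons_eq_none (wordE_cons_eq_none (h i h4 h5)).2).1
    have ht := ih (fun d hd => h1 d (by simp [hd])) h2.2 (fun hd => h3 (by simp [hd]))
      (fun i h4 h5 => wordE_eq_none_of_suffix [b, a] (h i h4 h5))
    have hba := hc.2
    have l1 := hc.1.1.bounds
    have l2 := hc.1.2.bounds
    have e1 := height_cases n a
    have e2 := height_cases n b
    have e3 := height_cases n 1
    have e4 := height_cases n 2
    unfold leLetter ltLetter at hba
    dsimp only at *
    suffices hab : a = 1 ∧ b = 2 by
      rw [List.length_cons, List.replicate_succ, ← ht, hab.1, hab.2]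
    cases t with
    | nil =>
      have ha1 := hc.1.1.range_of_eps le_rfl fun i h4 h5 => by simpa [colWord, wordPhi] using ha i h4 h5
      obtain rfl : a = 1 := by omega
      refine ⟨rfl, ?_⟩
      have hb1 := hc.1.2.range_of_eps (k := 2) (by omega) fun i h4 h5 => by
        have := hb i (by omega) h5
        rw [wordPhi, letterPhi_eq_zero.2 (by omega)] at this
        simpa [colWord, wordPhi] using this
      have : b ≠ -1 := fun hb => h3 (by simp [hb])
      dsimp only at hb1
      omega
    | cons d t =>
      have hd : d = (1, 2) := by
        rw [List.length_cons, List.replicate_succ] at ht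
        exact (List.cons.inj ht).1
      have hcd := h2.1 d (by simp)
      rw [hd] at hcd
      unfold leCol leLetter ltLetter at hcd
      dsimp only at hcd
      omega

/-- The tableau with `p` columns `(1, 2)`, `a` columns `(1, 2̄)`, `c` columns `(2, 2̄)` and
`d` columns `(2, 1̄)`. -/
def fourBlock (p a c d : ℕ) : List (ℤ × ℤ) :=
  List.replicate p (1, 2) ++ List.replicate a (1, -2) ++ List.replicate c (2, -2) ++
    List.replicate d (2, -1)

theorem mem_fourBlock {p a c d : ℕ} {x : ℤ × ℤ} : x ∈ fourBlock p a c d ↔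
    (p ≠ 0 ∧ x = (1, 2)) ∨ (a ≠ 0 ∧ x = (1, -2)) ∨ (c ≠ 0 ∧ x = (2, -2)) ∨
      (d ≠ 0 ∧ x = (2, -1)) := by
  simp only [fourBlock, List.mem_append, List.mem_replicate, or_assoc]

theorem length_fourBlock (p a c d : ℕ) : (fourBlock p a c d).length = p + a + c + d := by
  simp [fourBlock]
  omega

/-- Row order fixes the sequence of the blocks. Two adjacent columns (2,2̄) are a configuration,
whence `c ≤ 1`. -/
theorem eq_fourBlock {n : ℕ} (hn : 4 ≤ n) {t : List (ℤ × ℤ)} (ht : IsKN n t)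
    (h : ∀ x ∈ t, (x.1 = 1 ∨ x.1 = 2) ∧ (x.2 = 2 ∨ x.2 = -2 ∨ x.2 = -1)) :
    ∃ p a c d, c ≤ 1 ∧ t = fourBlock p a c d := by
  obtain ⟨h1, h2, -, h4, h3⟩ := isKN_iff.1 ht
  clear ht
  induction t with
  | nil => exact ⟨0, 0, 0, 0, by simp, rfl⟩
  | cons x t ih =>
    rw [List.pairwise_cons] at h2
    rw [List.isChain_cons] at h4
    obtain ⟨p, a, c, d, hc, rfl⟩ := ih (fun d hd => h d (by simp [hd]))
      (fun d hd => h1 d (by simp [hd])) h2.2 h4.2 (fun hd => h3 (by simp [hd]))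
    have hle := h2.1
    have hx := h x (by simp)
    have hx1 : x ≠ (1, -1) := fun h => h3 (by simp [h])
    have hx2 := (h1 x (by simp)).2
    obtain ⟨u, v⟩ := x
    simp only [mem_fourBlock] at hle
    have e1 := height_cases n 1
    have e2 := height_cases n 2
    have e3 := height_cases n (-1)
    have e4 := height_cases n (-2)
    dsimp only at hx hx2
    have hp : ¬ leCol n (u, v) (1, 2) → p = 0 := fun hn => by
      by_contra hp; exact hn (hle _ (Or.inl ⟨hp, rfl⟩))
    have ha : ¬ leCol n (u, v) (1, -2) → a = 0 := fun hn => by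
      by_contra hp; exact hn (hle _ (Or.inr (Or.inl ⟨hp, rfl⟩)))
    have hcc : ¬ leCol n (u, v) (2, -2) → c = 0 := fun hn => by
      by_contra hp; exact hn (hle _ (Or.inr (Or.inr (Or.inl ⟨hp, rfl⟩))))
    unfold leCol leLetter ltLetter at hp ha hcc
    unfold leLetter ltLetter at hx2
    dsimp only at hp ha hcc
    rcases hx with ⟨rfl | rfl, rfl | rfl | rfl⟩
    · exact ⟨p + 1, a, c, d, hc, by simp [fourBlock, List.replicate_succ]⟩
    · obtain rfl := hp (by omega)
      exact ⟨0, a + 1, c, d, hc, by simp [fourBlock, List.replicate_succ]⟩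
    · exact absurd rfl hx1
    · omega
    · obtain rfl := hp (by omega)
      obtain rfl := ha (by omega)
      have : c = 0 := by
        by_contra hc0
        obtain rfl : c = 1 := by omega
        exact (h4.1 (2, -2) (by simp [fourBlock])).1 ⟨rfl, rfl⟩
      subst this
      exact ⟨0, 0, 1, d, le_rfl, by simp [fourBlock]⟩
    · obtain rfl := hp (by omega)
      obtain rfl := ha (by omega)
      obtain rfl := hcc (by omega)
      exact ⟨0, 0, 0, d + 1, by omega, by simp [fourBlock, List.replicate_succ]⟩

theorem entries_of_branch_highest {n : ℕ} (hn : 4 ≤ n) {t : List (ℤ × ℤ)} (ht : IsTableau n t)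
    (h : ∀ i, 2 ≤ i → i ≤ n → knE n i t = none) :
    ∀ x ∈ t, (x.1 = 1 ∨ x.1 = 2) ∧ (x.2 = 2 ∨ x.2 = 3 ∨ x.2 = -2 ∨ x.2 = -1) := by
  obtain ⟨h1, h2, -⟩ := isTableau_iff.1 ht
  clear ht
  simp only [knE_eq_none] at h
  induction t with
  | nil => simp
  | cons c t ih =>
    obtain ⟨a, b⟩ := c
    rw [List.pairwise_cons] at h2
    have hc := h1 (a, b) (by simp)
    have hb : ∀ i, 2 ≤ i → i ≤ n → letterEps n i b ≤ wordPhi n i (a :: colWord t) :=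
      fun i h4 h5 => (wordE_cons_eq_none (h i h4 h5)).1
    have ha : ∀ i, 2 ≤ i → i ≤ n → letterEps n i a ≤ wordPhi n i (colWord t) :=
      fun i h4 h5 => (wordE_cons_eq_none (wordE_cons_eq_none (h i h4 h5)).2).1
    have ht := ih (fun d hd => h1 d (by simp [hd])) h2.2
      (fun i h4 h5 => wordE_eq_none_of_suffix [b, a] (h i h4 h5))
    have hba := hc.2
    have l1 := hc.1.1.bounds
    have l2 := hc.1.2.bounds
    have e1 := height_cases n a
    have e2 := height_cases n b
    have e3 := height_cases n 1
    have e4 := height_cases n 2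
    have e5 := height_cases n 3
    have ha' : a = 1 ∨ a = 2 := by
      cases t with
      | nil =>
        have ha1 := hc.1.1.range_of_eps (k := 2) (by omega) fun i h4 h5 => by
          simpa [colWord, wordPhi] using ha i h4 h5
        unfold leLetter ltLetter at hba
        dsimp only at *
        omega
      | cons d t =>
        have hcd := (h2.1 d (by simp)).1
        have hd := (ht d (by simp)).1
        unfold leLetter ltLetter at hcd
        dsimp only at *
        rcases hd with hd | hd <;> rw [hd] at hcd <;> omega
    have hb' : b = 2 ∨ b = 3 ∨ b = -2 ∨ b = -1 := by
      -- A bottom entry 3 farther right bounds `b` by row order; without one, no letter after `b`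
      -- has φ_i ≠ 0 for i ≥ 3.
      by_cases h3 : ∃ d ∈ t, d.2 = 3
      · obtain ⟨d, hd, hd3⟩ := h3
        have hcd := (h2.1 d hd).2
        unfold leLetter ltLetter at hcd hba
        rw [hd3] at hcd
        dsimp only at *
        omega
      · have hb1 := hc.1.2.range_of_eps (k := 3) (by omega) fun i h4 h5 => by
          have h6 := hb i (by omega) h5
          rw [wordPhi_eq_zero_of_phi] at h6
          · dsimp only
            omega
          · intro x hx
            have hx' : x = 1 ∨ x = 2 ∨ x = -2 ∨ x = -1 := by
              rcases List.mem_cons.1 hx with rfl | hx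
              · omega
              · obtain ⟨d, hd, hxd⟩ := mem_colWord.1 hx
                have h7 := ht d hd
                have h8 : d.2 ≠ 3 := fun h => h3 ⟨d, hd, h⟩
                omega
            rw [letterPhi_eq_zero]
            omega
        unfold leLetter ltLetter at hba
        dsimp only at *
        omega
    intro x hx
    rcases List.mem_cons.1 hx with rfl | hx
    · exact ⟨ha', hb'⟩
    · exact ht x hx

theorem eq_fourBlock_of_branch_highest {n : ℕ} (hn : 4 ≤ n) {t : List (ℤ × ℤ)} (ht : IsKN n t)
    (h : ∀ i, 2 ≤ i → i ≤ n → knE n i t = none) (hw : wordWt (colWord t) 3 = 0) :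
    ∃ p a c d, c ≤ 1 ∧ t = fourBlock p a c d := by
  have h1 := entries_of_branch_highest hn ht.toIsTableau h
  refine eq_fourBlock hn ht fun x hx => ?_
  have h2 := h1 x hx
  suffices x.2 ≠ 3 by omega
  intro h3
  have h4 : (3 : ℤ) ∈ colWord t := mem_colWord.2 ⟨x, hx, Or.inr h3.symm⟩
  have h5 : (-3 : ℤ) ∉ colWord t := by
    intro h5
    obtain ⟨d, hd, h6⟩ := mem_colWord.1 h5
    have := h1 d hd
    omega
  have h6 := List.count_pos_iff.2 h4
  have h7 := List.count_eq_zero.2 h5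
  simp only [wordWt, Nat.cast_ofNat] at hw
  omega

theorem wordWt_fourBlock (p a c d : ℕ) :
    wordWt (colWord (fourBlock p a c d)) 1 = p + a - d ∧
    wordWt (colWord (fourBlock p a c d)) 2 = p - a + d ∧
    ∀ j, 3 ≤ j → wordWt (colWord (fourBlock p a c d)) j = 0 := by
  refine ⟨?_, ?_, fun j hj => ?_⟩
  · simp only [fourBlock, colWord_append, wordWt_append, wordWt_colWord_replicate, wordWt_cons,
      wordWt_nil]
    norm_num
    ring
  · simp only [fourBlock, colWord_append, wordWt_append, wordWt_colWord_replicate, wordWt_cons,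
      wordWt_nil]
    norm_num
    ring
  · simp only [fourBlock, colWord_append, wordWt_append, wordWt_colWord_replicate, wordWt_cons,
      wordWt_nil]
    have h1 : ¬ (1 : ℤ) = j := by omega
    have h2 : ¬ (2 : ℤ) = j := by omega
    have h3 : ¬ (1 : ℤ) = -j := by omega
    have h4 : ¬ (2 : ℤ) = -j := by omega
    have h5 : ¬ (-1 : ℤ) = j := by omega
    have h6 : ¬ (-2 : ℤ) = j := by omega
    have h7 : ¬ (-1 : ℤ) = -j := by omega
    have h8 : ¬ (-2 : ℤ) = -j := by omega
    simp only [h1, h2, h3, h4, h5, h6, h7, h8, if_false]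
    ring

theorem compatible_of_fst_le {n : ℕ} (hn : 4 ≤ n) {c : ℤ × ℤ} (h : c.1 ≤ 2) (d : ℤ × ℤ) :
    Compatible n c d := by
  obtain ⟨p, q⟩ := c
  simp only [Compatible, Prod.mk.injEq]
  dsimp only at h
  omega

theorem isKN_fourBlock {n : ℕ} (hn : 4 ≤ n) (p a c d : ℕ) (hc : c ≤ 1) :
    IsKN n (fourBlock p a c d) := by
  have e1 := height_cases n 1
  have e2 := height_cases n 2
  have e3 := height_cases n (-1)
  have e4 := height_cases n (-2)
  have hmem : ∀ x ∈ fourBlock p a c d, x = (1, 2) ∨ x = (1, -2) ∨ x = (2, -2) ∨ x = (2, -1) := by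
    intro x hx
    rw [mem_fourBlock] at hx
    tauto
  have hle : ∀ x y : ℤ × ℤ, leCol n x y ↔ (x.1 = y.1 ∨ height n x.1 < height n y.1) ∧
    (x.2 = y.2 ∨ height n x.2 < height n y.2) := fun x y => Iff.rfl
  have hT : IsTableau n (fourBlock p a c d) := by
    rw [isTableau_iff]
    refine ⟨fun x hx => ?_, ?_, List.Pairwise.imp_of_mem (R := fun _ _ => True) ?_ ?_⟩
    · rcases hmem x hx with rfl | rfl | rfl | rfl <;>
      · refine ⟨⟨isLetter_of_bounds ?_, isLetter_of_bounds ?_⟩, ?_⟩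
        · dsimp only; omega
        · dsimp only; omega
        · unfold leLetter ltLetter; dsimp only; omega
    · simp only [fourBlock, List.pairwise_append, List.pairwise_replicate, List.mem_append,
        List.mem_replicate, hle]
      refine ⟨⟨⟨by simp, by simp, ?_⟩, by simp, ?_⟩, by simp, ?_⟩
      · rintro x ⟨-, rfl⟩ y ⟨-, rfl⟩
        dsimp only; omega
      · rintro x (⟨-, rfl⟩ | ⟨-, rfl⟩) y ⟨-, rfl⟩ <;> dsimp only <;> omega
      · rintro x ((⟨-, rfl⟩ | ⟨-, rfl⟩) | ⟨-, rfl⟩) y ⟨-, rfl⟩ <;> dsimp only <;> omega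
    · intro x y hx hy _
      refine compatible_of_fst_le hn ?_ y
      rcases hmem x hx with rfl | rfl | rfl | rfl <;> norm_num
    · exact List.pairwise_of_forall fun _ _ => trivial
  refine (isKN_split_iff (P := List.replicate p (1, 2) ++ List.replicate a (1, -2))
    (N := List.replicate d (2, -1)) (m := c) (a := 2) ?_ ?_ hT).2 ?_
  · intro x hx
    simp only [List.mem_append, List.mem_replicate] at hx
    unfold IsPos
    rcases hx with ⟨-, rfl⟩ | ⟨-, rfl⟩ <;> dsimp only <;> norm_num <;> omega
  · intro x hx
    rw [List.eq_of_mem_replicate hx]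
    unfold IsNeg
    norm_num
    omega
  · rcases Nat.eq_zero_or_pos c with h | h
    · exact Or.inl h
    · refine Or.inr ⟨by omega, ?_, by norm_num⟩
      rintro (⟨b, hb⟩ | ⟨b, hb⟩)
      · have := List.mem_of_getLast? hb
        simp [List.mem_replicate] at this
      · have := List.mem_of_mem_head? hb
        simp [List.mem_replicate] at this

/-! ### The operators on the tableaux `fourBlock` -/

/-- Each 2̄ in a column (1,2̄) must be cancelled by the 2 of a column (2,1̄), hence `a ≤ d`; a
column (2,2̄) cancels within itself. -/
theorem wordPhi_two_fourBlock {n : ℕ} (hn : 4 ≤ n) (p a c d : ℕ) (h : a ≤ d) :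
    wordE n 2 (colWord (fourBlock p a c d)) = none ∧
      wordPhi n 2 (colWord (fourBlock p a c d)) = p + (d - a) := by
  have f1 : letterPhi n 2 1 = 0 := letterPhi_eq_zero.2 (by omega)
  have f2 : letterPhi n 2 2 = 1 := letterPhi_eq_one.2 (by omega)
  have f3 : letterPhi n 2 (-1) = 0 := letterPhi_eq_zero.2 (by omega)
  have f4 : letterPhi n 2 (-2) = 0 := letterPhi_eq_zero.2 (by omega)
  have g1 : letterEps n 2 1 = 0 := letterEps_eq_zero.2 (by omega)
  have g2 : letterEps n 2 2 = 0 := letterEps_eq_zero.2 (by omega)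
  have g3 : letterEps n 2 (-1) = 0 := letterEps_eq_zero.2 (by omega)
  have g4 : letterEps n 2 (-2) = 1 := letterEps_eq_one.2 (by omega)
  induction p with
  | succ p ih =>
    have : colWord (fourBlock (p + 1) a c d) = 2 :: 1 :: colWord (fourBlock p a c d) := rfl
    rw [this]
    simp only [wordE, wordPhi, ih.1, ih.2, f1, f2, g1, g2, Nat.not_lt_zero, if_false,
      Option.map_none, true_and]
    omega
  | zero =>
    induction a with
    | succ a ih =>
      have : colWord (fourBlock 0 (a + 1) c d) = -2 :: 1 :: colWord (fourBlock 0 a c d) := rfl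
      rw [this]
      have ih := ih (by omega)
      simp only [wordE, wordPhi, ih.1, ih.2, f1, f4, g1, g4, Nat.not_lt_zero, if_false,
        Option.map_none]
      rw [if_neg (by omega)]
      exact ⟨rfl, by omega⟩
    | zero =>
      clear h
      induction c with
      | succ c ih =>
        have : colWord (fourBlock 0 0 (c + 1) d) = -2 :: 2 :: colWord (fourBlock 0 0 c d) := rfl
        rw [this]
        simp only [wordE, wordPhi, ih.1, ih.2, f2, f4, g2, g4, Nat.not_lt_zero, if_false,
          Option.map_none]
        rw [if_neg (by omega)]
        exact ⟨rfl, by omega⟩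
      | zero =>
        induction d with
        | succ d ih =>
          have : colWord (fourBlock 0 0 0 (d + 1)) = -1 :: 2 :: colWord (fourBlock 0 0 0 d) := rfl
          rw [this]
          simp only [wordE, wordPhi, ih.1, ih.2, f2, f3, g2, g3, Nat.not_lt_zero, if_false,
            Option.map_none, true_and]
          omega
        | zero => exact ⟨rfl, rfl⟩

theorem mem_colWord_fourBlock {p a c d : ℕ} {x : ℤ} (h : x ∈ colWord (fourBlock p a c d)) :
    x = 1 ∨ x = 2 ∨ x = -1 ∨ x = -2 := by
  obtain ⟨y, hy, h⟩ := mem_colWord.1 h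
  rw [mem_fourBlock] at hy
  rcases hy with ⟨-, rfl⟩ | ⟨-, rfl⟩ | ⟨-, rfl⟩ | ⟨-, rfl⟩ <;> dsimp only at h <;> omega

theorem wordPhi_fourBlock {n i : ℕ} (hn : 4 ≤ n) (hi : 3 ≤ i) (p a c d : ℕ) :
    wordE n i (colWord (fourBlock p a c d)) = none ∧
      wordPhi n i (colWord (fourBlock p a c d)) = 0 := by
  constructor
  · refine wordE_eq_none_of_eps fun x hx => letterEps_eq_zero.2 ?_
    have := mem_colWord_fourBlock hx
    omega
  · refine wordPhi_eq_zero_of_phi fun x hx => letterPhi_eq_zero.2 ?_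
    have := mem_colWord_fourBlock hx
    omega

theorem knE_fourBlock {n i : ℕ} (hn : 4 ≤ n) (hi : 2 ≤ i) {p a c d : ℕ} (h : a ≤ d) :
    knE n i (fourBlock p a c d) = none := by
  rw [knE_eq_none]
  rcases Nat.eq_or_lt_of_le hi with rfl | hi
  · exact (wordPhi_two_fourBlock hn p a c d h).1
  · exact (wordPhi_fourBlock hn hi p a c d).1

theorem isBranchHW_of_drop_eq {n s : ℕ} (hn : 4 ≤ n) {T : Tab n s} {p a c d : ℕ}
    (hT : drop T = fourBlock p a c d) (h : a ≤ d) : IsBranchHW T := by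
  intro i hi _
  rw [clE_eq_none hn (by omega), hT]
  exact knE_fourBlock hn hi h

/-- `e₁` increases the number of columns `(1, 2̄)`. -/
theorem knE_one_fourBlock {n : ℕ} (hn : 4 ≤ n) (a d : ℕ) :
    knE n 1 (fourBlock 0 a 1 d) = some (fourBlock 0 (a + 1) 0 d) ∧
    knE n 1 (fourBlock 0 a 0 (d + 1)) = some (fourBlock 0 a 1 d) := by
  have f1 : letterPhi n 1 2 = 0 := letterPhi_eq_zero.2 (by omega)
  have f2 : letterPhi n 1 (-1) = 0 := letterPhi_eq_zero.2 (by omega)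
  have g1 : letterEps n 1 2 = 1 := letterEps_eq_one.2 (by omega)
  have g2 : letterEps n 1 (-1) = 1 := letterEps_eq_one.2 (by omega)
  have g3 : letterEps n 1 1 = 0 := letterEps_eq_zero.2 (by omega)
  have g4 : letterEps n 1 (-2) = 0 := letterEps_eq_zero.2 (by omega)
  have hd : ∀ d, wordPhi n 1 (colWord (fourBlock 0 0 0 d)) = 0 := fun d => by
    refine wordPhi_eq_zero_of_phi fun x hx => ?_
    obtain ⟨y, hy, h⟩ := mem_colWord.1 hx
    rw [mem_fourBlock] at hy
    obtain rfl : y = (2, -1) := by tauto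
    rcases h with rfl | rfl
    exacts [f1, f2]
  -- The letters 2̄ and 1 have ε₁ = 0, so e₁ passes over the columns (1,2̄).
  have hstep : ∀ a c d t, knE n 1 (fourBlock 0 a c d) = some t →
      knE n 1 (fourBlock 0 (a + 1) c d) = some ((1, -2) :: t) := by
    intro a c d t h
    rw [knE_eq_some] at h ⊢
    have : colWord (fourBlock 0 (a + 1) c d) = -2 :: 1 :: colWord (fourBlock 0 a c d) := rfl
    rw [this, wordE_cons_of_eps_eq_zero _ g4, wordE_cons_of_eps_eq_zero _ g3, h]
    rfl
  induction a with
  | succ a ih => exact ⟨hstep _ _ _ _ ih.1, hstep _ _ _ _ ih.2⟩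
  | zero =>
    constructor
    · rw [knE_eq_some]
      have : colWord (fourBlock 0 0 1 d) = -2 :: 2 :: colWord (fourBlock 0 0 0 d) := rfl
      have h2 : letterE n 1 2 = some 1 := letterE_eq_some.2 (by omega)
      rw [this, wordE_cons_of_eps_eq_zero _ g4, wordE, hd, g1, if_pos (by omega), h2]
      rfl
    · rw [knE_eq_some]
      have : colWord (fourBlock 0 0 0 (d + 1)) = -1 :: 2 :: colWord (fourBlock 0 0 0 d) := rfl
      have h2 : letterE n 1 (-1) = some (-2) := letterE_eq_some.2 (by omega)
      rw [this, wordE, wordPhi, hd, f1, g2, if_pos (by omega), h2]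
      rfl

/-! ## Stripping the letters `1` and `1̄` -/

theorem letterPhi_one {n i : ℕ} (hn : 4 ≤ n) (hi : 2 ≤ i) : letterPhi n i 1 = 0 :=
  letterPhi_eq_zero.2 (by omega)

theorem letterEps_one {n i : ℕ} (hn : 4 ≤ n) (hi : 2 ≤ i) : letterEps n i 1 = 0 :=
  letterEps_eq_zero.2 (by omega)

theorem letterPhi_neg_one {n i : ℕ} (hn : 4 ≤ n) (hi : 2 ≤ i) : letterPhi n i (-1) = 0 :=
  letterPhi_eq_zero.2 (by omega)

theorem letterEps_neg_one {n i : ℕ} (hn : 4 ≤ n) (hi : 2 ≤ i) : letterEps n i (-1) = 0 :=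
  letterEps_eq_zero.2 (by omega)

/-- An embedding of words into tableaux that commutes with `e_i` and `f_i` for `2 ≤ i ≤ n`. -/
structure StripEmb (n : ℕ) (A : List ℤ → List (ℤ × ℤ)) : Prop where
  knE : ∀ i x, 2 ≤ i → i ≤ n → knE n i (A x) = (wordE n i x).map A
  knF : ∀ i x, 2 ≤ i → i ≤ n → knF n i (A x) = (wordF n i x).map A
  sorted : ∀ x, IsKN n (A x) →
    x.Pairwise (leLetter n) ∧ ∀ y ∈ x, IsLetter n y ∧ y ≠ 1 ∧ y ≠ -1

theorem StripEmb.of_colWord {n : ℕ} {A : List ℤ → List (ℤ × ℤ)}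
    (h1 : ∀ i x, 2 ≤ i → i ≤ n →
      wordE n i (colWord (A x)) = (wordE n i x).map (colWord ∘ A) ∧
      wordF n i (colWord (A x)) = (wordF n i x).map (colWord ∘ A))
    (h2 : ∀ x, IsKN n (A x) →
      x.Pairwise (leLetter n) ∧ ∀ y ∈ x, IsLetter n y ∧ y ≠ 1 ∧ y ≠ -1) : StripEmb n A := by
  have hc : ofColWord ∘ (colWord ∘ A) = A := funext fun x => ofColWord_colWord _
  refine ⟨fun i x hi hin => ?_, fun i x hi hin => ?_, h2⟩
  · rw [TypeD.knE, (h1 i x hi hin).1, Option.map_map, hc]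
  · rw [TypeD.knF, (h1 i x hi hin).2, Option.map_map, hc]

/-- The letters 1 are neutral for the colours 2, …, n, and the tail `τ` is invisible to them by
`hτ`; only the bottom row `x` is acted on. -/
theorem stripEmb_top {n : ℕ} (hn : 4 ≤ n) {τ : List (ℤ × ℤ)}
    (hτ : ∀ i, 2 ≤ i → i ≤ n → wordE n i (colWord τ) = none ∧ wordPhi n i (colWord τ) = 0) :
    StripEmb n (fun x => x.map (fun y => (1, y)) ++ τ) := by
  refine StripEmb.of_colWord ?_ ?_
  · intro i x hi hin
    have f1 := letterPhi_one hn hi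
    have g1 := letterEps_one hn hi
    suffices wordE n i (colWord (x.map (fun y => ((1 : ℤ), y)) ++ τ)) =
          (wordE n i x).map (fun x => colWord (x.map (fun y => ((1 : ℤ), y)) ++ τ)) ∧
        wordF n i (colWord (x.map (fun y => ((1 : ℤ), y)) ++ τ)) =
          (wordF n i x).map (fun x => colWord (x.map (fun y => ((1 : ℤ), y)) ++ τ)) ∧
        wordPhi n i (colWord (x.map (fun y => ((1 : ℤ), y)) ++ τ)) = wordPhi n i x from
      ⟨this.1, this.2.1⟩
    induction x with
    | nil =>
      refine ⟨?_, ?_, (hτ i hi hin).2⟩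
      · simpa [wordE] using (hτ i hi hin).1
      · simpa [wordF] using wordF_eq_none_of_wordPhi (hτ i hi hin).2
    | cons y x ih =>
      simp only [List.map_cons, List.cons_append, colWord]
      rw [wordE, wordF, wordPhi_cons_of_neutral _ f1 g1, wordE_cons_of_eps_eq_zero _ g1,
        wordF_cons_of_neutral _ f1 g1, wordPhi, wordPhi_cons_of_neutral _ f1 g1, ih.1, ih.2.1,
        ih.2.2, wordE, wordF, wordPhi]
      refine ⟨?_, ?_, rfl⟩
      · split_ifs <;> simp only [Option.map_map] <;> rfl
      · split_ifs <;> simp only [Option.map_map] <;> rfl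
  · intro x hx
    obtain ⟨h1, h2, -, -, h3⟩ := isKN_iff.1 hx
    simp only [List.mem_append] at h1 h3
    rw [List.pairwise_append, List.pairwise_map] at h2
    refine ⟨h2.1.imp fun h => h.2, fun y hy => ?_⟩
    have hy' : (1, y) ∈ x.map (fun y => ((1 : ℤ), y)) := List.mem_map.2 ⟨y, hy, rfl⟩
    have hc := h1 (1, y) (Or.inl hy')
    refine ⟨hc.1.2, fun h => hc.2 (Or.inl h), ?_⟩
    rintro rfl
    exact h3 (Or.inl hy')

theorem stripEmb_bottom {n : ℕ} (hn : 4 ≤ n) :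
    StripEmb n (fun x => x.map (fun y => (y, -1))) := by
  refine StripEmb.of_colWord ?_ ?_
  · intro i x hi hin
    have f1 := letterPhi_neg_one hn hi
    have g1 := letterEps_neg_one hn hi
    suffices wordE n i (colWord (x.map (fun y => (y, (-1 : ℤ))))) =
          (wordE n i x).map (fun x => colWord (x.map (fun y => (y, (-1 : ℤ))))) ∧
        wordF n i (colWord (x.map (fun y => (y, (-1 : ℤ))))) =
          (wordF n i x).map (fun x => colWord (x.map (fun y => (y, (-1 : ℤ))))) ∧
        wordPhi n i (colWord (x.map (fun y => (y, (-1 : ℤ))))) = wordPhi n i x from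
      ⟨this.1, this.2.1⟩
    induction x with
    | nil => exact ⟨rfl, rfl, rfl⟩
    | cons y x ih =>
      simp only [List.map_cons, colWord]
      rw [wordPhi_cons_of_neutral _ f1 g1,
        wordE_cons_of_eps_eq_zero _ g1, wordF_cons_of_neutral _ f1 g1, wordE, wordF, wordPhi,
        ih.1, ih.2.1, ih.2.2, wordE, wordF, wordPhi]
      refine ⟨?_, ?_, rfl⟩
      · split_ifs <;> simp only [Option.map_map] <;> rfl
      · split_ifs <;> simp only [Option.map_map] <;> rfl
  · intro x hx
    obtain ⟨h1, h2, -, -, h3⟩ := isKN_iff.1 hx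
    rw [List.pairwise_map] at h2
    refine ⟨h2.imp fun h => h.1, fun y hy => ?_⟩
    have hy' : (y, -1) ∈ x.map (fun y => (y, (-1 : ℤ))) := List.mem_map.2 ⟨y, hy, rfl⟩
    have hc := h1 (y, -1) hy'
    refine ⟨hc.1.1, ?_, fun h => hc.2 (Or.inl h.symm)⟩
    rintro rfl
    exact h3 hy'

theorem StripEmb.eq_replicate {n : ℕ} (hn : 4 ≤ n) {A : List ℤ → List (ℤ × ℤ)}
    (hA : StripEmb n A) {x : List ℤ} (hx : IsKN n (A x))
    (h : ∀ i, 2 ≤ i → i ≤ n → wordE n i x = none) : x = List.replicate x.length 2 := by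
  obtain ⟨h1, h2⟩ := hA.sorted x hx
  clear hx
  induction x with
  | nil => rfl
  | cons y x ih =>
    rw [List.pairwise_cons] at h1
    have ht := ih (fun i hi hin => (wordE_cons_eq_none (h i hi hin)).2) h1.2
      fun z hz => h2 z (by simp [hz])
    obtain ⟨hy1, hy2, hy3⟩ := h2 y (by simp)
    suffices y = 2 by rw [List.length_cons, List.replicate_succ, ← ht, this]
    have l1 := hy1.bounds
    cases x with
    | nil =>
      have := hy1.range_of_eps (k := 2) (by omega) fun i hi hin => by
        simpa [wordPhi] using (wordE_cons_eq_none (h i hi hin)).1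
      omega
    | cons z x =>
      have hz : z = 2 := by
        rw [List.length_cons, List.replicate_succ] at ht
        exact (List.cons.inj ht).1
      have hyz := h1.1 z (by simp)
      have e1 := height_cases n y
      have e2 := height_cases n 2
      subst hz
      unfold leLetter ltLetter at hyz
      omega

/-! ## The involution `σ` -/

theorem path_cons_eq_some {n s i : ℕ} {l : List ℕ} {u b : Tab n s} :
    path (i :: l) u = some b ↔ ∃ c, path l u = some c ∧ clF i c = some b := by
  rw [path, Option.bind_eq_some_iff]

theorem wt_path {n s : ℕ} (hn : 4 ≤ n) {l : List ℕ} (hl : ∀ i ∈ l, 2 ≤ i ∧ i ≤ n)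
    {u b : Tab n s} (h : path l u = some b) : wt b 1 = wt u 1 := by
  induction l generalizing b with
  | nil => rw [Option.some.inj h]
  | cons i l ih =>
    obtain ⟨c, hc, hb⟩ := path_cons_eq_some.1 h
    have hi := (hl i (by simp)).1
    rw [clF_eq_some_iff hn (by omega)] at hb
    have := wt_clE hn (by omega) hb
    rw [if_neg (by omega)] at this
    rw [← ih (fun j hj => hl j (by simp [hj])) hc, this, add_zero]

/-- The colours 2, …, n leave the coefficient of ε₁ alone, and σ̌ negates it by `rank_eq`. This
needs no uniqueness of σ, so bounds on 0-strings follow without evaluating it. -/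
theorem wt_sigmaRel {n s : ℕ} (hn : 4 ≤ n) {b b' : Tab n s} (h : SigmaRel b b') :
    wt b' 1 = -wt b 1 := by
  obtain ⟨u, u', l, hl, ⟨-, -, -, hr, -⟩, h1, h2⟩ := h
  rw [wt_path hn hl h1, wt_path hn hl h2]
  rw [rank_eq, rank_eq] at hr
  omega

theorem wt_sigma {n s : ℕ} (hn : 4 ≤ n) {b b' : Tab n s} (h : sigma b = some b') :
    wt b' 1 = -wt b 1 := by
  unfold sigma at h
  split_ifs at h with h0
  rw [← Option.some.inj h]
  exact wt_sigmaRel hn h0.choose_spec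

theorem sigma_eq_some {n s : ℕ} {b b' : Tab n s} (h : SigmaRel b b')
    (h' : ∀ c, SigmaRel b c → c = b') : sigma b = some b' := by
  have h0 : ∃ c, SigmaRel b c := ⟨b', h⟩
  rw [sigma, dif_pos h0]
  exact congrArg some (h' _ h0.choose_spec)

theorem path_eq_some_of_isBranchHW {n s : ℕ} (hn : 4 ≤ n) {l : List ℕ}
    (hl : ∀ i ∈ l, 2 ≤ i ∧ i ≤ n) {u b : Tab n s} (hb : IsBranchHW b) (h : path l u = some b) :
    l = [] ∧ u = b := by
  cases l with
  | nil => exact ⟨rfl, Option.some.inj h⟩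
  | cons i l =>
    obtain ⟨c, -, hc⟩ := path_cons_eq_some.1 h
    obtain ⟨hi, hin⟩ := hl i (by simp)
    rw [clF_eq_some_iff hn (by omega), hb i hi hin] at hc
    simp at hc

theorem sigma_of_isBranchHW {n s : ℕ} (hn : 4 ≤ n) {u v : Tab n s} (h : CheckSigma u v)
    (h' : ∀ w, CheckSigma u w → w = v) : sigma u = some v := by
  refine sigma_eq_some ⟨u, v, [], by simp, h, rfl, rfl⟩ ?_
  rintro c ⟨w, w', l, hl, hw, h1, h2⟩
  obtain ⟨rfl, rfl⟩ := path_eq_some_of_isBranchHW hn hl h.1 h1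
  rw [← Option.some.inj h2]
  exact h' _ hw

section Strip

variable {n s : ℕ} {A B : List ℤ → List (ℤ × ℤ)}

/-- The e_i act in parallel on `A x` and `B x`, so raising `x` to a word of letters 2 yields one
path that serves both vertices. -/
theorem StripEmb.exists_path (hn : 4 ≤ n) (hA : StripEmb n A) (hB : StripEmb n B)
    (x : List ℤ) (b b' : Tab n s) (hb : drop b = A x) (hb' : drop b' = B x) :
    ∃ (u u' : Tab n s) (l : List ℕ), (∀ i ∈ l, 2 ≤ i ∧ i ≤ n) ∧
      drop u = A (List.replicate x.length 2) ∧ drop u' = B (List.replicate x.length 2) ∧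
      path l u = some b ∧ path l u' = some b' := by
  induction hN : ht b using Nat.strong_induction_on generalizing b b' x with
  | _ N ih =>
    by_cases h : ∀ i, 2 ≤ i → i ≤ n → wordE n i x = none
    · have hx := hA.eq_replicate hn (hb ▸ isKN_drop hn b) h
      exact ⟨b, b', [], by simp, by rwa [← hx], by rwa [← hx], rfl, rfl⟩
    · push Not at h
      obtain ⟨i, hi, hin, h0⟩ := h
      obtain ⟨y, hy⟩ := Option.ne_none_iff_exists'.1 h0
      have h1 : TypeD.knE n i (drop b) = some (A y) := by rw [hb, hA.knE i x hi hin, hy]; rfl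
      have h2 : TypeD.knE n i (drop b') = some (B y) := by rw [hb', hB.knE i x hi hin, hy]; rfl
      obtain ⟨c, hc, hcA⟩ := exists_clE hn (by omega) h1
      obtain ⟨c', hc', hcB⟩ := exists_clE hn (by omega) h2
      have hlt := ht_clE hn (by omega) hc
      obtain ⟨u, u', l, hl, hu, hu', hp, hp'⟩ := ih (ht c) (by omega) y c c' hcA hcB rfl
      rw [length_wordE hy] at hu hu'
      refine ⟨u, u', i :: l, ?_, hu, hu', ?_, ?_⟩
      · intro j hj
        rcases List.mem_cons.1 hj with rfl | hj
        exacts [⟨hi, hin⟩, hl j hj]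
      · exact path_cons_eq_some.2 ⟨c, hp, (clF_eq_some_iff hn (by omega)).2 hc⟩
      · exact path_cons_eq_some.2 ⟨c', hp', (clF_eq_some_iff hn (by omega)).2 hc'⟩

/-- `SigmaRel` admits any path from a highest weight vector; this shows that the value of σ does not
depend on it. -/
theorem StripEmb.path_unique (hn : 4 ≤ n) (hA : StripEmb n A) (hB : StripEmb n B)
    {l : List ℕ} (hl : ∀ i ∈ l, 2 ≤ i ∧ i ≤ n) {x : List ℤ} {u b : Tab n s}
    (hu : IsBranchHW u) (h : path l u = some b) (hb : drop b = A x) :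
    drop u = A (List.replicate x.length 2) ∧
    ∀ u' b' : Tab n s, drop u' = B (List.replicate x.length 2) → path l u' = some b' →
      drop b' = B x := by
  induction l generalizing b x with
  | nil =>
    obtain rfl := Option.some.inj h
    have hx : x = List.replicate x.length 2 := by
      refine hA.eq_replicate hn (hb ▸ isKN_drop hn u) fun i hi hin => ?_
      have h1 := (clE_eq_none hn (by omega)).1 (hu i hi hin)
      rw [hb, hA.knE i x hi hin] at h1
      exact Option.map_eq_none_iff.1 h1
    refine ⟨by rwa [← hx], fun u' b' hu' hp => ?_⟩
    rw [← Option.some.inj hp, hu', ← hx]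
  | cons i l ih =>
    obtain ⟨c, hc, hcb⟩ := path_cons_eq_some.1 h
    obtain ⟨hi, hin⟩ := hl i (by simp)
    have h1 := (clE_eq_some hn).1 ((clF_eq_some_iff hn (by omega)).1 hcb)
    rw [hb, hA.knE i x hi hin] at h1
    obtain ⟨y, hy, hcy⟩ := Option.map_eq_some_iff.1 h1
    obtain ⟨h2, h3⟩ := ih (fun j hj => hl j (by simp [hj])) hc hcy.symm
    rw [length_wordE hy] at h2 h3
    refine ⟨h2, fun u' b' hu' hp => ?_⟩
    obtain ⟨c', hc', hcb'⟩ := path_cons_eq_some.1 hp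
    have h4 := (clF_eq_some hn).1 hcb'
    rw [h3 u' c' hu' hc', hB.knF i y hi hin, (wordF_of_wordE hn (by omega) hy).1] at h4
    exact (Option.some.inj h4).symm

theorem StripEmb.sigma_eq (hn : 4 ≤ n) (hA : StripEmb n A) (hB : StripEmb n B)
    {x : List ℤ} {b b' : Tab n s} (hb : drop b = A x) (hb' : drop b' = B x)
    (h : ∀ u v : Tab n s, drop u = A (List.replicate x.length 2) →
      (CheckSigma u v ↔ drop v = B (List.replicate x.length 2))) : sigma b = some b' := by
  obtain ⟨u, u', l, hl, hu, hu', hp, hp'⟩ := hA.exists_path hn hB x b b' hb hb'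
  refine sigma_eq_some ⟨u, u', l, hl, (h u u' hu).2 hu', hp, hp'⟩ ?_
  rintro c ⟨w, w', l', hl', hw, h1, h2⟩
  obtain ⟨h3, h4⟩ := hA.path_unique hn hB hl' hw.1 h1 hb
  exact drop_injective hn ((h4 w' c ((h w w' h3).1 hw) h2).trans hb'.symm)

end Strip

/-! ### Values of σ̌ and σ on the components that are needed. -/

theorem wt_of_drop_eq {n s : ℕ} (hn : 4 ≤ n) {T : Tab n s} {p a c d : ℕ}
    (h : drop T = fourBlock p a c d) :
    wt T 1 = p + a - d ∧ wt T 2 = p - a + d ∧ ∀ j, 3 ≤ j → wt T j = 0 := by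
  have := wordWt_fourBlock p a c d
  refine ⟨?_, ?_, fun j hj => ?_⟩
  · rw [wt_eq_drop hn, h, this.1]
  · rw [wt_eq_drop hn, h, this.2.1]
  · rw [wt_eq_drop hn, h, this.2.2 j hj]

/-- Equal rank means equal coefficient ±k of ε₁, and B(ℓϖ₂) has no such weight for ℓ < k. -/
theorem minComp_eq {n s k : ℕ} (hn : 4 ≤ n) {u w : Tab n s} (hw : IsBranchHW w)
    (h1 : SameShape w u) (h2 : wt w 1 = wt u 1) (h3 : comp w = k)
    (h4 : wt u 1 = k ∨ wt u 1 = -k) : minComp u = k := by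
  have hmem : k ∈ {l | ∃ w : Tab n s, IsBranchHW w ∧ SameShape w u ∧ rank w = rank u ∧
      comp w = l} := ⟨w, hw, h1, by rw [rank_eq, rank_eq, h2], h3⟩
  refine le_antisymm (Nat.sInf_le hmem) (le_csInf ⟨k, hmem⟩ ?_)
  rintro l ⟨w', -, -, h5, rfl⟩
  rw [rank_eq, rank_eq] at h5
  have := abs_wt_le_comp hn w'
  omega

/-- The branching components of weight `±kε₁ + kε₂` occur in `B(ℓϖ₂)` for `ℓ ≥ k` only. -/
theorem minComp_of_drop_eq {n s : ℕ} (hn : 4 ≤ n) {u : Tab n s} {p a c d : ℕ}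
    (h : drop u = fourBlock p a c d) (hp : p = 0 ∨ a = d) (had : a ≤ d) :
    minComp u = p + (d - a) := by
  have hlen := length_drop_le hn u
  rw [h, length_fourBlock] at hlen
  have hu := wt_of_drop_eq hn h
  rcases hp with rfl | rfl
  · obtain ⟨w, hw⟩ := exists_drop_eq (s := s) hn
      (isKN_fourBlock hn 0 0 0 (d - a) (by omega)) (by rw [length_fourBlock]; omega)
    have hw' := wt_of_drop_eq hn hw
    refine minComp_eq hn (isBranchHW_of_drop_eq hn hw (by omega)) (fun j hj hjn => ?_) ?_ ?_ ?_
    · rcases Nat.eq_or_lt_of_le hj with rfl | hj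
      · rw [hu.2.1, hw'.2.1]; omega
      · rw [hu.2.2 j hj, hw'.2.2 j hj]
    · rw [hu.1, hw'.1]; omega
    · rw [comp, hw, length_fourBlock]
    · rw [hu.1]; omega
  · obtain ⟨w, hw⟩ := exists_drop_eq (s := s) hn
      (isKN_fourBlock hn p 0 0 0 (by omega)) (by rw [length_fourBlock]; omega)
    have hw' := wt_of_drop_eq hn hw
    refine minComp_eq hn (isBranchHW_of_drop_eq hn hw (by omega)) (fun j hj hjn => ?_) ?_ ?_ ?_
    · rcases Nat.eq_or_lt_of_le hj with rfl | hj
      · rw [hu.2.1, hw'.2.1]; omega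
      · rw [hu.2.2 j hj, hw'.2.2 j hj]
    · rw [hu.1, hw'.1]; omega
    · rw [comp, hw, length_fourBlock]; omega
    · rw [hu.1]; omega

/-- `σ̌` on the branching components of weight `±kε₁ + kε₂`. -/
theorem checkSigma_iff {n s : ℕ} (hn : 4 ≤ n) {u v : Tab n s} {p a c d p' a' c' d' : ℕ}
    (h : drop u = fourBlock p a c d) (hp : p = 0 ∨ a = d) (had : a ≤ d)
    (h1 : p' + a' + p + a = d + d') (h2 : p' + d' + a = a' + p + d)
    (h3 : p' + a' + c' + d' + (a + c + d) = s + (d - a)) (hc : c' ≤ 1) (had' : a' ≤ d') :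
    CheckSigma u v ↔ drop v = fourBlock p' a' c' d' := by
  have hu := wt_of_drop_eq hn h
  have hm := minComp_of_drop_eq hn h hp had
  have hcu : comp u = p + a + c + d := by rw [comp, h, length_fourBlock]
  constructor
  · rintro ⟨-, hv, hs, hr, hcv⟩
    obtain ⟨p₁, a₁, c₁, d₁, hc₁, hv₁⟩ := eq_fourBlock_of_branch_highest hn (isKN_drop hn v)
      (fun i hi hin => (clE_eq_none hn (by omega)).1 (hv i hi hin))
      (by rw [← wt_eq_drop hn, ← hs 3 (by omega) (by omega), hu.2.2 3 le_rfl])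
    have hv' := wt_of_drop_eq hn hv₁
    have e1 := hs 2 le_rfl (by omega)
    have e2 : comp v = p₁ + a₁ + c₁ + d₁ := by rw [comp, hv₁, length_fourBlock]
    rw [rank_eq, rank_eq, hu.1, hv'.1] at hr
    rw [hu.2.1, hv'.2.1] at e1
    -- The two weights give p and a - d; the number of columns then gives 2a + c, and c ≤ 1 is its
    -- parity.
    obtain rfl : p₁ = p' := by omega
    obtain rfl : c₁ = c' := by omega
    obtain rfl : a₁ = a' := by omega
    obtain rfl : d₁ = d' := by omega
    exact hv₁
  · intro hv
    have hv' := wt_of_drop_eq hn hv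
    refine ⟨isBranchHW_of_drop_eq hn h had, isBranchHW_of_drop_eq hn hv had', fun j hj hjn => ?_,
      ?_, ?_⟩
    · rcases Nat.eq_or_lt_of_le hj with rfl | hj
      · rw [hu.2.1, hv'.2.1]; omega
      · rw [hu.2.2 j hj, hv'.2.2 j hj]
    · rw [rank_eq, rank_eq, hu.1, hv'.1]; omega
    · rw [hcu, hm, comp, hv, length_fourBlock]; omega

/-- Here u_k has weight k(ε₁+ε₂), so ℓ = k, and σ̌ leads to B(sϖ₂) and the weight k(-ε₁+ε₂). The
only highest weight vector there is the stated one. -/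
theorem sigma_highest {n s : ℕ} (hn : 4 ≤ n) {k a c : ℕ} (hs : 2 * a + c + k = s) (hc : c ≤ 1)
    {u v : Tab n s} (hu : drop u = fourBlock k 0 0 0) (hv : drop v = fourBlock 0 a c (a + k)) :
    sigma u = some v ∧ sigma v = some u := by
  have h1 : ∀ w : Tab n s, CheckSigma u w ↔ drop w = fourBlock 0 a c (a + k) := fun w =>
    checkSigma_iff hn hu (Or.inr rfl) le_rfl (by omega) (by omega) (by omega) hc (by omega)
  have h2 : ∀ w : Tab n s, CheckSigma v w ↔ drop w = fourBlock k 0 0 0 := fun w =>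
    checkSigma_iff hn hv (Or.inl rfl) (by omega) (by omega) (by omega) (by omega) (by omega)
      le_rfl
  exact ⟨sigma_of_isBranchHW hn ((h1 v).2 hv)
      fun w hw => drop_injective hn (((h1 w).1 hw).trans hv.symm),
    sigma_of_isBranchHW hn ((h2 u).2 hu)
      fun w hw => drop_injective hn (((h2 w).1 hw).trans hu.symm)⟩

theorem map_top_replicate_append (k a c d : ℕ) :
    (List.replicate k (2 : ℤ)).map (fun y => ((1 : ℤ), y)) ++ fourBlock 0 a c d =
      fourBlock k a c d := by
  simp [fourBlock]

theorem map_top_replicate_append' (k a c d : ℕ) :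
    (List.replicate k (-2 : ℤ)).map (fun y => ((1 : ℤ), y)) ++ fourBlock 0 a c d =
      fourBlock 0 (k + a) c d := by
  simp only [fourBlock, List.map_replicate, List.replicate_zero, List.nil_append,
    List.replicate_add, List.append_assoc]

/-- l_k is not D_{n-1}-highest. Without its letters 1̄ it is a row of letters 2̄; σ puts that row
under letters 1 and appends the D_{n-1}-invariant tail `fourBlock 0 a c a`. -/
theorem sigma_lowest {n s : ℕ} (hn : 4 ≤ n) {k a c : ℕ} (hs : 2 * a + c + k = s) (hc : c ≤ 1)
    {u v : Tab n s} (hu : drop u = List.replicate k (-2, -1))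
    (hv : drop v = fourBlock 0 (k + a) c a) :
    sigma u = some v ∧ sigma v = some u := by
  have hτ : ∀ i, 2 ≤ i → i ≤ n → wordE n i (colWord (fourBlock 0 a c a)) = none ∧
      wordPhi n i (colWord (fourBlock 0 a c a)) = 0 := by
    intro i hi _
    rcases Nat.eq_or_lt_of_le hi with rfl | hi
    · simpa using wordPhi_two_fourBlock hn 0 a c a le_rfl
    · exact wordPhi_fourBlock hn hi 0 a c a
  have hA := stripEmb_top hn hτ
  have hB := stripEmb_bottom hn
  have hbot : (List.replicate k (2 : ℤ)).map (fun y => (y, (-1 : ℤ))) = fourBlock 0 0 0 k := by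
    simp [fourBlock]
  have hu' : drop u = (List.replicate k (-2 : ℤ)).map (fun y => (y, (-1 : ℤ))) := by
    rw [hu, List.map_replicate]
  rw [← map_top_replicate_append'] at hv
  constructor
  · refine hB.sigma_eq hn hA hu' hv fun w w' hw => ?_
    rw [List.length_replicate] at hw ⊢
    rw [hbot] at hw
    rw [map_top_replicate_append]
    exact checkSigma_iff hn hw (Or.inl rfl) (by omega) (by omega) (by omega) (by omega) hc le_rfl
  · refine hA.sigma_eq hn hB hv hu' fun w w' hw => ?_
    rw [List.length_replicate] at hw ⊢
    rw [map_top_replicate_append] at hw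
    rw [hbot]
    exact checkSigma_iff hn hw (Or.inr rfl) le_rfl (by omega) (by omega) (by omega) (by omega)
      (by omega)

theorem isKN_replicate_lowest {n : ℕ} (hn : 4 ≤ n) (k : ℕ) :
    IsKN n (List.replicate k (-2, -1)) := by
  have e1 := height_cases n (-2)
  have e2 := height_cases n (-1)
  have e3 := height_cases n 1
  have hT : IsTableau n (List.replicate k (-2, -1)) := by
    rw [isTableau_iff]
    refine ⟨fun x hx => ?_, List.pairwise_replicate.2 (Or.inr ⟨leLetter.refl _ _,
      leLetter.refl _ _⟩), List.pairwise_replicate.2 (Or.inr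
        (compatible_of_fst_le hn (by norm_num) _))⟩
    rw [List.eq_of_mem_replicate hx]
    refine ⟨⟨isLetter_of_bounds ?_, isLetter_of_bounds ?_⟩, ?_⟩
    · dsimp only; omega
    · dsimp only; omega
    · unfold leLetter ltLetter; dsimp only; omega
  have := (isKN_split_iff (P := []) (N := List.replicate k (-2, -1)) (m := 0) (a := 0) (by simp)
    (fun x hx => ?_) (by simpa using hT)).2 (Or.inl rfl)
  · simpa using this
  · rw [List.eq_of_mem_replicate hx]
    unfold IsNeg
    norm_num
    omega

/-! ## Generalities on `ε_i`, `φ_i` and tensor products -/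

section Strings

variable {I B : Type*} (C : CrystalOps I B) (i : I)

theorem iter_succ (g : B → Option B) (k : ℕ) (b : B) :
    iter g (k + 1) b = (g b).bind (iter g k) := rfl

theorem le_sSup_iter {g : B → Option B} {b : B} {N k : ℕ}
    (hN : ∀ k, iter g k b ≠ none → k ≤ N) (hk : iter g k b ≠ none) :
    k ≤ sSup {k | iter g k b ≠ none} := le_csSup ⟨N, fun _ h => hN _ h⟩ hk

theorem sSup_iter_le {g : B → Option B} {b : B} {N : ℕ}
    (hN : ∀ k, iter g k b ≠ none → k ≤ N) : sSup {k | iter g k b ≠ none} ≤ N :=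
  csSup_le ⟨0, by simp [iter]⟩ fun _ h => hN _ h

variable {C i}

/-- The supremum of an unbounded set of naturals is 0, so positivity already gives a bounded string,
whose length is attained. -/
theorem CrystalOps.exists_e_of_eps_pos {b : B} (h : 0 < C.eps i b) :
    ∃ b', C.e i b = some b' ∧ C.eps i b' < C.eps i b := by
  unfold CrystalOps.eps at h ⊢
  have hbdd : BddAbove {k | iter (C.e i) k b ≠ none} := by
    by_contra h0
    rw [Nat.sSup_of_not_bddAbove h0] at h
    exact lt_irrefl _ h
  have hmem := Nat.sSup_mem ⟨0, by simp [iter]⟩ hbdd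
  obtain ⟨m, hm⟩ : ∃ m, sSup {k | iter (C.e i) k b ≠ none} = m + 1 :=
    ⟨_, (Nat.succ_pred_eq_of_pos h).symm⟩
  rw [hm, Set.mem_ofPred_eq, iter_succ] at hmem
  cases hb : C.e i b with
  | none => simp [hb] at hmem
  | some b' =>
    refine ⟨b', rfl, Nat.lt_of_le_of_lt (sSup_iter_le (N := m) fun k hk => ?_)
      (by rw [hm]; exact Nat.lt_succ_self m)⟩
    have : k + 1 ≤ sSup {k | iter (C.e i) k b ≠ none} :=
      le_csSup hbdd (by rw [Set.mem_ofPred_eq, iter_succ, hb]; exact hk)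
    omega

theorem CrystalOps.tensor_e_left {B₁ : Type*} {C₁ : CrystalOps I B₁} {b : B} {b₁ : B₁}
    (h : C₁.phi i b₁ < C.eps i b) : ∃ b', C.e i b = some b' ∧ C.eps i b' < C.eps i b ∧
      (C.tensor C₁).e i (b, b₁) = some (b', b₁) := by
  obtain ⟨b', hb', hlt⟩ := CrystalOps.exists_e_of_eps_pos (Nat.zero_lt_of_lt h)
  refine ⟨b', hb', hlt, ?_⟩
  simp only [CrystalOps.tensor]
  rw [if_pos h, hb']
  rfl

theorem CrystalOps.tensor_e_right {B₁ : Type*} {C₁ : CrystalOps I B₁} {b : B} {b₁ b' : B₁}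
    (h : ¬ C₁.phi i b₁ < C.eps i b) (hb : C₁.e i b₁ = some b') :
      (C.tensor C₁).e i (b, b₁) = some (b, b') := by
  simp only [CrystalOps.tensor]
  rw [if_neg h, hb]
  rfl

end Strings

/-! ## The affine operators -/

section Affine

variable {n s : ℕ}

theorem B2_e_of_ne_zero {i : Fin (n + 1)} (hi : i ≠ 0) (T : Tab n s) :
    (B2 n s).e i T = clE i T := if_neg hi

theorem B2_f_of_ne_zero {i : Fin (n + 1)} (hi : i ≠ 0) (T : Tab n s) :
    (B2 n s).f i T = clF i T := if_neg hi

theorem B2_e_zero {T H H' T' : Tab n s} (h1 : sigma T = some H) (h2 : clE 1 H = some H')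
    (h3 : sigma H' = some T') : (B2 n s).e 0 T = some T' := by
  simp [B2, h1, h2, h3]

theorem wt_B2_e_zero (hn : 4 ≤ n) {T T' : Tab n s} (h : (B2 n s).e 0 T = some T') :
    wt T' 1 = wt T 1 - 1 := by
  simp only [B2, if_true, Option.bind_eq_some_iff] at h
  obtain ⟨H', ⟨H, h1, h2⟩, h3⟩ := h
  have e1 := wt_sigma hn h1
  have e2 := wt_clE hn le_rfl h2
  have e3 := wt_sigma hn h3
  rw [if_pos rfl] at e2
  omega

theorem wt_B2_f_zero (hn : 4 ≤ n) {T T' : Tab n s} (h : (B2 n s).f 0 T = some T') :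
    wt T' 1 = wt T 1 + 1 := by
  simp only [B2, if_true, Option.bind_eq_some_iff] at h
  obtain ⟨H', ⟨H, h1, h2⟩, h3⟩ := h
  rw [clF_eq_some_iff hn le_rfl] at h2
  have e1 := wt_sigma hn h1
  have e2 := wt_clE hn le_rfl h2
  have e3 := wt_sigma hn h3
  rw [if_pos rfl] at e2
  omega

theorem abs_wt_le (hn : 4 ≤ n) (T : Tab n s) : -(s : ℤ) ≤ wt T 1 ∧ wt T 1 ≤ s := by
  have h1 := abs_wt_le_comp hn T
  have h2 : comp T ≤ s := length_drop_le hn T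
  omega

/-! ### Bounds on string lengths. -/

theorem iter_e_zero_le (hn : 4 ≤ n) {T : Tab n s} {k : ℕ}
    (h : iter ((B2 n s).e 0) k T ≠ none) : (k : ℤ) ≤ s + wt T 1 := by
  induction k generalizing T with
  | zero =>
    have := abs_wt_le hn T
    omega
  | succ k ih =>
    rw [iter_succ] at h
    cases hT : (B2 n s).e 0 T with
    | none => simp [hT] at h
    | some T' =>
      rw [hT] at h
      have h1 := ih h
      have h2 := wt_B2_e_zero hn hT
      omega

theorem iter_f_zero_le (hn : 4 ≤ n) {T : Tab n s} {k : ℕ}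
    (h : iter ((B2 n s).f 0) k T ≠ none) : (k : ℤ) ≤ s - wt T 1 := by
  induction k generalizing T with
  | zero =>
    have := abs_wt_le hn T
    omega
  | succ k ih =>
    rw [iter_succ] at h
    cases hT : (B2 n s).f 0 T with
    | none => simp [hT] at h
    | some T' =>
      rw [hT] at h
      have h1 := ih h
      have h2 := wt_B2_f_zero hn hT
      omega

theorem iter_e_le_ht (hn : 4 ≤ n) {i : Fin (n + 1)} (hi : i ≠ 0) {T : Tab n s} {k : ℕ}
    (h : iter ((B2 n s).e i) k T ≠ none) : k ≤ ht T := by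
  induction k generalizing T with
  | zero => exact Nat.zero_le _
  | succ k ih =>
    rw [iter_succ, B2_e_of_ne_zero hi] at h
    cases hT : clE i T with
    | none => simp [hT] at h
    | some T' =>
      rw [hT] at h
      have h1 := ih h
      have h2 := ht_clE hn (Nat.one_le_iff_ne_zero.2 (Fin.val_ne_zero_iff.2 hi)) hT
      omega

theorem eps_pos_of_clE (hn : 4 ≤ n) {i : Fin (n + 1)} (hi : i ≠ 0) {T T' : Tab n s}
    (h : clE i T = some T') : 0 < (B2 n s).eps i T := by
  refine Nat.lt_of_lt_of_le Nat.one_pos (le_sSup_iter (fun k hk => iter_e_le_ht hn hi hk) ?_)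
  rw [iter_succ, B2_e_of_ne_zero hi, h]
  simp [iter]

theorem phi_uZero (hn : 4 ≤ n) {i : Fin (n + 1)} (hi : i ≠ 0) :
    (B2 n s).phi i (uZero n s hn) = 0 := by
  refine Nat.le_zero.1 (sSup_iter_le fun k hk => ?_)
  cases k with
  | zero => exact le_rfl
  | succ k =>
    rw [iter_succ, B2_f_of_ne_zero hi, clF, drop_uZero] at hk
    simp [knF, colWord, wordF] at hk

/-- The coefficient of ε₁ starts at 0, grows by one with each f₀ and cannot exceed s. -/
theorem phi_zero_uZero_le (hn : 4 ≤ n) : (B2 n s).phi 0 (uZero n s hn) ≤ s := by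
  refine sSup_iter_le fun k hk => ?_
  have h1 := iter_f_zero_le hn hk
  have h2 : wt (uZero n s hn) 1 = 0 := by
    rw [wt_eq_drop hn, drop_uZero]
    simp [colWord, wordWt]
  omega

theorem eq_uZero (hn : 4 ≤ n) {T : Tab n s} (h : drop T = []) : T = uZero n s hn :=
  drop_injective hn (h.trans (drop_uZero hn).symm)

theorem exists_half (m : ℕ) : ∃ a c, 2 * a + c = m ∧ c ≤ 1 :=
  ⟨m / 2, m % 2, by omega, by omega⟩

/-- `e₀` sends the highest weight vector of `B((k+1)ϖ₂)` to that of `B(kϖ₂)`. -/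
theorem e_zero_highest (hn : 4 ≤ n) {k : ℕ} {T : Tab n s} (hT : drop T = fourBlock (k + 1) 0 0 0) :
    ∃ T', (B2 n s).e 0 T = some T' ∧ drop T' = fourBlock k 0 0 0 := by
  have hk := length_drop_le hn T
  rw [hT, length_fourBlock] at hk
  -- σ T has a, c and a+k+1 columns (1,2̄), (2,2̄), (2,1̄). If c = 0, then e₁ turns a (2,1̄) into
  -- (2,2̄); if c = 1, it turns (2,2̄) into (1,2̄). Either way the result is σ of u_k.
  obtain ⟨a, c, hac, hc⟩ := exists_half (s - (k + 1))
  obtain ⟨H, hH⟩ := exists_drop_eq (s := s) hn (isKN_fourBlock hn 0 a c (a + (k + 1)) hc)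
    (by rw [length_fourBlock]; omega)
  obtain ⟨T', hT'⟩ := exists_drop_eq (s := s) hn (isKN_fourBlock hn k 0 0 0 (by omega))
    (by rw [length_fourBlock]; omega)
  have h1 := (sigma_highest hn (by omega) hc hT hH).1
  have key : ∀ a' c', 2 * a' + c' + k = s → c' ≤ 1 →
      knE n 1 (drop H) = some (fourBlock 0 a' c' (a' + k)) →
      ∃ T', (B2 n s).e 0 T = some T' ∧ drop T' = fourBlock k 0 0 0 := by
    intro a' c' h2 h3 h4
    obtain ⟨H', hHH', hH'⟩ := exists_clE hn le_rfl h4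
    exact ⟨T', B2_e_zero h1 hHH' (sigma_highest hn h2 h3 hT' hH').2, hT'⟩
  rcases Nat.eq_zero_or_pos c with rfl | hc0
  · refine key a 1 (by omega) le_rfl ?_
    rw [hH]
    exact (knE_one_fourBlock hn a (a + k)).2
  · obtain rfl : c = 1 := by omega
    refine key (a + 1) 0 (by omega) (by omega) ?_
    rw [hH, add_right_comm a 1 k]
    exact (knE_one_fourBlock hn a (a + (k + 1))).1

/-- `e₀` sends the lowest weight vector of `B(kϖ₂)` to that of `B((k+1)ϖ₂)`. -/
theorem e_zero_lowest (hn : 4 ≤ n) {k : ℕ} (hk : k < s) {T : Tab n s}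
    (hT : drop T = List.replicate k (-2, -1)) :
    ∃ T', (B2 n s).e 0 T = some T' ∧ drop T' = List.replicate (k + 1) (-2, -1) := by
  -- The same alternation of c, now with k+a, c and a columns (1,2̄), (2,2̄), (2,1̄); e₁ produces σ
  -- of l_{k+1}.
  obtain ⟨a, c, hac, hc⟩ := exists_half (s - k)
  obtain ⟨H, hH⟩ := exists_drop_eq (s := s) hn (isKN_fourBlock hn 0 (k + a) c a hc)
    (by rw [length_fourBlock]; omega)
  obtain ⟨T', hT'⟩ := exists_drop_eq (s := s) hn (isKN_replicate_lowest hn (k + 1))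
    (by rw [List.length_replicate]; omega)
  have h1 := (sigma_lowest hn (by omega) hc hT hH).1
  have key : ∀ a' c', 2 * a' + c' + (k + 1) = s → c' ≤ 1 →
      knE n 1 (drop H) = some (fourBlock 0 (k + 1 + a') c' a') →
      ∃ T', (B2 n s).e 0 T = some T' ∧ drop T' = List.replicate (k + 1) (-2, -1) := by
    intro a' c' h2 h3 h4
    obtain ⟨H', hHH', hH'⟩ := exists_clE hn le_rfl h4
    exact ⟨T', B2_e_zero h1 hHH' (sigma_lowest hn h2 h3 hT' hH').2, hT'⟩
  rcases Nat.eq_zero_or_pos c with rfl | hc0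
  · obtain ⟨a, rfl⟩ : ∃ b, a = b + 1 := ⟨a - 1, by omega⟩
    refine key a 1 (by omega) le_rfl ?_
    rw [hH, add_assoc k 1 a, add_comm 1 a]
    exact (knE_one_fourBlock hn (k + (a + 1)) a).2
  · obtain rfl : c = 1 := by omega
    refine key a 0 (by omega) (by omega) ?_
    rw [hH, add_right_comm k 1 a]
    exact (knE_one_fourBlock hn (k + a) a).1

theorem iter_e_zero_lowest (hn : 4 ≤ n) (d : ℕ) {k : ℕ} (hk : k + d = s) {T : Tab n s}
    (hT : drop T = List.replicate k (-2, -1)) : iter ((B2 n s).e 0) d T ≠ none := by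
  induction d generalizing k T with
  | zero => simp [iter]
  | succ d ih =>
    obtain ⟨T', h1, h2⟩ := e_zero_lowest hn (by omega) hT
    rw [iter_succ, h1]
    exact ih (by omega) h2

/-- k steps lead from u_k to u₀ = l₀, and s more from l₀ to l_s. -/
theorem iter_e_zero_highest (hn : 4 ≤ n) (k : ℕ) {T : Tab n s}
    (hT : drop T = fourBlock k 0 0 0) : iter ((B2 n s).e 0) (k + s) T ≠ none := by
  induction k generalizing T with
  | zero =>
    rw [Nat.zero_add]
    exact iter_e_zero_lowest hn s (Nat.zero_add s) hT
  | succ k ih =>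
    obtain ⟨T', h1, h2⟩ := e_zero_highest hn hT
    rw [Nat.add_right_comm, iter_succ, h1]
    exact ih h2

theorem le_eps_zero_highest (hn : 4 ≤ n) (k : ℕ) {T : Tab n s}
    (hT : drop T = fourBlock k 0 0 0) : k + s ≤ (B2 n s).eps 0 T := by
  refine le_sSup_iter (N := 2 * s) (fun k hk => ?_) (iter_e_zero_highest hn k hT)
  have h1 := iter_e_zero_le hn hk
  have h2 := abs_wt_le hn T
  omega

theorem drop_of_highest (hn : 4 ≤ n) {T : Tab n s} (h : ∀ i : Fin (n + 1), i ≠ 0 →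
    clE (s := s) i T = none) : ∃ k, drop T = fourBlock k 0 0 0 := by
  refine ⟨(drop T).length, ?_⟩
  have := eq_replicate_of_highest hn (isKN_drop hn T) fun i hi hin =>
    (clE_eq_none hn hi).1 (h ⟨i, by omega⟩ (by rw [ne_eq, Fin.ext_iff]; simp; omega))
  rw [this]
  simp [fourBlock]

/-! ## The tensor product -/

/-- One step with some `e_i` in the tensor square. -/
def Raises (n s : ℕ) (y z : Tab n s × Tab n s) : Prop :=
  ∃ i, ((B2 n s).tensor (B2 n s)).e i y = some z

/-- A colour is chosen that does not kill `b'`. It may act on either factor, but both outcomes lower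
the sum of the heights. -/
theorem raises_right_highest (hn : 4 ≤ n) (b b' : Tab n s) :
    ∃ (c c' : Tab n s) (k : ℕ), Relation.ReflTransGen (Raises n s) (b, b') (c, c') ∧
      drop c' = fourBlock k 0 0 0 := by
  induction hN : ht b + ht b' using Nat.strong_induction_on generalizing b b' with
  | _ N ih =>
    by_cases h : ∀ i : Fin (n + 1), i ≠ 0 → clE (s := s) i b' = none
    · obtain ⟨k, hk⟩ := drop_of_highest hn h
      exact ⟨b, b', k, Relation.ReflTransGen.refl, hk⟩
    · push Not at h
      obtain ⟨i, hi, h0⟩ := h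
      have hi1 : 1 ≤ (i : ℕ) := Nat.one_le_iff_ne_zero.2 (Fin.val_ne_zero_iff.2 hi)
      obtain ⟨d, hd⟩ := Option.ne_none_iff_exists'.1 h0
      by_cases hlt : (B2 n s).phi i b' < (B2 n s).eps i b
      · obtain ⟨e, he, -, hte⟩ := CrystalOps.tensor_e_left (C := B2 n s) (C₁ := B2 n s) hlt
        rw [B2_e_of_ne_zero hi] at he
        have := ht_clE hn hi1 he
        obtain ⟨c, c', k, h1, h2⟩ := ih (ht e + ht b') (by omega) e b' rfl
        exact ⟨c, c', k, Relation.ReflTransGen.head ⟨i, hte⟩ h1, h2⟩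
      · have hte := CrystalOps.tensor_e_right (C := B2 n s) (C₁ := B2 n s) hlt
          ((B2_e_of_ne_zero hi b').trans hd)
        have := ht_clE hn hi1 hd
        obtain ⟨c, c', k, h1, h2⟩ := ih (ht b + ht d) (by omega) b d rfl
        exact ⟨c, c', k, Relation.ReflTransGen.head ⟨i, hte⟩ h1, h2⟩

/-- Each time e₀ acts on the left, ε₀ of that factor drops while φ₀(b') stays fixed; so e₀
eventually acts on the right. -/
theorem raises_right_step (hn : 4 ≤ n) (b : Tab n s) {b' : Tab n s} {k : ℕ}
    (hb' : drop b' = fourBlock (k + 1) 0 0 0) :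
    ∃ c c' : Tab n s, Relation.ReflTransGen (Raises n s) (b, b') (c, c') ∧
      drop c' = fourBlock k 0 0 0 := by
  induction hN : (B2 n s).eps 0 b using Nat.strong_induction_on generalizing b with
  | _ N ih =>
    by_cases hlt : (B2 n s).phi 0 b' < (B2 n s).eps 0 b
    · obtain ⟨e, -, he, hte⟩ := CrystalOps.tensor_e_left (C := B2 n s) (C₁ := B2 n s) hlt
      obtain ⟨c, c', h1, h2⟩ := ih _ (hN ▸ he) e rfl
      exact ⟨c, c', Relation.ReflTransGen.head ⟨0, hte⟩ h1, h2⟩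
    · obtain ⟨d, hd, hd'⟩ := e_zero_highest hn hb'
      have hte := CrystalOps.tensor_e_right (C := B2 n s) (C₁ := B2 n s) hlt hd
      exact ⟨b, d, Relation.ReflTransGen.single ⟨0, hte⟩, hd'⟩

theorem raises_right_uZero (hn : 4 ≤ n) (k : ℕ) (b : Tab n s) {b' : Tab n s}
    (hb' : drop b' = fourBlock k 0 0 0) :
    ∃ c, Relation.ReflTransGen (Raises n s) (b, b') (c, uZero n s hn) := by
  induction k generalizing b b' with
  | zero => exact ⟨b, by rw [eq_uZero hn hb']⟩
  | succ k ih =>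
    obtain ⟨c, c', h1, h2⟩ := raises_right_step hn b hb'
    obtain ⟨d, h3⟩ := ih c h2
    exact ⟨d, h1.trans h3⟩

theorem raises_left_highest (hn : 4 ≤ n) (b : Tab n s) :
    ∃ (c : Tab n s) (k : ℕ),
      Relation.ReflTransGen (Raises n s) (b, uZero n s hn) (c, uZero n s hn) ∧
      drop c = fourBlock k 0 0 0 := by
  induction hN : ht b using Nat.strong_induction_on generalizing b with
  | _ N ih =>
    by_cases h : ∀ i : Fin (n + 1), i ≠ 0 → clE (s := s) i b = none
    · obtain ⟨k, hk⟩ := drop_of_highest hn h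
      exact ⟨b, k, Relation.ReflTransGen.refl, hk⟩
    · push Not at h
      obtain ⟨i, hi, h0⟩ := h
      have hi1 : 1 ≤ (i : ℕ) := Nat.one_le_iff_ne_zero.2 (Fin.val_ne_zero_iff.2 hi)
      obtain ⟨d, hd⟩ := Option.ne_none_iff_exists'.1 h0
      have hlt : (B2 n s).phi i (uZero n s hn) < (B2 n s).eps i b := by
        rw [phi_uZero hn hi]
        exact eps_pos_of_clE hn hi hd
      obtain ⟨e, he, -, hte⟩ := CrystalOps.tensor_e_left (C := B2 n s) (C₁ := B2 n s) hlt
      rw [B2_e_of_ne_zero hi] at he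
      have := ht_clE hn hi1 he
      obtain ⟨c, k, h1, h2⟩ := ih (ht e) (by omega) e rfl
      exact ⟨c, k, Relation.ReflTransGen.head ⟨i, hte⟩ h1, h2⟩

/-- For k > 0, ε₀(u_k) ≥ k + s > s ≥ φ₀(u₀), so e₀ cannot move the right factor away from u₀. -/
theorem raises_left_uZero (hn : 4 ≤ n) (k : ℕ) {b : Tab n s} (hb : drop b = fourBlock k 0 0 0) :
    Relation.ReflTransGen (Raises n s) (b, uZero n s hn) (uZero n s hn, uZero n s hn) := by
  induction k generalizing b with
  | zero => rw [eq_uZero hn hb]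
  | succ k ih =>
    have h1 := le_eps_zero_highest hn _ hb
    have h2 := phi_zero_uZero_le (s := s) hn
    obtain ⟨e, he, -, hte⟩ := CrystalOps.tensor_e_left (C := B2 n s) (C₁ := B2 n s) (i := 0)
      (b := b) (b₁ := uZero n s hn) (by omega)
    obtain ⟨e', he', hd⟩ := e_zero_highest hn hb
    obtain rfl := Option.some.inj (he.symm.trans he')
    exact Relation.ReflTransGen.head ⟨0, hte⟩ (ih hd)

theorem raises_uZero (hn : 4 ≤ n) (x : Tab n s × Tab n s) :
    Relation.ReflTransGen (Raises n s) x (uZero n s hn, uZero n s hn) := by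
  obtain ⟨b, b'⟩ := x
  obtain ⟨c, c', k, h1, h2⟩ := raises_right_highest hn b b'
  obtain ⟨d, h3⟩ := raises_right_uZero hn k c h2
  obtain ⟨e, j, h4, h5⟩ := raises_left_highest hn d
  exact h1.trans (h3.trans (h4.trans (raises_left_uZero hn j h5)))

end Affine

end TypeD

theorem lemma7p1 (n s : ℕ) (hn : 4 ≤ n) (hs : 1 ≤ s) :
    ((TypeD.B2 n s).tensor (TypeD.B2 n s)).Connected ∧
    ∀ x : TypeD.Tab n s × TypeD.Tab n s,
      Relation.ReflTransGen
        (fun y z => ∃ i, ((TypeD.B2 n s).tensor (TypeD.B2 n s)).e i y = some z)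
        x (TypeD.uZero n s hn, TypeD.uZero n s hn) := by
  have h := fun x => TypeD.raises_uZero (s := s) hn x
  have hE : ∀ x, Relation.EqvGen ((TypeD.B2 n s).tensor (TypeD.B2 n s)).Arrow x
      (TypeD.uZero n s hn, TypeD.uZero n s hn) := by
    intro x
    induction h x using Relation.ReflTransGen.head_induction_on with
    | refl => exact Relation.EqvGen.refl _
    | head hxy _ ih =>
      obtain ⟨i, hi⟩ := hxy
      exact Relation.EqvGen.trans _ _ _
        (Relation.EqvGen.symm _ _ (Relation.EqvGen.rel _ _ ⟨i, Or.inr hi⟩)) ih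
  exact ⟨⟨⟨(TypeD.uZero n s hn, TypeD.uZero n s hn)⟩, fun x y =>
    Relation.EqvGen.trans _ _ _ (hE x) (Relation.EqvGen.symm _ _ (hE y))⟩, h⟩
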